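/- Consider simple undirected graphs on the vertex set $\{1,\dots,n\}$, accessed in the general query model: a degree query on $v$ returns $\deg(v)$; a neighbor query on $(v,i)$, $i\in\{1,\dots,n\}$, returns the $i$-th neighbor of $v$ in an arbitrary but fixed ordering of its neighbors, or $\perp$ if $i>\deg(v)$; a pair query on $(u,v)$ returns whether $uv$ is an edge. A randomized algorithm is an adaptive query algorithm with real output whose random coins are drawn from a probability space independent of the input. Two graphs $G_1=(V,E_1)$, $G_2=(V,E_2)$ are edge-neighboring if $E_1\setminus\{e\}=E_2\setminus\{e\}$ for some $e$; an algorithm $\mathcal A$ is $\varepsilon$-edge differentially private if $\Pr[\mathcal A(G_1)\in S]\le e^{\varepsilon}\Pr[\mathcal A(G_2)\in S]$ for all edge-neighboring $G_1,G_2$ (with any orderings of the neighbors) and all measurable $S\subseteq\mathbb R$. For a graph $G$ let $t$ be its number of triangles and $m$ its number of edges; $\log$ is the natural logarithm. For every integer $K>0$ and every real $c>0$ there are constants $C',C>0$ and $k\in\mathbb N$, depending only on $K$ and $c$, such that for all $\varepsilon>0$ and $\alpha\in(0,1)$ there is a randomized algorithm $\mathcal A'$ (given $n\ge 1$) with the following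 properties. 1. (Privacy) $\mathcal A'$ is $\varepsilon$-edge differentially private. 2. (Accuracy) For every graph $G$ on $n$ vertices, with probability at least $1-\frac1{n^c}-\frac{1}{n^{c-3}(e^{\varepsilon}-1)/K+1}$, $$(1-\alpha')t-\frac{2c}{\varepsilon}\,n\log n-\frac1{Kn^3}\;\le\;\mathcal A'(G)\;\le\;(1+\alpha')t+\frac{2c}{\varepsilon}\,n\log n+\frac1{Kn^3},\qquad \alpha'=\alpha\Bigl(1+\frac{\varepsilon}{C'\log n}\Bigr)$$ (for $n=1$ one has $t=0$ and the value of $\alpha'$ is irrelevant). 3. (Queries) For every graph $G$ on $n$ vertices with $t\ge1$, with probability at least $1-\frac1{n^c}$, $\mathcal A'$ makes at most $$C\Bigl(\frac{n}{t^{1/3}}+\frac{m^{3/2}}{t}\Bigr)\Bigl(1+\log n+\frac1{\alpha\varepsilon}\Bigr)^{k}$$ queries. -/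

import Mathlib

open MeasureTheory

namespace TriangleDP

/-- A graph on the vertex set `Fin n` as it is presented to a query algorithm: the graph together
with an (arbitrary) ordering of the neighbours of every vertex, which gives a meaning to
"the `i`-th neighbour of `v`". -/
structure GraphInput (n : ℕ) where
  graph : SimpleGraph (Fin n)
  nbrs : Fin n → List (Fin n)
  nodup_nbrs : ∀ v, (nbrs v).Nodup
  mem_nbrs : ∀ v w, w ∈ nbrs v ↔ graph.Adj v w

open Classical in
/-- The length of the neighbour list of a vertex is its degree. -/
theorem GraphInput.length_nbrs {n : ℕ} (I : GraphInput n) (v : Fin n) :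
    (I.nbrs v).length = I.graph.degree v := by
  rw [← List.toFinset_card_of_nodup (I.nodup_nbrs v), ← SimpleGraph.card_neighborFinset_eq_degree]
  congr 1
  ext w
  simp [I.mem_nbrs]

/-- The queries of the general query model (neighbours are numbered from `0`). -/
inductive Query (n : ℕ) : Type
  | degree (v : Fin n)
  | neighbor (v : Fin n) (i : Fin n)
  | pair (u v : Fin n)

/-- The type of answers to a query. In a neighbour query, `none` stands for `⊥`. -/
def Query.Answer {n : ℕ} : Query n → Type
  | .degree _ => ℕ
  | .neighbor _ _ => Option (Fin n)
  | .pair _ _ => Bool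

open Classical in
/-- The answer of the oracle. -/
noncomputable def GraphInput.answer {n : ℕ} (I : GraphInput n) : (q : Query n) → q.Answer
  | .degree v => (I.nbrs v).length
  | .neighbor v i => (I.nbrs v)[(i : ℕ)]?
  | .pair u v => decide (I.graph.Adj u v)

/-- A deterministic adaptive query algorithm with real output: a decision tree which either stops
with an output, or asks a query and continues in a way that depends on the answer. -/
inductive DecisionTree (n : ℕ) : Type
  | output (x : ℝ) : DecisionTree n
  | ask (q : Query n) (next : q.Answer → DecisionTree n) : DecisionTree n

/-- The output of a decision tree on an input. -/
noncomputable def DecisionTree.eval {n : ℕ} : DecisionTree n → GraphInput n → ℝ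
  | .output x, _ => x
  | .ask q next, I => (next (I.answer q)).eval I

/-- The number of queries that a decision tree makes on an input. -/
noncomputable def DecisionTree.numQueries {n : ℕ} : DecisionTree n → GraphInput n → ℕ
  | .output _, _ => 0
  | .ask q next, I => (next (I.answer q)).numQueries I + 1

/-- A randomized query algorithm for `n`-vertex graphs: its random coins are drawn from a
probability space (which does not depend on the input), and for every outcome of the coins it is a
deterministic query algorithm. Its output and its number of queries are random variables. -/
structure RandomizedAlgorithm (n : ℕ) where
  Coins : Type
  [measurableSpaceCoins : MeasurableSpace Coins]
  law : Measure Coins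
  [isProbabilityMeasure_law : IsProbabilityMeasure law]
  tree : Coins → DecisionTree n
  measurable_eval : ∀ I : GraphInput n, Measurable fun r => (tree r).eval I
  measurable_numQueries : ∀ I : GraphInput n, Measurable fun r => (tree r).numQueries I

attribute [instance] RandomizedAlgorithm.measurableSpaceCoins
attribute [instance] RandomizedAlgorithm.isProbabilityMeasure_law

/-- The probability that the output of the algorithm on the input `I` lies in `S`. -/
noncomputable def RandomizedAlgorithm.probOutput {n : ℕ} (A : RandomizedAlgorithm n)
    (I : GraphInput n) (S : Set ℝ) : ℝ :=
  A.law.real {r | (A.tree r).eval I ∈ S}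

/-- The probability that the algorithm makes at most `B` queries on the input `I`. -/
noncomputable def RandomizedAlgorithm.probQueriesLE {n : ℕ} (A : RandomizedAlgorithm n)
    (I : GraphInput n) (B : ℝ) : ℝ :=
  A.law.real {r | ((A.tree r).numQueries I : ℝ) ≤ B}

/-- Two graphs on the same vertices are edge-neighbouring if they agree outside one edge. -/
def EdgeNeighboring {n : ℕ} (G₁ G₂ : SimpleGraph (Fin n)) : Prop :=
  ∃ e : Sym2 (Fin n), G₁.edgeSet \ {e} = G₂.edgeSet \ {e}

/-- Pure `ε`-edge differential privacy, whatever the orderings of the neighbours in the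
presentations of the two edge-neighbouring graphs are. -/
def RandomizedAlgorithm.IsEdgeDP {n : ℕ} (A : RandomizedAlgorithm n) (ε : ℝ) : Prop :=
  ∀ I₁ I₂ : GraphInput n, EdgeNeighboring I₁.graph I₂.graph →
    ∀ S : Set ℝ, MeasurableSet S → A.probOutput I₁ S ≤ Real.exp ε * A.probOutput I₂ S

/-- The number of edges. -/
noncomputable def numEdges {n : ℕ} (G : SimpleGraph (Fin n)) : ℕ :=
  G.edgeSet.ncard

/-- The number of triangles, i.e. of sets of three pairwise adjacent vertices. -/
noncomputable def numTriangles {n : ℕ} (G : SimpleGraph (Fin n)) : ℕ :=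
  (G.cliqueSet 3).ncard

end TriangleDP

/-! The proof has two halves: a sublinear non-private estimator of `t` with tunable failure
probability, and a wrapper that turns it into a purely private one without further queries.
Algorithms are written as finite programs (`Alg`) whose means, variances and query counts are
computed by recursion; `exists_realizes` converts a program into a `RandomizedAlgorithm` with the
same joint law of output and number of queries.

Estimator. Order the vertices by degree. A vertex has at most `√(2m)` neighbours after it, so an
edge lies in at most `√(2m)` triangles whose first vertex is an endpoint of the edge. For a guess
`θ³` of `t`, `triEst` samples vertices with rate about `1/θ`, then edges and then triangles at them,
and reweights by the inverse rates. The variance is threatened only by vertices in very many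
triangles. Each triangle is therefore shared among those of its vertices that a cheap random test
(`check`) finds light. The test is rerun with fresh coins whenever it is needed: by linearity of
expectation the shares still add up to the probability that some vertex is found light
(`mean_share_add`), and Chebyshev bounds the contribution of every vertex (`light_mul_triAt_le`).
Few vertices are heavy, so few triangles are lost (`mean_triEst_ge`). Averaging, aborting long runs
and taking medians yield a reliable estimate. The number of edges, needed for the rates, is
estimated in the same round. Halving `θ` from `n` until the estimate reaches `θ³` finds a good guess
(`prob_search`).

Privacy. Changing an edge changes `t` by at most `n` (`numTriangles_le_add`). On the scale `log (1 +
x/N)` with `N = n/ν`, good estimates for neighbouring graphs differ by `O(ν)`, that is by at most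
`D` grid steps. A truncated geometric mechanism on the grid costs `39/40 ε` of the privacy budget.
The estimator may fail with probability `δ`, which by itself would give only approximate privacy.
Mixing in a uniform grid point with probability `ζ` gives every attainable output the mass
`ζ/(K+1)`, and a sufficiently small `δ` is absorbed by it (`prob_privatize_le`). The dependence of
the query count on `1/δ` is logarithmic, so this is affordable.

Extreme parameters. If `c log n ≤ α ε`, then `α' ≥ 1` and the output `0` is accurate. If `ε` is
huge, it is lowered while `α ε` is kept fixed; the additive slack `1/(K n³)` pays for this. -/

namespace TriangleDP

/-! ### Randomized query programs and their expectations -/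

/-- A randomized query program with results in `α`: it may stop, ask a query, or draw a random
element of `Fin k` with given probabilities. -/
inductive Alg (n : ℕ) (α : Type) : Type
  | pure (a : α) : Alg n α
  | ask (q : Query n) (next : q.Answer → Alg n α) : Alg n α
  | rand {k : ℕ} (w : Fin k → ℝ) (hw : (∀ i, 0 ≤ w i) ∧ ∑ i, w i = 1)
      (next : Fin k → Alg n α) : Alg n α

namespace Alg

variable {n : ℕ} {α β ι : Type}

/-- The expectation of a function of the result and of the number of queries. -/
noncomputable def ex (I : GraphInput n) : Alg n α → (α → ℕ → ℝ) → ℝ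
  | .pure a, f => f a 0
  | .ask q next, f => (next (I.answer q)).ex I fun a c => f a (c + 1)
  | .rand w _ next, f => ∑ i, w i * (next i).ex I f

/-- Sequential composition. -/
def bind : Alg n α → (α → Alg n β) → Alg n β
  | .pure a, g => g a
  | .ask q next, g => .ask q fun x => (next x).bind g
  | .rand w hw next, g => .rand w hw fun i => (next i).bind g

theorem ex_bind (I : GraphInput n) (A : Alg n α) (g : α → Alg n β) (f : β → ℕ → ℝ) :
    (A.bind g).ex I f = A.ex I fun a c => (g a).ex I fun b c' => f b (c + c') := by
  induction A generalizing f with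
  | pure a => simp [bind, ex]
  | ask q next ih =>
    simp only [bind, ex, ih]
    congr; ext a c; congr; ext b c'; congr 1; ring
  | rand w hw next ih => simp only [bind, ex, ih]

theorem ex_add (I : GraphInput n) (A : Alg n α) (f g : α → ℕ → ℝ) :
    (A.ex I fun a c => f a c + g a c) = A.ex I f + A.ex I g := by
  induction A generalizing f g with
  | pure a => rfl
  | ask q next ih => simp only [ex, ih]
  | rand w hw next ih => simp only [ex, ih, mul_add, Finset.sum_add_distrib]

theorem ex_const_mul (I : GraphInput n) (A : Alg n α) (r : ℝ) (f : α → ℕ → ℝ) :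
    (A.ex I fun a c => r * f a c) = r * A.ex I f := by
  induction A generalizing f with
  | pure a => rfl
  | ask q next ih => simp only [ex, ih]
  | rand w hw next ih =>
    simp only [ex, ih, Finset.mul_sum]
    refine Finset.sum_congr rfl fun i _ => by ring

theorem ex_mul_const (I : GraphInput n) (A : Alg n α) (r : ℝ) (f : α → ℕ → ℝ) :
    (A.ex I fun a c => f a c * r) = A.ex I f * r := by
  rw [mul_comm, ← ex_const_mul]; congr; ext a c; ring

theorem ex_const (I : GraphInput n) (A : Alg n α) (r : ℝ) : (A.ex I fun _ _ => r) = r := by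
  induction A with
  | pure a => rfl
  | ask q next ih => simp only [ex, ih]
  | rand w hw next ih => simp only [ex, ih, ← Finset.sum_mul, hw.2, one_mul]

theorem ex_sub (I : GraphInput n) (A : Alg n α) (f g : α → ℕ → ℝ) :
    (A.ex I fun a c => f a c - g a c) = A.ex I f - A.ex I g := by
  have := ex_add I A f (fun a c => (-1) * g a c)
  rw [ex_const_mul] at this
  rw [sub_eq_add_neg, ← neg_one_mul, ← this]
  congr; ext a c; ring

theorem ex_mono (I : GraphInput n) (A : Alg n α) {f g : α → ℕ → ℝ} (h : ∀ a c, f a c ≤ g a c) :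
    A.ex I f ≤ A.ex I g := by
  induction A generalizing f g with
  | pure a => exact h a 0
  | ask q next ih => exact ih _ fun a c => h a (c + 1)
  | rand w hw next ih =>
    exact Finset.sum_le_sum fun i _ => mul_le_mul_of_nonneg_left (ih i h) (hw.1 i)

theorem ex_nonneg (I : GraphInput n) (A : Alg n α) {f : α → ℕ → ℝ} (h : ∀ a c, 0 ≤ f a c) :
    0 ≤ A.ex I f := by
  rw [← ex_const I A 0]; exact ex_mono I A h

open Classical in
/-- The probability of an event that concerns the result and the number of queries. -/
noncomputable def prob (I : GraphInput n) (A : Alg n α) (P : α → ℕ → Prop) : ℝ :=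
  A.ex I fun a c => if P a c then 1 else 0

theorem prob_ask (I : GraphInput n) (q : Query n) (k : q.Answer → Alg n α) (P : α → ℕ → Prop) :
    (ask q k).prob I P = (k (I.answer q)).prob I fun a c => P a (c + 1) := rfl

theorem prob_rand (I : GraphInput n) {k : ℕ} (w : Fin k → ℝ)
    (hw : (∀ i, 0 ≤ w i) ∧ ∑ i, w i = 1) (next : Fin k → Alg n α) (P : α → ℕ → Prop) :
    (rand w hw next).prob I P = ∑ i, w i * (next i).prob I P := rfl

theorem prob_bind_pure (I : GraphInput n) (A : Alg n α) (g : α → β) (P : β → ℕ → Prop) :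
    (A.bind fun a => pure (g a)).prob I P = A.prob I fun a c => P (g a) c := by
  rw [prob, ex_bind]; rfl

theorem prob_nonneg (I : GraphInput n) (A : Alg n α) (P : α → ℕ → Prop) : 0 ≤ A.prob I P :=
  ex_nonneg I A fun a c => by split_ifs <;> norm_num

theorem prob_mono (I : GraphInput n) (A : Alg n α) {P Q : α → ℕ → Prop}
    (h : ∀ a c, P a c → Q a c) : A.prob I P ≤ A.prob I Q :=
  ex_mono I A fun a c => by
    by_cases hP : P a c
    · simp [hP, h a c hP]
    · simp only [hP, if_false]; split_ifs <;> norm_num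

theorem prob_le_one (I : GraphInput n) (A : Alg n α) (P : α → ℕ → Prop) : A.prob I P ≤ 1 := by
  rw [← ex_const I A 1]
  exact ex_mono I A fun a c => by split_ifs <;> norm_num

theorem prob_or_le (I : GraphInput n) (A : Alg n α) (P Q : α → ℕ → Prop) :
    (A.prob I fun a c => P a c ∨ Q a c) ≤ A.prob I P + A.prob I Q := by
  rw [prob, prob, prob, ← ex_add]
  refine ex_mono I A fun a c => ?_
  by_cases hP : P a c <;> by_cases hQ : Q a c <;> simp [hP, hQ]

open Classical in
theorem prob_not (I : GraphInput n) (A : Alg n α) (P : α → ℕ → Prop) :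
    (A.prob I fun a c => ¬ P a c) = 1 - A.prob I P := by
  have h := ex_sub I A (fun _ _ => 1) (fun a c => if P a c then 1 else 0)
  rw [ex_const] at h
  rw [prob, prob, ← h]
  congr; ext a c
  by_cases hP : P a c <;> simp [hP]

/-- Markov's inequality. -/
theorem prob_le_div (I : GraphInput n) (A : Alg n α) {f : α → ℕ → ℝ} (hf : ∀ a c, 0 ≤ f a c)
    {r : ℝ} (hr : 0 < r) {P : α → ℕ → Prop} (h : ∀ a c, P a c → r ≤ f a c) :
    A.prob I P ≤ A.ex I f / r := by
  rw [div_eq_mul_inv, ← ex_mul_const]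
  refine ex_mono I A fun a c => ?_
  split_ifs with hP
  · rw [← div_eq_mul_inv, le_div_iff₀ hr, one_mul]; exact h a c hP
  · exact mul_nonneg (hf a c) (inv_nonneg.2 hr.le)

open Classical in
/-- The union bound along a sequential composition. -/
theorem prob_bind_not_le (I : GraphInput n) (A : Alg n α) (g : α → Alg n β)
    (P : α → ℕ → Prop) (Q : β → ℕ → Prop) {δ₁ δ₂ : ℝ} (h₀ : 0 ≤ δ₂)
    (h₁ : (A.prob I fun a c => ¬ P a c) ≤ δ₁)
    (h₂ : ∀ a c, P a c → ((g a).prob I fun b c' => ¬ Q b (c + c')) ≤ δ₂) :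
    ((A.bind g).prob I fun b c => ¬ Q b c) ≤ δ₁ + δ₂ := by
  rw [prob, ex_bind]
  calc _ ≤ A.ex I fun a c => (if ¬ P a c then 1 else 0) + δ₂ := ex_mono I A fun a c => by
        by_cases hP : P a c
        · have := h₂ a c hP
          unfold prob at this
          simpa [hP] using this
        · simp only [hP, not_false_eq_true, if_true]
          have := (g a).prob_le_one I fun b c' => ¬ Q b (c + c')
          unfold prob at this
          linarith
    _ ≤ δ₁ + δ₂ := by
        rw [ex_add, ex_const]
        have : (A.ex I fun a c => if ¬ P a c then (1:ℝ) else 0) ≤ δ₁ := by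
          unfold prob at h₁
          convert h₁ using 5
        linarith

/-! ### Programs as randomized algorithms -/

/-- `A` realizes the program `T`: results and numbers of queries have the same joint law. -/
def Realizes (A : RandomizedAlgorithm n) (T : Alg n ℝ) : Prop :=
  ∀ (I : GraphInput n) (S : Set (ℝ × ℕ)), MeasurableSet S →
    A.law.real {r | ((A.tree r).eval I, (A.tree r).numQueries I) ∈ S} = T.prob I fun x c => (x, c) ∈ S

theorem exists_realizes_pure (x : ℝ) : ∃ A : RandomizedAlgorithm n, Realizes A (.pure x) := by
  refine ⟨{ Coins := Unit, law := Measure.dirac (), tree := fun _ => .output x,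
            measurable_eval := fun I => measurable_const
            measurable_numQueries := fun I => measurable_const }, fun I S hS => ?_⟩
  by_cases h : (x, 0) ∈ S <;> simp [DecisionTree.eval, DecisionTree.numQueries, prob, ex, h]

/-- The coins are an independent family, one member for each conceivable answer, possibly infinitely
many. On a fixed input only the coordinate of the true answer is read, and its marginal is the law
of that continuation. -/
theorem exists_realizes_ask (q : Query n) (next : q.Answer → Alg n ℝ)
    (ih : ∀ a, ∃ A : RandomizedAlgorithm n, Realizes A (next a)) :
    ∃ A : RandomizedAlgorithm n, Realizes A (.ask q next) := by
  choose A hA using ih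
  refine ⟨{ Coins := (a : q.Answer) → (A a).Coins
            law := Measure.infinitePi fun a => (A a).law
            tree := fun r => .ask q fun a => (A a).tree (r a)
            measurable_eval := fun I =>
              ((A (I.answer q)).measurable_eval I).comp (measurable_pi_apply _)
            measurable_numQueries := fun I =>
              (((A (I.answer q)).measurable_numQueries I).comp
                (measurable_pi_apply (I.answer q))).add_const 1 }, fun I S hS => ?_⟩
  have hm : Measurable fun p : ℝ × ℕ => (p.1, p.2 + 1) :=
    measurable_fst.prodMk (measurable_snd.add_const 1)
  have h := hA (I.answer q) I _ (hm hS)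
  have hmeas : MeasurableSet {r | (((A (I.answer q)).tree r).eval I,
      ((A (I.answer q)).tree r).numQueries I) ∈ (fun p : ℝ × ℕ => (p.1, p.2 + 1)) ⁻¹' S} :=
    (((A (I.answer q)).measurable_eval I).prodMk ((A (I.answer q)).measurable_numQueries I))
      (hm hS)
  have hp := (measurePreserving_eval_infinitePi (fun a => (A a).law) (I.answer q)).measure_preimage
    hmeas.nullMeasurableSet
  rw [measureReal_def, ← hp] at h
  rw [measureReal_def]
  exact h

/-- The coins are the disjoint union of the coins of the branches, carrying the mixture of their
laws with weights `w`. A set in this union is measurable when all its fibres are, so everything can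
be checked branch by branch. -/
theorem exists_realizes_rand {k : ℕ} (w : Fin k → ℝ) (hw : (∀ i, 0 ≤ w i) ∧ ∑ i, w i = 1)
    (next : Fin k → Alg n ℝ) (ih : ∀ i, ∃ A : RandomizedAlgorithm n, Realizes A (next i)) :
    ∃ A : RandomizedAlgorithm n, Realizes A (.rand w hw next) := by
  choose A hA using ih
  have hmk (i : Fin k) : Measurable (@Sigma.mk _ (fun i => (A i).Coins) i) := by
    intro s hs
    exact MeasurableSpace.measurableSet_iInf.1 hs i
  have hout {β : Type} [MeasurableSpace β] (f : (Σ i, (A i).Coins) → β)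
      (hf : ∀ i, Measurable fun r => f ⟨i, r⟩) : Measurable f := by
    intro s hs
    rw [MeasurableSpace.measurableSet_iInf]
    exact fun i => hf i hs
  let law : Measure (Σ i, (A i).Coins) :=
    ∑ i, ENNReal.ofReal (w i) • ((A i).law.map fun r => ⟨i, r⟩)
  have hlaw : ∀ s, MeasurableSet s →
      law s = ∑ i, ENNReal.ofReal (w i) * (A i).law ((fun r => ⟨i, r⟩) ⁻¹' s) := by
    intro s hs
    simp only [law, Measure.coe_finsetSum, Finset.sum_apply, Measure.smul_apply, smul_eq_mul]
    exact Finset.sum_congr rfl fun i _ => by rw [Measure.map_apply (hmk i) hs]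
  have hprob : IsProbabilityMeasure law := ⟨by
    rw [hlaw _ MeasurableSet.univ]
    simp only [Set.preimage_univ, measure_univ, mul_one]
    rw [← ENNReal.ofReal_sum_of_nonneg fun i _ => hw.1 i, hw.2, ENNReal.ofReal_one]⟩
  have hev (I : GraphInput n) :
      Measurable fun r : Σ i, (A i).Coins => ((A r.1).tree r.2).eval I :=
    hout _ fun i => (A i).measurable_eval I
  have hnq (I : GraphInput n) :
      Measurable fun r : Σ i, (A i).Coins => ((A r.1).tree r.2).numQueries I :=
    hout _ fun i => (A i).measurable_numQueries I
  refine ⟨{ Coins := Σ i, (A i).Coins, law := law, tree := fun r => (A r.1).tree r.2,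
            measurable_eval := hev, measurable_numQueries := hnq }, fun I S hS => ?_⟩
  refine (congrArg ENNReal.toReal (hlaw _ (((hev I).prodMk (hnq I)) hS))).trans ?_
  rw [ENNReal.toReal_sum]
  · rw [prob, ex]
    refine Finset.sum_congr rfl fun i _ => ?_
    rw [ENNReal.toReal_mul, ENNReal.toReal_ofReal (hw.1 i)]
    congr 1
    exact hA i I S hS
  · exact fun i _ => ENNReal.mul_ne_top ENNReal.ofReal_ne_top (measure_ne_top _ _)

theorem exists_realizes (T : Alg n ℝ) : ∃ A : RandomizedAlgorithm n, Realizes A T := by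
  induction T with
  | pure x => exact exists_realizes_pure x
  | ask q next ih => exact exists_realizes_ask q next ih
  | rand w hw next ih => exact exists_realizes_rand w hw next ih

theorem Realizes.probOutput_eq {A : RandomizedAlgorithm n} {T : Alg n ℝ} (h : Realizes A T)
    (I : GraphInput n) {S : Set ℝ} (hS : MeasurableSet S) :
    A.probOutput I S = T.prob I fun x _ => x ∈ S :=
  h I (Prod.fst ⁻¹' S) (measurable_fst hS)

theorem Realizes.probQueriesLE_eq {A : RandomizedAlgorithm n} {T : Alg n ℝ} (h : Realizes A T)
    (I : GraphInput n) (B : ℝ) :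
    A.probQueriesLE I B = T.prob I fun _ c => (c : ℝ) ≤ B :=
  h I {p | (p.2 : ℝ) ≤ B} (measurable_snd (MeasurableSet.of_discrete (s := {c : ℕ | (c : ℝ) ≤ B})))

end Alg
end TriangleDP

namespace TriangleDP
namespace Alg

variable {n : ℕ} {α β ι : Type}

/-! ### Moments -/

/-- The expected result. -/
noncomputable def mean (I : GraphInput n) (A : Alg n ℝ) : ℝ := A.ex I fun x _ => x

/-- The expected square of the result. -/
noncomputable def sq (I : GraphInput n) (A : Alg n ℝ) : ℝ := A.ex I fun x _ => x ^ 2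

/-- The variance of the result. -/
noncomputable def var (I : GraphInput n) (A : Alg n ℝ) : ℝ := A.sq I - A.mean I ^ 2

/-- The expected number of queries. -/
noncomputable def cost (I : GraphInput n) (A : Alg n α) : ℝ := A.ex I fun _ c => (c : ℝ)

@[simp] theorem mean_pure (I : GraphInput n) (x : ℝ) : (pure x : Alg n ℝ).mean I = x := rfl
@[simp] theorem sq_pure (I : GraphInput n) (x : ℝ) : (pure x : Alg n ℝ).sq I = x ^ 2 := rfl
@[simp] theorem var_pure (I : GraphInput n) (x : ℝ) : (pure x : Alg n ℝ).var I = 0 := by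
  simp [var]
@[simp] theorem cost_pure (I : GraphInput n) (x : α) : (pure x : Alg n α).cost I = 0 := by
  simp [cost, ex]

@[simp] theorem cost_ask (I : GraphInput n) (q : Query n) (k : q.Answer → Alg n α) :
    (ask q k).cost I = 1 + (k (I.answer q)).cost I := by
  simp only [cost, ex, Nat.cast_add, Nat.cast_one]
  rw [ex_add, ex_const, add_comm]

theorem cost_bind (I : GraphInput n) (A : Alg n α) (g : α → Alg n β) :
    (A.bind g).cost I = A.cost I + A.ex I fun a _ => (g a).cost I := by
  simp only [cost, ex_bind, Nat.cast_add]
  rw [← ex_add]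
  congr; ext a c
  rw [ex_add, ex_const]

theorem cost_bind_pure (I : GraphInput n) (A : Alg n α) (g : α → β) :
    (A.bind fun a => pure (g a)).cost I = A.cost I := by
  simp [cost_bind, ex_const]

theorem var_eq (I : GraphInput n) (A : Alg n ℝ) :
    A.var I = A.ex I fun x _ => (x - A.mean I) ^ 2 := by
  have e : (fun (x : ℝ) (_ : ℕ) => (x - A.mean I) ^ 2) =
      fun x _ => (x ^ 2 - (2 * A.mean I) * x) + A.mean I ^ 2 := by ext x c; ring
  rw [e, ex_add, ex_sub, ex_const_mul, ex_const]
  change A.sq I - A.mean I ^ 2 = A.sq I - 2 * A.mean I * A.mean I + A.mean I ^ 2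
  ring

/-- Chebyshev's inequality. -/
theorem prob_abs_sub_le (I : GraphInput n) (A : Alg n ℝ) {r : ℝ} (hr : 0 < r) :
    (A.prob I fun x _ => r ≤ |x - A.mean I|) ≤ A.var I / r ^ 2 := by
  rw [var_eq]
  refine prob_le_div I A (fun _ _ => sq_nonneg _) (by positivity) fun x c hx => ?_
  rw [← sq_abs (x - _)]
  exact pow_le_pow_left₀ hr.le hx 2

/-- Add up the results of independent programs. -/
def sumL (l : List ι) (f : ι → Alg n ℝ) : Alg n ℝ :=
  match l with
  | [] => pure 0
  | i :: l => (f i).bind fun x => (sumL l f).bind fun y => pure (x + y)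

theorem mean_sumL (I : GraphInput n) (l : List ι) (f : ι → Alg n ℝ) :
    (sumL l f).mean I = (l.map fun i => (f i).mean I).sum := by
  induction l with
  | nil => simp [sumL]
  | cons i l ih =>
    simp only [sumL, List.map_cons, List.sum_cons, ← ih]
    simp only [mean, ex_bind, ex, ex_add, ex_const]

theorem var_sumL (I : GraphInput n) (l : List ι) (f : ι → Alg n ℝ) :
    (sumL l f).var I = (l.map fun i => (f i).var I).sum := by
  induction l with
  | nil => simp [sumL]
  | cons i l ih =>
    have hs : (sumL (i :: l) f).sq I =
        (f i).sq I + 2 * (f i).mean I * (sumL l f).mean I + (sumL l f).sq I := by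
      simp only [sumL, sq, mean, ex_bind, ex, add_sq, ex_add, ex_const, ex_const_mul, ex_mul_const]
    have hm : (sumL (i :: l) f).mean I = (f i).mean I + (sumL l f).mean I := by
      simp [mean_sumL]
    rw [List.map_cons, List.sum_cons, ← ih, var, hs, hm, var, var]
    ring

theorem cost_sumL (I : GraphInput n) (l : List ι) (f : ι → Alg n ℝ) :
    (sumL l f).cost I = (l.map fun i => (f i).cost I).sum := by
  induction l with
  | nil => simp [sumL]
  | cons i l ih =>
    simp only [sumL, List.map_cons, List.sum_cons, ← ih]
    simp only [cost_bind, cost_pure, ex_const, add_zero]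

theorem thin_weights {p : ℝ} (hp : 0 < p ∧ p ≤ 1) :
    (∀ i, 0 ≤ (![p, 1 - p] : Fin 2 → ℝ) i) ∧ ∑ i, (![p, 1 - p] : Fin 2 → ℝ) i = 1 := by
  refine ⟨fun i => ?_, by simp⟩
  fin_cases i
  · simpa using hp.1.le
  · simpa using hp.2

/-- With probability `p` run the program and divide its result by `p`; otherwise return `0`. -/
noncomputable def thin (p : Set.Ioc (0 : ℝ) 1) (A : Alg n ℝ) : Alg n ℝ :=
  .rand ![(p : ℝ), 1 - p] (thin_weights p.2)
    ![A.bind fun x => pure (x / p), pure 0]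

theorem ex_thin (I : GraphInput n) (p : Set.Ioc (0 : ℝ) 1) (A : Alg n ℝ) (f : ℝ → ℕ → ℝ) :
    (thin p A).ex I f = p * (A.ex I fun x c => f (x / p) c) + (1 - p) * f 0 0 := by
  simp [thin, ex, ex_bind]

theorem mean_thin (I : GraphInput n) (p : Set.Ioc (0 : ℝ) 1) (A : Alg n ℝ) :
    (thin p A).mean I = A.mean I := by
  have hp := p.2.1.ne'
  simp only [mean, ex_thin, div_eq_mul_inv, ex_mul_const]
  field_simp; ring

theorem sq_thin (I : GraphInput n) (p : Set.Ioc (0 : ℝ) 1) (A : Alg n ℝ) :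
    (thin p A).sq I = A.sq I / p := by
  have hp := p.2.1.ne'
  simp only [sq, ex_thin, div_eq_mul_inv, mul_pow, ex_mul_const]
  field_simp; ring

theorem var_thin (I : GraphInput n) (p : Set.Ioc (0 : ℝ) 1) (A : Alg n ℝ) :
    (thin p A).var I = A.var I / p + (1 / p - 1) * A.mean I ^ 2 := by
  rw [var, var, mean_thin, sq_thin]; ring

theorem cost_thin (I : GraphInput n) (p : Set.Ioc (0 : ℝ) 1) (A : Alg n ℝ) :
    (thin p A).cost I = p * A.cost I := by
  simp [cost, ex_thin]

/-- The average of the results of `R` independent runs. -/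
noncomputable def avg (R : ℕ) (A : Alg n ℝ) : Alg n ℝ :=
  (sumL (List.range R) fun _ => A).bind fun s => pure (s / R)

theorem mean_avg (I : GraphInput n) {R : ℕ} (hR : 0 < R) (A : Alg n ℝ) :
    (avg R A).mean I = A.mean I := by
  have h : (avg R A).mean I = (sumL (List.range R) fun _ => A).mean I * (R : ℝ)⁻¹ := by
    simp only [avg, mean, ex_bind, ex, div_eq_mul_inv, ex_mul_const]
  rw [h, mean_sumL]
  have : (R : ℝ) ≠ 0 := by positivity
  simp; field_simp

theorem var_avg (I : GraphInput n) {R : ℕ} (hR : 0 < R) (A : Alg n ℝ) :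
    (avg R A).var I = A.var I / R := by
  have hm : (avg R A).mean I = (sumL (List.range R) fun _ => A).mean I * (R : ℝ)⁻¹ := by
    simp only [avg, mean, ex_bind, ex, div_eq_mul_inv, ex_mul_const]
  have hs : (avg R A).sq I = (sumL (List.range R) fun _ => A).sq I * ((R : ℝ)⁻¹) ^ 2 := by
    simp only [avg, sq, ex_bind, ex, div_eq_mul_inv, mul_pow, ex_mul_const]
  have h : (avg R A).var I = (sumL (List.range R) fun _ => A).var I * ((R : ℝ)⁻¹) ^ 2 := by
    rw [var, var, hm, hs]; ring
  rw [h, var_sumL]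
  have : (R : ℝ) ≠ 0 := by positivity
  simp; field_simp

theorem cost_avg (I : GraphInput n) (R : ℕ) (A : Alg n ℝ) :
    (avg R A).cost I = R * A.cost I := by
  rw [avg, cost_bind_pure, cost_sumL]; simp

/-! ### Aborting -/

/-- Run a program, but stop with the result `d` when more than `b` queries would be made. -/
def trunc (d : α) : ℕ → Alg n α → Alg n α
  | _, .pure a => .pure a
  | 0, .ask _ _ => .pure d
  | b + 1, .ask q next => .ask q fun x => trunc d b (next x)
  | b, .rand w hw next => .rand w hw fun i => trunc d b (next i)

/-- Truncation changes a run only if the run exceeds the budget, so a bad event costs at most the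
additional probability of an overrun. -/
theorem prob_trunc_le (I : GraphInput n) (d : α) (b : ℕ) (A : Alg n α) (P : α → ℕ → Prop) :
    (trunc d b A).prob I P ≤ A.prob I fun a c => P a c ∨ b < c := by
  induction A generalizing b P with
  | pure a => exact prob_mono I _ fun a c => Or.inl
  | ask q next ih =>
    cases b with
    | zero =>
      refine (prob_le_one _ _ _).trans ?_
      simp [prob, ex, ex_const]
    | succ b =>
      simp only [trunc, prob_ask, Nat.add_lt_add_iff_right]
      exact ih (I.answer q) b fun a c => P a (c + 1)
  | rand w hw next ih =>
    simp only [trunc, prob_rand]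
    exact Finset.sum_le_sum fun i _ => mul_le_mul_of_nonneg_left (ih i b P) (hw.1 i)

/-- If the default value is harmless, aborting only helps, and no bound on the overrun is needed.
This is what controls runs with a guess so wrong that their cost is not understood. -/
theorem prob_trunc_le_of_not (I : GraphInput n) (d : α) (b : ℕ) (A : Alg n α) (P : α → Prop)
    (hd : ¬ P d) :
    ((trunc d b A).prob I fun a _ => P a) ≤ A.prob I fun a _ => P a := by
  induction A generalizing b with
  | pure a => simp [trunc]
  | ask q next ih =>
    cases b with
    | zero =>
      refine le_trans (le_of_eq ?_) (prob_nonneg _ _ _)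
      simp [trunc, prob, ex, hd]
    | succ b => exact ih (I.answer q) b
  | rand w hw next ih =>
    simp only [trunc, prob_rand]
    exact Finset.sum_le_sum fun i _ => mul_le_mul_of_nonneg_left (ih i b) (hw.1 i)

theorem prob_trunc_lt_cost (I : GraphInput n) (d : α) (b : ℕ) (A : Alg n α) :
    ((trunc d b A).prob I fun _ c => ¬ c ≤ b) = 0 := by
  induction A generalizing b with
  | pure a => simp [trunc, prob, ex]
  | ask q next ih =>
    cases b with
    | zero => simp [trunc, prob, ex]
    | succ b =>
      have := ih (I.answer q) b
      simp only [trunc, prob, ex] at this ⊢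
      simpa using this
  | rand w hw next ih =>
    simp only [trunc, prob_rand]
    exact Finset.sum_eq_zero fun i _ => mul_eq_zero_of_right _ (ih i b)

/-! ### Amplification by medians -/

/-- The results of `k` independent runs. -/
def runs : ℕ → Alg n α → Alg n (List α)
  | 0, _ => pure []
  | k + 1, A => A.bind fun a => (runs k A).bind fun l => pure (a :: l)

/-- Independence of the runs, in the form that an exponential moment argument needs. -/
theorem ex_runs_prod (I : GraphInput n) (k : ℕ) (A : Alg n α) (g : α → ℝ) :
    ((runs k A).ex I fun l _ => (l.map g).prod) = (A.ex I fun a _ => g a) ^ k := by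
  induction k with
  | zero => simp [runs, ex]
  | succ k ih =>
    simp only [runs, ex_bind, ex, List.map_cons, List.prod_cons, ex_const_mul, ih, ex_mul_const]
    ring

theorem prob_runs (I : GraphInput n) (k b : ℕ) (A : Alg n α)
    (h : (A.prob I fun _ c => ¬ c ≤ b) ≤ 0) :
    ((runs k A).prob I fun l c => ¬ (l.length = k ∧ c ≤ k * b)) ≤ 0 := by
  induction k with
  | zero => simp [runs, prob, ex]
  | succ k ih =>
    rw [runs, ← add_zero (0 : ℝ)]
    refine prob_bind_not_le I A _ _ _ le_rfl h fun a c hc => ?_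
    rw [← add_zero (0 : ℝ)]
    refine prob_bind_not_le I _ _ (fun (l : List α) c => l.length = k ∧ c ≤ k * b)
      (fun (l : List α) c' => l.length = k + 1 ∧ c + c' ≤ (k + 1) * b) le_rfl ih fun l c' hl => ?_
    have : c + c' ≤ (k + 1) * b := by linarith [hl.2]
    simp [prob, ex, hl.1, this]

/-- A median of a list of real numbers. -/
noncomputable def median (l : List ℝ) : ℝ := (l.insertionSort (· ≤ ·))[l.length / 2]?.getD 0

open Classical in
-- If the median were outside the order-connected `S`, then `S` could not meet both sides of it. So
-- the sorted list up to the median, or from it on, would lie outside `S`, and each of these parts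
-- has at least half of the entries.
theorem median_mem {S : Set ℝ} (hS : S.OrdConnected) {l : List ℝ}
    (hl : 2 * l.countP (· ∉ S) < l.length) : median l ∈ S := by
  by_contra hx
  set s := l.insertionSort (· ≤ ·) with hs
  have hperm : s.Perm l := List.perm_insertionSort _ l
  have hlen : s.length = l.length := hperm.length_eq
  have hsort : s.Pairwise (· ≤ ·) := List.pairwise_insertionSort _ l
  have hcount : s.countP (· ∉ S) = l.countP (· ∉ S) := hperm.countP_eq _
  set h := l.length / 2 with hh
  have hlt : h < s.length := by omega
  have hmed : median l = s[h] := by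
    simp [median, ← hs, ← hh, hlt]
  rw [hmed] at hx
  have hall : (∀ y ∈ s.take (h + 1), y ∉ S) ∨ ∀ y ∈ s.drop h, y ∉ S := by
    by_contra! hcon
    obtain ⟨⟨y, hy, hyS⟩, z, hz, hzS⟩ := hcon
    obtain ⟨i, hi, rfl⟩ := List.mem_take_iff_getElem.1 hy
    obtain ⟨j, hj, rfl⟩ := List.mem_drop_iff_getElem.1 hz
    refine hx (hS.out hyS hzS ⟨?_, ?_⟩)
    · exact hsort.rel_get_of_le (a := ⟨i, by omega⟩) (b := ⟨h, hlt⟩) (by simp; omega)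
    · exact hsort.rel_get_of_le (a := ⟨h, hlt⟩) (b := ⟨h + j, by omega⟩) (by simp)
  have hsplit (k : ℕ) : s.countP (· ∉ S) =
      (s.take k).countP (· ∉ S) + (s.drop k).countP (· ∉ S) := by
    rw [← List.countP_append, List.take_append_drop]
  rcases hall with hall | hall
  · have : (s.take (h + 1)).countP (· ∉ S) = (s.take (h + 1)).length :=
      List.countP_eq_length.2 fun y hy => by simpa using hall y hy
    have h2 := hsplit (h + 1)
    rw [List.length_take] at this
    omega
  · have : (s.drop h).countP (· ∉ S) = (s.drop h).length :=
      List.countP_eq_length.2 fun y hy => by simpa using hall y hy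
    have h2 := hsplit h
    rw [List.length_drop] at this
    omega

/-- The median of `k` independent runs. -/
noncomputable def medianRuns (k : ℕ) (A : Alg n ℝ) : Alg n ℝ :=
  (runs k A).bind fun l => pure (median l)

open Classical in
theorem prob_medianRuns (I : GraphInput n) {k b : ℕ} {A : Alg n ℝ}
    (hc : (A.prob I fun _ c => ¬ c ≤ b) ≤ 0) {S : Set ℝ} (hS : S.OrdConnected)
    (h : (A.prob I fun x _ => x ∉ S) ≤ 1 / 16) :
    ((medianRuns k A).prob I fun x c => ¬ (x ∈ S ∧ c ≤ k * b)) ≤ (1 / 2) ^ k := by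
  -- Markov's inequality for the product of the weights `g`. Its mean is at most `2 ^ k`, as one
  -- factor has mean at most `1 + 15/16`; with at least half of the runs bad it is at least `16 ^
  -- (k/2) = 4 ^ k`.
  set g : ℝ → ℝ := fun x => if x ∉ S then 16 else 1 with hg
  have hg0 (x : ℝ) : 0 ≤ g x := by rw [hg]; dsimp; split_ifs <;> norm_num
  have hg1 : (A.ex I fun x _ => g x) ≤ 2 := by
    have : (fun (x : ℝ) (_ : ℕ) => g x) = fun x c => 15 * (if x ∉ S then 1 else 0) + 1 := by
      ext x c; rw [hg]; dsimp; split_ifs <;> norm_num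
    rw [this, ex_add, ex_const_mul, ex_const]
    have h' : (A.ex I fun x _ => if x ∉ S then (1 : ℝ) else 0) ≤ 1 / 16 := by
      unfold prob at h; convert h using 5
    linarith
  have hprod (l : List ℝ) : (l.map g).prod = 16 ^ l.countP (· ∉ S) := by
    induction l with
    | nil => simp
    | cons x l ih =>
      by_cases hx : x ∈ S
      · rw [List.map_cons, List.prod_cons, ih, List.countP_cons_of_neg (by simpa using hx)]
        simp [hg, hx]
      · rw [List.map_cons, List.prod_cons, ih, List.countP_cons_of_pos (by simpa using hx), pow_succ']
        simp [hg, hx]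
  have hbad : ((runs k A).prob I fun l _ => l.length = k ∧ median l ∉ S) ≤ (1 / 2) ^ k := by
    have h4 : ((2 : ℝ) ^ k / 4 ^ k) = (1 / 2) ^ k := by
      rw [← div_pow]; norm_num
    rw [← h4]
    refine (prob_le_div I (runs k A) (f := fun l _ => (l.map g).prod) (fun l _ => ?_)
      (r := 4 ^ k) (by positivity) fun l c hl => ?_).trans ?_
    · rw [hprod]; positivity
    · rw [hprod, show (16 : ℝ) = 4 ^ 2 by norm_num, ← pow_mul]
      refine pow_le_pow_right₀ (by norm_num) ?_
      by_contra hcon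
      exact hl.2 (median_mem hS (by omega))
    · rw [ex_runs_prod]
      gcongr
      exact ex_nonneg I A fun x _ => hg0 x
  have hlen := prob_runs I k b A hc
  have h2 : ((medianRuns k A).prob I fun x c => ¬ (x ∈ S ∧ c ≤ k * b)) =
      (runs k A).prob I fun l c => ¬ (median l ∈ S ∧ c ≤ k * b) := prob_bind_pure ..
  rw [h2]
  calc _ ≤ (runs k A).prob I fun l c => (l.length = k ∧ median l ∉ S) ∨
        ¬ (l.length = k ∧ c ≤ k * b) := prob_mono I _ fun l c hl => by tauto
    _ ≤ (1 / 2) ^ k + 0 := (prob_or_le I _ _ _).trans (add_le_add hbad hlen)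
    _ = _ := add_zero _

end Alg
end TriangleDP

namespace TriangleDP

/-! ### Degrees and triangles -/

namespace GraphInput

variable {n : ℕ} (I : GraphInput n)

/-- The degree of a vertex. -/
def deg (v : Fin n) : ℕ := (I.nbrs v).length

/-- The comparison of vertices by degree, ties being broken by the label. -/
def key (d : ℕ) (v : Fin n) : ℕ ×ₗ Fin n := toLex (d, v)

/-- `x` comes before `y` in the order by degrees. -/
def Below (x y : Fin n) : Prop := key (I.deg x) x < key (I.deg y) y

theorem Below.asymm {I : GraphInput n} {x y : Fin n} (h : I.Below x y) : ¬ I.Below y x :=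
  not_lt.2 (le_of_lt h)

theorem below_or_below {x y : Fin n} (h : x ≠ y) : I.Below x y ∨ I.Below y x := by
  refine lt_or_gt_of_ne fun hk => h ?_
  exact congrArg (fun k => (ofLex k).2) hk

theorem Below.deg_le {I : GraphInput n} {x y : Fin n} (h : I.Below x y) : I.deg x ≤ I.deg y := by
  rcases Prod.Lex.lt_iff.1 h with h | h
  · exact h.le
  · exact h.1.le

/-- `x y w` is a triangle whose first vertex in the order by degrees is `x`. -/
def Tri (x y w : Fin n) : Prop :=
  I.graph.Adj x y ∧ I.graph.Adj x w ∧ I.graph.Adj y w ∧ I.Below x y ∧ I.Below x w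

theorem tri_comm {x y w : Fin n} : I.Tri x y w ↔ I.Tri x w y := by
  unfold Tri
  rw [I.graph.adj_comm y w]
  tauto

open Classical in
theorem sum_map_nbrs (v : Fin n) (f : Fin n → ℝ) :
    ((I.nbrs v).map f).sum = ∑ u, if I.graph.Adj v u then f u else 0 := by
  rw [← List.sum_toFinset f (I.nodup_nbrs v), ← Finset.sum_filter]
  refine Finset.sum_congr ?_ fun _ _ => rfl
  ext u; simp [I.mem_nbrs]

open Classical in
theorem deg_eq_sum (v : Fin n) : (I.deg v : ℝ) = ∑ u, if I.graph.Adj v u then 1 else 0 := by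
  rw [← sum_map_nbrs]; simp [deg]

theorem deg_le (v : Fin n) : I.deg v ≤ n := by
  simpa [deg] using (I.nodup_nbrs v).length_le_card

theorem sum_deg : ∑ v, (I.deg v : ℝ) = 2 * (numEdges I.graph : ℝ) := by
  classical
  have h := I.graph.sum_degrees_eq_twice_card_edges
  have h2 : numEdges I.graph = I.graph.edgeFinset.card := by
    rw [numEdges, ← SimpleGraph.coe_edgeFinset, Set.ncard_coe_finset]
  rw [h2, ← Nat.cast_sum]
  have h3 (v : Fin n) : I.deg v = I.graph.degree v := I.length_nbrs v
  simp only [h3, h]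
  push_cast; ring

open Classical in
/-- The number of neighbours that come later in the order by degrees. -/
noncomputable def degUp (x : Fin n) : ℝ :=
  ∑ w, if I.graph.Adj x w ∧ I.Below x w then 1 else 0

theorem degUp_nonneg (x : Fin n) : 0 ≤ I.degUp x :=
  Finset.sum_nonneg fun _ _ => by split_ifs <;> norm_num

theorem degUp_le_deg (x : Fin n) : I.degUp x ≤ I.deg x := by
  classical
  rw [deg_eq_sum]
  refine Finset.sum_le_sum fun w _ => ?_
  by_cases h : I.graph.Adj x w <;> by_cases h' : I.Below x w <;> simp [h, h']

/-- Each of the `degUp x` later neighbours has degree at least `deg x ≥ degUp x`, and all degrees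
add up to `2m`. -/
theorem degUp_sq_le (x : Fin n) : I.degUp x ^ 2 ≤ 2 * (numEdges I.graph : ℝ) := by
  classical
  rw [← sum_deg, _root_.sq]
  nth_rw 1 [degUp]
  rw [Finset.sum_mul]
  refine Finset.sum_le_sum fun w _ => ?_
  split_ifs with h
  · rw [one_mul]
    exact (I.degUp_le_deg x).trans (by exact_mod_cast h.2.deg_le)
  · rw [zero_mul]; positivity

theorem degUp_le_sqrt (x : Fin n) : I.degUp x ≤ √(2 * (numEdges I.graph : ℝ)) :=
  Real.le_sqrt_of_sq_le (I.degUp_sq_le x)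

theorem sum_degUp : ∑ x, I.degUp x = (numEdges I.graph : ℝ) := by
  classical
  have h : ∑ x, I.degUp x + ∑ x, I.degUp x = 2 * (numEdges I.graph : ℝ) := by
    rw [← sum_deg]
    simp only [deg_eq_sum]
    nth_rw 2 [show ∑ x, I.degUp x = ∑ x, ∑ w, if I.graph.Adj w x ∧ I.Below w x then (1 : ℝ) else 0
      from Finset.sum_comm]
    rw [← Finset.sum_add_distrib]
    refine Finset.sum_congr rfl fun x _ => ?_
    rw [degUp, ← Finset.sum_add_distrib]
    refine Finset.sum_congr rfl fun w _ => ?_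
    by_cases h : I.graph.Adj x w
    · rcases I.below_or_below h.ne with hb | hb
      · simp [h, hb, hb.asymm]
      · simp [h, hb, hb.asymm, h.symm]
    · simp [h, show ¬ I.graph.Adj w x from fun h' => h h'.symm]
  linarith

open Classical in
-- Bound the minimum by `deg v` if `deg v ≤ √(2m)`, and otherwise by `deg u`, whose sum is `2m`.
-- This bounds the work of scanning every edge at `v` from its endpoint of smaller degree.
theorem sum_min_deg_le (v : Fin n) :
    (∑ u, if I.graph.Adj v u then min (I.deg v : ℝ) (I.deg u) else 0) ≤
      I.deg v * √(2 * (numEdges I.graph : ℝ)) := by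
  set s := √(2 * (numEdges I.graph : ℝ)) with hs
  have hs0 : 0 ≤ s := Real.sqrt_nonneg _
  have hss : s * s = 2 * (numEdges I.graph : ℝ) := Real.mul_self_sqrt (by positivity)
  rcases le_total (I.deg v : ℝ) s with h | h
  · calc _ ≤ ∑ u, (if I.graph.Adj v u then (1 : ℝ) else 0) * I.deg v := by
          refine Finset.sum_le_sum fun u _ => ?_
          split_ifs <;> simp
      _ = I.deg v * I.deg v := by rw [← Finset.sum_mul, ← deg_eq_sum]
      _ ≤ _ := by gcongr
  · calc _ ≤ ∑ u, (I.deg u : ℝ) := by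
          refine Finset.sum_le_sum fun u _ => ?_
          split_ifs <;> simp
      _ = s * s := by rw [sum_deg, hss]
      _ ≤ _ := by gcongr

open Classical in
/-- The ordered triangles that start with their first vertex. -/
noncomputable def triFinset : Finset (Fin n × Fin n × Fin n) :=
  Finset.univ.filter fun z => I.Tri z.1 z.2.1 z.2.2

theorem exists_first {s : Finset (Fin n)} (hs : I.graph.IsNClique 3 s) :
    ∃ a b c, I.Tri a b c ∧ b ≠ c ∧ s = {a, b, c} := by
  obtain ⟨a, b, c, hab, hac, hbc, rfl⟩ := SimpleGraph.is3Clique_iff.1 hs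
  rcases I.below_or_below hab.ne with h1 | h1 <;> rcases I.below_or_below hac.ne with h2 | h2 <;>
    rcases I.below_or_below hbc.ne with h3 | h3
  · exact ⟨a, b, c, ⟨hab, hac, hbc, h1, h2⟩, hbc.ne, rfl⟩
  · exact ⟨a, b, c, ⟨hab, hac, hbc, h1, h2⟩, hbc.ne, rfl⟩
  · exact absurd (lt_trans h1 h3) h2.asymm
  · exact ⟨c, a, b, ⟨hac.symm, hbc.symm, hab, h2, h3⟩, hab.ne, by ext; simp; tauto⟩
  · exact ⟨b, a, c, ⟨hab.symm, hbc, hac, h1, h3⟩, hac.ne, by ext; simp; tauto⟩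
  · exact absurd (lt_trans h2 h3) h1.asymm
  · exact ⟨b, a, c, ⟨hab.symm, hbc, hac, h1, h3⟩, hac.ne, by ext; simp; tauto⟩
  · exact ⟨c, a, b, ⟨hac.symm, hbc.symm, hab, h2, h3⟩, hab.ne, by ext; simp; tauto⟩

/-- The first vertex of a triangle is determined by the order, while the other two may come in
either order. -/
theorem card_triFinset : I.triFinset.card = 2 * numTriangles I.graph := by
  classical
  have ht : numTriangles I.graph = (I.graph.cliqueFinset 3).card := by
    rw [numTriangles, ← SimpleGraph.coe_cliqueFinset, Set.ncard_coe_finset]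
  have hmap : ∀ z ∈ I.triFinset, ({z.1, z.2.1, z.2.2} : Finset (Fin n)) ∈ I.graph.cliqueFinset 3 := by
    rintro ⟨x, y, w⟩ hz
    obtain ⟨h1, h2, h3, -, -⟩ := (Finset.mem_filter.1 hz).2
    rw [SimpleGraph.mem_cliqueFinset_iff]
    exact SimpleGraph.is3Clique_triple_iff.2 ⟨h1, h2, h3⟩
  rw [Finset.card_eq_sum_card_fiberwise hmap, ht, mul_comm, ← smul_eq_mul, ← Finset.sum_const]
  refine Finset.sum_congr rfl fun s hs => ?_
  obtain ⟨a, b, c, habc, hbc, rfl⟩ := I.exists_first ((SimpleGraph.mem_cliqueFinset_iff).1 hs)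
  have : (I.triFinset.filter fun z => ({z.1, z.2.1, z.2.2} : Finset (Fin n)) = {a, b, c}) =
      {(a, b, c), (a, c, b)} := by
    ext ⟨x, y, w⟩
    simp only [triFinset, Finset.mem_filter, Finset.mem_univ, true_and, Finset.mem_insert,
      Finset.mem_singleton, Prod.mk.injEq]
    constructor
    · rintro ⟨⟨h1, h2, h3, h4, h5⟩, he⟩
      have ha : a ∈ ({x, y, w} : Finset (Fin n)) := he ▸ by simp
      have hb : b ∈ ({x, y, w} : Finset (Fin n)) := he ▸ by simp
      have hc : c ∈ ({x, y, w} : Finset (Fin n)) := he ▸ by simp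
      have hx : x ∈ ({a, b, c} : Finset (Fin n)) := he ▸ by simp
      simp only [Finset.mem_insert, Finset.mem_singleton] at ha hb hc hx
      have hxa : x = a := by
        rcases hx with rfl | rfl | rfl
        · rfl
        · rcases ha with rfl | rfl | rfl
          · rfl
          · exact absurd h4 habc.2.2.2.1.asymm
          · exact absurd h5 habc.2.2.2.1.asymm
        · rcases ha with rfl | rfl | rfl
          · rfl
          · exact absurd h4 habc.2.2.2.2.asymm
          · exact absurd h5 habc.2.2.2.2.asymm
      have hab := habc.1.ne
      have hac := habc.2.1.ne
      grind
    · rintro (⟨rfl, rfl, rfl⟩ | ⟨rfl, rfl, rfl⟩)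
      · exact ⟨habc, rfl⟩
      · exact ⟨I.tri_comm.1 habc, by ext; simp; tauto⟩
  rw [this, Finset.card_pair]
  simp [hbc]

open Classical in
theorem sum_tri : (∑ x, ∑ y, ∑ w, if I.Tri x y w then (1 : ℝ) else 0) =
    2 * (numTriangles I.graph : ℝ) := by
  have h := I.card_triFinset
  rw [triFinset, Finset.card_filter] at h
  have h' := congrArg (Nat.cast (R := ℝ)) h
  push_cast at h'
  rw [← h', Fintype.sum_prod_type]
  refine Finset.sum_congr rfl fun x _ => ?_
  rw [Fintype.sum_prod_type]

/-- Each of the `m` edges, directed upwards from `x`, is completed by at most `degUp x ≤ √(2m)`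
vertices after `x`. -/
theorem two_mul_numTriangles_le : 2 * (numTriangles I.graph : ℝ) ≤
    (numEdges I.graph : ℝ) * √(2 * (numEdges I.graph : ℝ)) := by
  classical
  rw [← sum_tri, ← sum_degUp, Finset.sum_mul]
  refine Finset.sum_le_sum fun x _ => ?_
  nth_rw 1 [degUp]
  rw [Finset.sum_mul]
  refine Finset.sum_le_sum fun y _ => ?_
  rw [sum_degUp]
  split_ifs with h
  · rw [one_mul]
    refine le_trans ?_ (I.degUp_le_sqrt x)
    refine Finset.sum_le_sum fun w _ => ?_
    by_cases h' : I.Tri x y w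
    · simp [h', h'.2.1, h'.2.2.2.2]
    · simp only [h', if_false]; split_ifs <;> norm_num
  · rw [zero_mul]
    refine (Finset.sum_eq_zero fun w _ => ?_).le
    rw [if_neg fun h' => h ⟨h'.1, h'.2.2.2.1⟩]

theorem numTriangles_le : (numTriangles I.graph : ℝ) ≤ (n : ℝ) ^ 3 := by
  classical
  have h := I.sum_tri
  have h2 : (∑ x : Fin n, ∑ y : Fin n, ∑ w : Fin n, if I.Tri x y w then (1 : ℝ) else 0) ≤
      ∑ x : Fin n, ∑ y : Fin n, ∑ w : Fin n, 1 := by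
    gcongr; split_ifs <;> norm_num
  rw [h] at h2
  simp at h2
  nlinarith [Nat.cast_nonneg (α := ℝ) (numTriangles I.graph)]

end GraphInput

/-- The sensitivity bound on which privacy rests: a triangle lost with the edge `ab` has the form
`{a, b, w}`, so there are at most `n` of them. -/
theorem numTriangles_le_add {n : ℕ} {G₁ G₂ : SimpleGraph (Fin n)} (h : EdgeNeighboring G₁ G₂) :
    numTriangles G₁ ≤ numTriangles G₂ + n := by
  classical
  obtain ⟨e, he⟩ := h
  induction e with | h a b => ?_
  have hadj (x y : Fin n) (hxy : G₁.Adj x y) (hne : s(x, y) ≠ s(a, b)) : G₂.Adj x y := by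
    have : s(x, y) ∈ G₂.edgeSet \ {s(a, b)} := he ▸ ⟨hxy, hne⟩
    exact this.1
  have hsub : G₁.cliqueSet 3 ⊆ G₂.cliqueSet 3 ∪ Set.range fun w : Fin n => ({a, b, w} : Finset (Fin n)) := by
    intro s hs
    by_cases hmem : a ∈ s ∧ b ∈ s ∧ a ≠ b
    · right
      have hc : s.card = 3 := hs.card_eq
      have : ((s.erase a).erase b).card = 1 := by
        rw [Finset.card_erase_of_mem (by simp [hmem.2.1, hmem.2.2.symm]),
          Finset.card_erase_of_mem hmem.1, hc]
      obtain ⟨w, hw⟩ := Finset.card_eq_one.1 this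
      refine ⟨w, ?_⟩
      dsimp only
      rw [← hw, Finset.insert_erase (by simp [hmem.2.1, hmem.2.2.symm]), Finset.insert_erase hmem.1]
    · left
      refine ⟨fun x hx y hy hxy => hadj x y (hs.isClique hx hy hxy) fun heq => hmem ?_, hs.card_eq⟩
      rcases Sym2.eq_iff.1 heq with ⟨rfl, rfl⟩ | ⟨rfl, rfl⟩
      · exact ⟨hx, hy, hxy⟩
      · exact ⟨hy, hx, hxy.symm⟩
  calc numTriangles G₁ ≤ (G₂.cliqueSet 3 ∪ Set.range fun w : Fin n => ({a, b, w} : Finset (Fin n))).ncard :=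
        Set.ncard_le_ncard hsub (Set.toFinite _)
    _ ≤ numTriangles G₂ + (Set.range fun w : Fin n => ({a, b, w} : Finset (Fin n))).ncard :=
        Set.ncard_union_le _ _
    _ ≤ numTriangles G₂ + n := by
        gcongr
        rw [← Set.image_univ]
        refine (Set.ncard_image_le (Set.toFinite _)).trans ?_
        simp [Set.ncard_univ]

theorem EdgeNeighboring.symm {n : ℕ} {G₁ G₂ : SimpleGraph (Fin n)} (h : EdgeNeighboring G₁ G₂) :
    EdgeNeighboring G₂ G₁ := h.imp fun _ he => he.symm

end TriangleDP

namespace TriangleDP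
namespace Alg

variable {n : ℕ}

/-! ### Typed queries -/

section queries

variable {α : Type} (I : GraphInput n)

/-- Ask for a degree. -/
def askDeg (v : Fin n) (k : ℕ → Alg n α) : Alg n α := .ask (.degree v) k

/-- Ask for a neighbour. -/
def askNbr (v i : Fin n) (k : Option (Fin n) → Alg n α) : Alg n α := .ask (.neighbor v i) k

/-- Ask whether a pair is an edge. -/
def askPair (u v : Fin n) (k : Bool → Alg n α) : Alg n α := .ask (.pair u v) k

theorem ex_askDeg (v : Fin n) (k : ℕ → Alg n α) (f : α → ℕ → ℝ) :
    (askDeg v k).ex I f = (k (I.deg v)).ex I fun a c => f a (c + 1) := rfl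

theorem mean_askDeg (v : Fin n) (k : ℕ → Alg n ℝ) :
    (askDeg v k).mean I = (k (I.deg v)).mean I := rfl

theorem var_askDeg (v : Fin n) (k : ℕ → Alg n ℝ) :
    (askDeg v k).var I = (k (I.deg v)).var I := rfl

theorem cost_askDeg (v : Fin n) (k : ℕ → Alg n α) :
    (askDeg v k).cost I = 1 + (k (I.deg v)).cost I := cost_ask I (.degree v) k

theorem mean_askNbr (v i : Fin n) (k : Option (Fin n) → Alg n ℝ) :
    (askNbr v i k).mean I = (k (I.nbrs v)[(i : ℕ)]?).mean I := rfl

theorem var_askNbr (v i : Fin n) (k : Option (Fin n) → Alg n ℝ) :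
    (askNbr v i k).var I = (k (I.nbrs v)[(i : ℕ)]?).var I := rfl

theorem cost_askNbr (v i : Fin n) (k : Option (Fin n) → Alg n α) :
    (askNbr v i k).cost I = 1 + (k (I.nbrs v)[(i : ℕ)]?).cost I := cost_ask I (.neighbor v i) k

open Classical in
theorem cost_askPair (u v : Fin n) (k : Bool → Alg n α) :
    (askPair u v k).cost I = 1 + (k (decide (I.graph.Adj u v))).cost I := cost_ask I (.pair u v) k

end queries

/-! ### Sampling triangles at a vertex -/

/-- Go through the neighbours of `v`, a vertex of degree `d`, keep each of them independently with
probability `p`, and add up the results of `body`, divided by `p`. -/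
noncomputable def forNbrs (v : Fin n) (d : ℕ) (p : Set.Ioc (0 : ℝ) 1) (body : Fin n → Alg n ℝ) :
    Alg n ℝ :=
  sumL (List.range d) fun i => thin p <|
    -- The index type of neighbour queries demands this test; for a true degree `d ≤ n` it always
    -- succeeds.
    if h : i < n then
      askNbr v ⟨i, h⟩ fun o => o.elim (pure 0) body
    else pure 0

theorem map_range_deg (I : GraphInput n) (v : Fin n) (φ : ℕ → ℝ) (ψ : Fin n → ℝ)
    (h : ∀ (i : ℕ) (hi : i < (I.nbrs v).length), φ i = ψ (I.nbrs v)[i]) :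
    (List.range (I.deg v)).map φ = (I.nbrs v).map ψ := by
  refine List.ext_getElem (by simp [GraphInput.deg]) fun i h1 h2 => ?_
  simp only [List.getElem_map, List.getElem_range]
  exact h i (by simpa using h2)

open Classical in
theorem mean_forNbrs (I : GraphInput n) (v : Fin n) (p : Set.Ioc (0 : ℝ) 1)
    (body : Fin n → Alg n ℝ) : (forNbrs v (I.deg v) p body).mean I =
      ∑ u, if I.graph.Adj v u then (body u).mean I else 0 := by
  rw [forNbrs, mean_sumL, ← I.sum_map_nbrs]
  congr 1
  refine map_range_deg I v _ _ fun i hi => ?_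
  have hn : i < n := lt_of_lt_of_le hi (I.deg_le v)
  rw [mean_thin, dif_pos hn, mean_askNbr, List.getElem?_eq_getElem hi]
  rfl

open Classical in
theorem var_forNbrs (I : GraphInput n) (v : Fin n) (p : Set.Ioc (0 : ℝ) 1)
    (body : Fin n → Alg n ℝ) : (forNbrs v (I.deg v) p body).var I =
      ∑ u, if I.graph.Adj v u then
        (body u).var I / p + (1 / p - 1) * (body u).mean I ^ 2 else 0 := by
  rw [forNbrs, var_sumL, ← I.sum_map_nbrs]
  congr 1
  refine map_range_deg I v _ _ fun i hi => ?_
  have hn : i < n := lt_of_lt_of_le hi (I.deg_le v)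
  rw [var_thin, dif_pos hn, mean_askNbr, var_askNbr, List.getElem?_eq_getElem hi]
  rfl

open Classical in
theorem cost_forNbrs (I : GraphInput n) (v : Fin n) (p : Set.Ioc (0 : ℝ) 1)
    (body : Fin n → Alg n ℝ) : (forNbrs v (I.deg v) p body).cost I =
      ∑ u, if I.graph.Adj v u then p * (1 + (body u).cost I) else 0 := by
  rw [forNbrs, cost_sumL, ← I.sum_map_nbrs]
  congr 1
  refine map_range_deg I v _ _ fun i hi => ?_
  have hn : i < n := lt_of_lt_of_le hi (I.deg_le v)
  rw [cost_thin, dif_pos hn, cost_askNbr, List.getElem?_eq_getElem hi]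
  rfl

/-- Sample the triangles `x y w` whose first vertex is `x`, and run `act` on the sample. -/
noncomputable def edgeScan (r : Set.Ioc (0 : ℝ) 1) (act : Fin n → Fin n → Fin n → Alg n ℝ)
    (x : Fin n) (d : ℕ) (y : Fin n) : Alg n ℝ :=
  forNbrs x d r fun w => askPair w y fun b =>
    if b then askDeg w fun dw =>
      if GraphInput.key d x < GraphInput.key dw w then act x y w else pure 0
    else pure 0

/-- Sample the triangles at the vertex `v` of degree `d`, and run `act` on the sample. -/
noncomputable def vertexScan (q r : Set.Ioc (0 : ℝ) 1) (act : Fin n → Fin n → Fin n → Alg n ℝ)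
    (v : Fin n) (d : ℕ) : Alg n ℝ :=
  forNbrs v d q fun u => askDeg u fun du =>
    if GraphInput.key d v < GraphInput.key du u then edgeScan r act v d u
    else edgeScan r act u du v

open Classical in
/-- The sum of `F` over the triangles `x y w` whose first vertex is `x`. -/
noncomputable def triSum (I : GraphInput n) (F : Fin n → Fin n → Fin n → ℝ) (x y : Fin n) : ℝ :=
  ∑ w, if I.Tri x y w then F x y w else 0

/-- The sum of `F` over the triangles that contain the edge `v u` and the first vertex of which
is `v` or `u`. -/
noncomputable def edgeSum (I : GraphInput n) (F : Fin n → Fin n → Fin n → ℝ) (v u : Fin n) : ℝ :=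
  triSum I F v u + triSum I F u v

theorem triSum_nonneg (I : GraphInput n) {F : Fin n → Fin n → Fin n → ℝ}
    (hF : ∀ x y w, 0 ≤ F x y w) (x y : Fin n) : 0 ≤ triSum I F x y :=
  Finset.sum_nonneg fun w _ => by split_ifs; exacts [hF x y w, le_rfl]

theorem edgeSum_nonneg (I : GraphInput n) {F : Fin n → Fin n → Fin n → ℝ}
    (hF : ∀ x y w, 0 ≤ F x y w) (x y : Fin n) : 0 ≤ edgeSum I F x y :=
  add_nonneg (triSum_nonneg I hF x y) (triSum_nonneg I hF y x)

theorem triSum_mono (I : GraphInput n) {F G : Fin n → Fin n → Fin n → ℝ}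
    (h : ∀ x y w, F x y w ≤ G x y w) (x y : Fin n) : triSum I F x y ≤ triSum I G x y :=
  Finset.sum_le_sum fun w _ => by split_ifs; exacts [h x y w, le_rfl]

theorem triSum_eq_zero (I : GraphInput n) (F : Fin n → Fin n → Fin n → ℝ) {x y : Fin n}
    (h : ¬ (I.graph.Adj x y ∧ I.Below x y)) : triSum I F x y = 0 :=
  Finset.sum_eq_zero fun w _ => by rw [if_neg fun h' => h ⟨h'.1, h'.2.2.2.1⟩]

theorem edgeSum_eq_zero (I : GraphInput n) (F : Fin n → Fin n → Fin n → ℝ) {x y : Fin n}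
    (h : ¬ I.graph.Adj x y) : edgeSum I F x y = 0 := by
  rw [edgeSum, triSum_eq_zero I F fun h' => h h'.1, triSum_eq_zero I F fun h' => h h'.1.symm,
    add_zero]

theorem edgeSum_of_below (I : GraphInput n) (F : Fin n → Fin n → Fin n → ℝ) {x y : Fin n}
    (h : I.Below x y) : edgeSum I F x y = triSum I F x y := by
  rw [edgeSum, triSum_eq_zero I F fun h' => h.asymm h'.2, add_zero]

theorem edgeSum_of_below' (I : GraphInput n) (F : Fin n → Fin n → Fin n → ℝ) {x y : Fin n}
    (h : I.Below y x) : edgeSum I F x y = triSum I F y x := by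
  rw [edgeSum, triSum_eq_zero I F fun h' => h.asymm h'.2, zero_add]

theorem triSum_le_sqrt (I : GraphInput n) {F : Fin n → Fin n → Fin n → ℝ}
    (hF : ∀ x y w, F x y w ≤ 1) (x y : Fin n) :
    triSum I F x y ≤ √(2 * (numEdges I.graph : ℝ)) := by
  classical
  refine le_trans (Finset.sum_le_sum fun w _ => ?_) (I.degUp_le_sqrt x)
  by_cases h : I.Tri x y w
  · simpa [h, h.2.1, h.2.2.2.2] using hF x y w
  · rw [if_neg h]; split_ifs <;> norm_num

/-! ### Means, variances and costs of the scans -/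

section scan

variable (I : GraphInput n) (act : Fin n → Fin n → Fin n → Alg n ℝ)

open Classical in
-- Means and variances do not see the queries; the abstract `g` treats both at once.
theorem edgeScan_body {x y w : Fin n} (hxy : I.graph.Adj x y) (hb : I.Below x y)
    (hw : I.graph.Adj x w) (g : Alg n ℝ → ℝ) (hg0 : g (pure 0) = 0)
    (hgP : ∀ u v k, g (askPair u v k) = g (k (decide (I.graph.Adj u v))))
    (hgD : ∀ v k, g (askDeg v k) = g (k (I.deg v))) :
    g (askPair w y fun b =>
      if b then askDeg w fun dw =>
        if GraphInput.key (I.deg x) x < GraphInput.key dw w then act x y w else pure 0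
      else pure 0) = if I.Tri x y w then g (act x y w) else 0 := by
  rw [hgP]
  by_cases h1 : I.graph.Adj w y
  · rw [decide_eq_true h1, if_pos rfl, hgD]
    by_cases h2 : GraphInput.key (I.deg x) x < GraphInput.key (I.deg w) w
    · rw [if_pos h2, if_pos ⟨hxy, hw, h1.symm, hb, h2⟩]
    · rw [if_neg h2, if_neg fun h => h2 h.2.2.2.2, hg0]
  · rw [decide_eq_false h1, if_neg (by simp), hg0, if_neg fun h => h1 h.2.2.1.symm]

theorem mean_edgeScan (r : Set.Ioc (0 : ℝ) 1) {x y : Fin n} (hxy : I.graph.Adj x y)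
    (hb : I.Below x y) : (edgeScan r act x (I.deg x) y).mean I =
      triSum I (fun x y w => (act x y w).mean I) x y := by
  classical
  rw [edgeScan, mean_forNbrs, triSum]
  refine Finset.sum_congr rfl fun w _ => ?_
  split_ifs with hw h h
  · rw [edgeScan_body I act hxy hb hw (fun A => A.mean I) rfl (fun _ _ _ => rfl) fun _ _ => rfl, if_pos h]
  · rw [edgeScan_body I act hxy hb hw (fun A => A.mean I) rfl (fun _ _ _ => rfl) fun _ _ => rfl, if_neg h]
  · exact absurd h.2.1 hw
  · rfl

/-- Variances of independent samples add. The hypothesis makes each of them at most linear in its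
mean, so the total is at most linear in the total mean. -/
theorem var_edgeScan_le (r : Set.Ioc (0 : ℝ) 1) {K : ℝ}
    (hK : ∀ x y w, (act x y w).var I / r + (1 / r - 1) * (act x y w).mean I ^ 2 ≤
      K * (act x y w).mean I) {x y : Fin n} (hxy : I.graph.Adj x y)
    (hb : I.Below x y) : (edgeScan r act x (I.deg x) y).var I ≤
      K * triSum I (fun x y w => (act x y w).mean I) x y := by
  classical
  rw [edgeScan, var_forNbrs, triSum, Finset.mul_sum]
  refine Finset.sum_le_sum fun w _ => ?_
  split_ifs with hw h h
  · rw [edgeScan_body I act hxy hb hw (fun A => A.mean I) rfl (fun _ _ _ => rfl) fun _ _ => rfl, if_pos h,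
      edgeScan_body I act hxy hb hw (fun A => A.var I) (var_pure I 0)
        (fun _ _ _ => rfl) fun _ _ => rfl, if_pos h]
    exact hK x y w
  · rw [edgeScan_body I act hxy hb hw (fun A => A.mean I) rfl (fun _ _ _ => rfl) fun _ _ => rfl, if_neg h,
      edgeScan_body I act hxy hb hw (fun A => A.var I) (var_pure I 0)
        (fun _ _ _ => rfl) fun _ _ => rfl, if_neg h]
    simp
  · exact absurd h.2.1 hw
  · simp

/-- A sampled neighbour costs at most three queries (neighbour, pair, degree), and `act` is run only
on actual triangles. -/
theorem cost_edgeScan_le (r : Set.Ioc (0 : ℝ) 1) {κ : ℝ} (hκ : ∀ x y w, (act x y w).cost I ≤ κ)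
    {x y : Fin n} (hxy : I.graph.Adj x y) (hb : I.Below x y) :
    (edgeScan r act x (I.deg x) y).cost I ≤
      3 * r * I.deg x + r * κ * triSum I (fun _ _ _ => 1) x y := by
  classical
  have hr := r.2.1.le
  rw [edgeScan, cost_forNbrs, triSum, Finset.mul_sum, I.deg_eq_sum, Finset.mul_sum,
    ← Finset.sum_add_distrib]
  refine Finset.sum_le_sum fun w _ => ?_
  by_cases hw : I.graph.Adj x w
  · rw [if_pos hw, if_pos hw, cost_askPair]
    by_cases h1 : I.graph.Adj w y
    · rw [decide_eq_true h1, if_pos rfl, cost_askDeg]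
      by_cases h2 : GraphInput.key (I.deg x) x < GraphInput.key (I.deg w) w
      · rw [if_pos h2, if_pos ⟨hxy, hw, h1.symm, hb, h2⟩]
        nlinarith [hκ x y w]
      · rw [if_neg h2, if_neg fun h => h2 h.2.2.2.2, cost_pure]
        linarith
    · rw [decide_eq_false h1, if_neg (by simp), cost_pure, if_neg fun h => h1 h.2.2.1.symm]
      linarith
  · rw [if_neg hw, if_neg hw, if_neg fun h => hw h.2.1]
    simp

/-- Directs the edge: the scan runs at the endpoint `x` that comes first, which has the smaller
degree, and one of the two halves of `edgeSum` vanishes. -/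
theorem vertexScan_body {v u : Fin n} (r : Set.Ioc (0 : ℝ) 1) (h : I.graph.Adj v u) :
    ∃ x y, I.graph.Adj x y ∧ I.Below x y ∧ (I.deg x : ℝ) = min (I.deg v : ℝ) (I.deg u) ∧
      (∀ F, edgeSum I F v u = triSum I F x y) ∧
      (if GraphInput.key (I.deg v) v < GraphInput.key (I.deg u) u then edgeScan r act v (I.deg v) u
        else edgeScan r act u (I.deg u) v) = edgeScan r act x (I.deg x) y := by
  rcases I.below_or_below h.ne with hb | hb
  · refine ⟨v, u, h, hb, (min_eq_left (by exact_mod_cast hb.deg_le)).symm,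
      fun F => edgeSum_of_below I F hb, if_pos hb⟩
  · refine ⟨u, v, h.symm, hb, (min_eq_right (by exact_mod_cast hb.deg_le)).symm,
      fun F => edgeSum_of_below' I F hb, if_neg hb.asymm⟩

theorem mean_vertexScan (q r : Set.Ioc (0 : ℝ) 1) (v : Fin n) :
    (vertexScan q r act v (I.deg v)).mean I =
      ∑ u, edgeSum I (fun x y w => (act x y w).mean I) v u := by
  classical
  rw [vertexScan, mean_forNbrs]
  refine Finset.sum_congr rfl fun u _ => ?_
  split_ifs with h
  · obtain ⟨x, y, hxy, hb, -, hs, he⟩ := vertexScan_body I act r h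
    rw [hs, ← mean_edgeScan I act r hxy hb, ← he]
    rfl
  · rw [edgeSum_eq_zero I _ h]

/-- Thinning the edges adds `1/q - 1` times the squared mean at each edge. One of the two factors of
the square is at most `√(2m)`, so this too is linear in the mean. -/
theorem var_vertexScan_le (q r : Set.Ioc (0 : ℝ) 1) {K : ℝ}
    (hK : ∀ x y w, (act x y w).var I / r + (1 / r - 1) * (act x y w).mean I ^ 2 ≤
      K * (act x y w).mean I) (h0 : ∀ x y w, 0 ≤ (act x y w).mean I)
    (h1 : ∀ x y w, (act x y w).mean I ≤ 1) (v : Fin n) :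
    (vertexScan q r act v (I.deg v)).var I ≤
      (K / q + (1 / q - 1) * √(2 * (numEdges I.graph : ℝ))) *
        ∑ u, edgeSum I (fun x y w => (act x y w).mean I) v u := by
  classical
  rw [vertexScan, var_forNbrs, Finset.mul_sum]
  refine Finset.sum_le_sum fun u _ => ?_
  split_ifs with h
  · obtain ⟨x, y, hxy, hb, -, hs, he⟩ := vertexScan_body I act r h
    rw [var_askDeg, mean_askDeg]
    have hv := var_edgeScan_le I act r hK hxy hb
    have hle := triSum_le_sqrt I h1 x y
    have hnn := triSum_nonneg I h0 x y
    have hq : 0 ≤ 1 / (q : ℝ) - 1 := by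
      rw [sub_nonneg, one_le_div q.2.1]; exact q.2.2
    rw [he, hs, mean_edgeScan I act r hxy hb, add_mul, _root_.sq, mul_assoc, div_mul_eq_mul_div]
    have hq' := q.2.1
    gcongr
  · rw [edgeSum_eq_zero I _ h, mul_zero]

theorem cost_vertexScan_le (q r : Set.Ioc (0 : ℝ) 1) {κ : ℝ}
    (hκ : ∀ x y w, (act x y w).cost I ≤ κ) (v : Fin n) :
    (vertexScan q r act v (I.deg v)).cost I ≤
      2 * q * I.deg v + 3 * q * r * (I.deg v * √(2 * (numEdges I.graph : ℝ))) +
        q * r * κ * ∑ u, edgeSum I (fun _ _ _ => 1) v u := by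
  classical
  have hq := q.2.1.le
  have hr := r.2.1.le
  refine le_trans ?_ (add_le_add (add_le_add le_rfl
    (mul_le_mul_of_nonneg_left (I.sum_min_deg_le v) (by positivity))) le_rfl)
  rw [vertexScan, cost_forNbrs, I.deg_eq_sum v, Finset.mul_sum, Finset.mul_sum, Finset.mul_sum,
    ← Finset.sum_add_distrib, ← Finset.sum_add_distrib]
  refine Finset.sum_le_sum fun u _ => ?_
  split_ifs with h
  · obtain ⟨x, y, hxy, hb, hd, hs, he⟩ := vertexScan_body I act r h
    rw [cost_askDeg, he, hs, ← I.deg_eq_sum, ← hd]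
    have hc := cost_edgeScan_le I act r hκ hxy hb
    have := mul_le_mul_of_nonneg_left hc hq
    nlinarith
  · rw [edgeSum_eq_zero I _ h]
    simp

end scan

end Alg
end TriangleDP

namespace TriangleDP
namespace Alg

variable {n : ℕ}

/-! ### Light vertices -/

/-- Decide (with random errors) whether the vertex `z` is light, that is, whether it has degree at
most `D` and lies in at most about `τ` triangles. The result is `1` if it is and `0` otherwise. -/
noncomputable def check (q r : Set.Ioc (0 : ℝ) 1) (D τ : ℝ) (z : Fin n) : Alg n ℝ :=
  askDeg z fun d => if D < d then pure 0 else
    (vertexScan q r (fun _ _ _ => pure 1) z d).bind fun Y => pure (if Y ≤ τ then 1 else 0)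

/-- The probability that `z` is found to be light. -/
noncomputable def light (I : GraphInput n) (q r : Set.Ioc (0 : ℝ) 1) (D τ : ℝ) (z : Fin n) : ℝ :=
  (check q r D τ z).mean I

/-- The number of triangles at `v`, counted twice if `v` is their first vertex. -/
noncomputable def triAt (I : GraphInput n) (v : Fin n) : ℝ := ∑ u, edgeSum I (fun _ _ _ => 1) v u

section

variable (I : GraphInput n) (q r : Set.Ioc (0 : ℝ) 1) (D τ : ℝ)

theorem triAt_nonneg (v : Fin n) : 0 ≤ triAt I v :=
  Finset.sum_nonneg fun u _ => edgeSum_nonneg I (fun _ _ _ => zero_le_one) v u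

/-- The result of the test is a Bernoulli variable, so its mean `light` determines its law. -/
theorem ex_check (z : Fin n) (f : ℝ → ℝ) : ((check q r D τ z).ex I fun x _ => f x) =
    light I q r D τ z * f 1 + (1 - light I q r D τ z) * f 0 := by
  by_cases h : D < I.deg z
  · simp [light, mean, check, ex_askDeg, h, ex]
  · simp only [light, mean, check, ex_askDeg, h, if_false, ex_bind, ex]
    generalize vertexScan q r (fun _ _ _ => pure 1) z (I.deg z) = A
    have h1 : (1 - A.ex I fun Y _ => if Y ≤ τ then (1 : ℝ) else 0) =
        A.ex I fun Y _ => 1 - if Y ≤ τ then (1 : ℝ) else 0 := by rw [ex_sub, ex_const]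
    rw [h1, ← ex_mul_const, ← ex_mul_const, ← ex_add]
    congr; ext Y c
    split_ifs <;> ring

theorem light_nonneg (z : Fin n) : 0 ≤ light I q r D τ z := by
  unfold light check
  rw [mean_askDeg]
  split_ifs
  · simp
  · rw [mean, ex_bind]
    exact ex_nonneg I _ fun _ _ => by simp only [ex]; split_ifs <;> norm_num

theorem light_eq_prob {z : Fin n} (h : I.deg z ≤ D) : light I q r D τ z =
    (vertexScan q r (fun _ _ _ => pure 1) z (I.deg z)).prob I fun Y _ => Y ≤ τ := by
  classical
  rw [light, check, mean_askDeg, if_neg (not_lt.2 h), mean, ex_bind, prob]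
  simp only [ex]

theorem light_le_one (z : Fin n) : light I q r D τ z ≤ 1 := by
  by_cases h : D < I.deg z
  · unfold light check
    rw [mean_askDeg, if_pos h]; simp
  · rw [light_eq_prob I q r D τ (not_lt.1 h)]
    exact prob_le_one _ _ _

theorem mean_vertexScan_one (z : Fin n) :
    (vertexScan q r (fun _ _ _ => pure 1) z (I.deg z)).mean I = triAt I z :=
  mean_vertexScan I _ q r z

theorem var_vertexScan_one_le {B : ℝ}
    (hB : (1 / r - 1) / q + (1 / q - 1) * √(2 * (numEdges I.graph : ℝ)) ≤ B) (z : Fin n) :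
    (vertexScan q r (fun _ _ _ => pure 1) z (I.deg z)).var I ≤ B * triAt I z := by
  refine (var_vertexScan_le I (fun _ _ _ => pure 1) q r (K := 1 / r - 1) ?_ ?_ ?_ z).trans ?_
  · intro x y w; simp
  · intro x y w; simp
  · intro x y w; simp
  · exact mul_le_mul_of_nonneg_right hB (triAt_nonneg I z)

/-- Chebyshev: being rejected requires a deviation of at least `τ/2`, against a variance of at most
`B τ / 2`. -/
theorem one_sub_light_le {B : ℝ} (hτ : 0 < τ)
    (hB : (1 / r - 1) / q + (1 / q - 1) * √(2 * (numEdges I.graph : ℝ)) ≤ B) (hB0 : 0 ≤ B)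
    {z : Fin n} (hz : I.deg z ≤ D) (ht : triAt I z ≤ τ / 2) :
    1 - light I q r D τ z ≤ 2 * B / τ := by
  rw [light_eq_prob I q r D τ hz, ← prob_not]
  refine (prob_mono I _ fun Y c hY => ?_).trans ((prob_abs_sub_le I _ (half_pos hτ)).trans ?_)
  · rw [mean_vertexScan_one]
    exact le_trans (by linarith) (le_abs_self _)
  · rw [div_le_div_iff₀ (by positivity) hτ]
    have := var_vertexScan_one_le I q r hB z
    have h2 : B * triAt I z ≤ B * (τ / 2) := by gcongr
    nlinarith

/-- A vertex with many triangles is accepted only after a deviation of at least half the mean, which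
by Chebyshev has probability at most `4B / triAt`. Heavier vertices are thus accepted so rarely that
the product stays bounded, with no union bound over vertices. -/
theorem light_mul_triAt_le {B : ℝ} (hτ : 0 < τ)
    (hB : (1 / r - 1) / q + (1 / q - 1) * √(2 * (numEdges I.graph : ℝ)) ≤ B) (hB0 : 0 ≤ B)
    (z : Fin n) : light I q r D τ z * triAt I z ≤ 2 * τ + 4 * B := by
  have h1 := light_le_one I q r D τ z
  have h0 := triAt_nonneg I z
  rcases le_total (triAt I z) (2 * τ) with ht | ht
  · nlinarith
  by_cases hz : D < I.deg z
  · have : light I q r D τ z = 0 := by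
      unfold light check
      rw [mean_askDeg, if_pos hz]; simp
    rw [this]; linarith
  have hpos : 0 < triAt I z := by linarith
  have key : light I q r D τ z ≤ B * triAt I z / (triAt I z / 2) ^ 2 := by
    rw [light_eq_prob I q r D τ (not_lt.1 hz)]
    refine (prob_mono I _ fun Y c hY => ?_).trans
      ((prob_abs_sub_le I _ (half_pos hpos)).trans ?_)
    · rw [mean_vertexScan_one, abs_sub_comm]
      exact le_trans (by linarith) (le_abs_self _)
    · gcongr
      exact var_vertexScan_one_le I q r hB z
  have : light I q r D τ z * triAt I z ≤ 4 * B := by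
    calc _ ≤ B * triAt I z / (triAt I z / 2) ^ 2 * triAt I z := by gcongr
      _ = 4 * B := by field_simp; ring
  linarith

theorem cost_check_le (hD : 0 ≤ D) (z : Fin n) : (check q r D τ z).cost I ≤
    1 + 2 * q * D + 3 * q * r * (D * √(2 * (numEdges I.graph : ℝ))) := by
  have hq := q.2.1.le
  have hr := r.2.1.le
  rw [check, cost_askDeg]
  split_ifs with h
  · rw [cost_pure]
    have := Real.sqrt_nonneg (2 * (numEdges I.graph : ℝ))
    have h1 : 0 ≤ 2 * q * D := by positivity
    have h2 : 0 ≤ 3 * q * r * (D * √(2 * (numEdges I.graph : ℝ))) := by positivity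
    linarith
  · rw [cost_bind_pure, add_assoc]
    have := cost_vertexScan_le I (fun _ _ _ => pure 1) q r (κ := 0) (fun _ _ _ => by simp) z
    refine add_le_add le_rfl (this.trans ?_)
    rw [mul_zero, zero_mul, add_zero]
    have h' := not_lt.1 h
    gcongr

/-! ### The weight of a triangle -/

/-- The share of the vertex `v` in the triangle `x y w`, whose first vertex is `x`: the triangle is
shared among its light vertices, the first vertex having two shares. -/
noncomputable def share (v x y w : Fin n) : Alg n ℝ :=
  (check q r D τ x).bind fun lx => (check q r D τ y).bind fun ly => (check q r D τ w).bind fun lw =>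
    pure ((if v = x then lx else if v = y then ly else 0) / (2 * lx + ly + lw))

theorem ex_share (v x y w : Fin n) (f : ℝ → ℝ) :
    ((share q r D τ v x y w).ex I fun a _ => f a) =
      (check q r D τ x).ex I fun lx _ => (check q r D τ y).ex I fun ly _ =>
        (check q r D τ w).ex I fun lw _ =>
          f ((if v = x then lx else if v = y then ly else 0) / (2 * lx + ly + lw)) := by
  simp only [share, ex_bind, ex]

/-- Expansion over the eight outcomes of three independent Bernoulli tests. If no vertex is found
light the quotient is `0 / 0 = 0`, as it should be. -/
theorem ex_share_eq (v x y w : Fin n) (f : ℝ → ℝ) :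
    ((share q r D τ v x y w).ex I fun a _ => f a) =
      (let a := light I q r D τ x
       let b := light I q r D τ y
       let c := light I q r D τ w
       let g : ℝ → ℝ → ℝ → ℝ := fun lx ly lw =>
        f ((if v = x then lx else if v = y then ly else 0) / (2 * lx + ly + lw))
       a * (b * (c * g 1 1 1 + (1 - c) * g 1 1 0) + (1 - b) * (c * g 1 0 1 + (1 - c) * g 1 0 0)) +
       (1 - a) * (b * (c * g 0 1 1 + (1 - c) * g 0 1 0) +
         (1 - b) * (c * g 0 0 1 + (1 - c) * g 0 0 0))) := by
  rw [ex_share, ex_check I q r D τ x fun lx => (check q r D τ y).ex I fun ly _ =>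
        (check q r D τ w).ex I fun lw _ =>
          f ((if v = x then lx else if v = y then ly else 0) / (2 * lx + ly + lw))]
  simp only [ex_check I q r D τ y fun ly => (check q r D τ w).ex I fun lw _ =>
          f ((if v = x then _ else if v = y then ly else 0) / (2 * _ + ly + lw))]
  simp only [ex_check I q r D τ w fun lw =>
          f ((if v = x then _ else if v = y then _ else 0) / (2 * _ + _ + lw))]

theorem mean_share_self (x y w : Fin n) : (share q r D τ x x y w).mean I =
    (let a := light I q r D τ x
     let b := light I q r D τ y
     let c := light I q r D τ w
     a * (b * c / 4 + b * (1 - c) / 3 + (1 - b) * c / 3 + (1 - b) * (1 - c) / 2)) := by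
  rw [mean, ex_share_eq I q r D τ x x y w fun a => a]
  simp only [if_true]
  ring

theorem mean_share_other {x y : Fin n} (h : y ≠ x) (w : Fin n) :
    (share q r D τ y x y w).mean I =
    (let a := light I q r D τ x
     let b := light I q r D τ y
     let c := light I q r D τ w
     b * (a * c / 4 + a * (1 - c) / 3 + (1 - a) * c / 2 + (1 - a) * (1 - c))) := by
  rw [mean, ex_share_eq I q r D τ y x y w fun a => a]
  simp only [if_neg h, if_true]
  ring

/-- With one common outcome of the tests, the shares would add up to `1` unless all three tests
fail. Only means enter, so the identity survives the use of fresh coins for each share. -/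
theorem mean_share_add {x y w : Fin n} (hy : y ≠ x) (hw : w ≠ x) :
    2 * (share q r D τ x x y w).mean I + (share q r D τ y x y w).mean I +
      (share q r D τ w x w y).mean I =
    1 - (1 - light I q r D τ x) * (1 - light I q r D τ y) * (1 - light I q r D τ w) := by
  rw [mean_share_self, mean_share_other I q r D τ hy, mean_share_other I q r D τ hw]
  ring

theorem mean_share_nonneg (v x y w : Fin n) : 0 ≤ (share q r D τ v x y w).mean I := by
  have a0 := light_nonneg I q r D τ x
  have a1 := light_le_one I q r D τ x
  have b0 := light_nonneg I q r D τ y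
  have b1 := light_le_one I q r D τ y
  have c0 := light_nonneg I q r D τ w
  have c1 := light_le_one I q r D τ w
  rw [mean, ex_share_eq I q r D τ v x y w fun a => a]
  have : 0 ≤ 1 - light I q r D τ x := by linarith
  have : 0 ≤ 1 - light I q r D τ y := by linarith
  have : 0 ≤ 1 - light I q r D τ w := by linarith
  dsimp only
  split_ifs <;> positivity

/-- The share is at most `1`, and it vanishes unless `v` is found light. -/
theorem mean_share_le (v x y w : Fin n) :
    (share q r D τ v x y w).mean I ≤ light I q r D τ v := by
  have a0 := light_nonneg I q r D τ x
  have a1 := light_le_one I q r D τ x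
  have b0 := light_nonneg I q r D τ y
  have b1 := light_le_one I q r D τ y
  have c0 := light_nonneg I q r D τ w
  have c1 := light_le_one I q r D τ w
  by_cases hx : v = x
  · subst hx
    rw [mean_share_self]
    refine mul_le_of_le_one_right a0 ?_
    nlinarith [mul_nonneg b0 c0, mul_nonneg b0 (sub_nonneg.2 c1), mul_nonneg c0 (sub_nonneg.2 b1),
      mul_nonneg (sub_nonneg.2 b1) (sub_nonneg.2 c1)]
  by_cases hy : v = y
  · subst hy
    rw [mean_share_other I q r D τ hx]
    refine mul_le_of_le_one_right b0 ?_
    nlinarith [mul_nonneg a0 c0, mul_nonneg a0 (sub_nonneg.2 c1), mul_nonneg c0 (sub_nonneg.2 a1),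
      mul_nonneg (sub_nonneg.2 a1) (sub_nonneg.2 c1)]
  · rw [mean, ex_share_eq I q r D τ v x y w fun a => a]
    simp only [hx, hy, if_false]
    simpa using light_nonneg I q r D τ v

theorem sq_share_le (v x y w : Fin n) :
    (share q r D τ v x y w).sq I ≤ (share q r D τ v x y w).mean I := by
  have a0 := light_nonneg I q r D τ x
  have a1 := sub_nonneg.2 (light_le_one I q r D τ x)
  have b0 := light_nonneg I q r D τ y
  have b1 := sub_nonneg.2 (light_le_one I q r D τ y)
  have c0 := light_nonneg I q r D τ w
  have c1 := sub_nonneg.2 (light_le_one I q r D τ w)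
  rw [mean, sq, ex_share_eq I q r D τ v x y w fun a => a, ex_share_eq I q r D τ v x y w fun a => a ^ 2]
  dsimp only
  split_ifs <;> gcongr <;> norm_num

theorem cost_share_le {κ : ℝ} (hκ : ∀ z, (check (n := n) q r D τ z).cost I ≤ κ) (v x y w : Fin n) :
    (share q r D τ v x y w).cost I ≤ 3 * κ := by
  simp only [share, cost_bind, cost_pure, ex_const, add_zero]
  linarith [hκ x, hκ y, hκ w]

/-! ### The estimator -/

/-- An estimator of the number of triangles. -/
noncomputable def triEst (p : Set.Ioc (0 : ℝ) 1) : Alg n ℝ :=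
  sumL (List.finRange n) fun v => thin p <| askDeg v fun d =>
    vertexScan q r (share q r D τ v) v d

/-- The expected contribution of a vertex to the estimator. -/
noncomputable def contrib (v : Fin n) : ℝ :=
  ∑ u, edgeSum I (fun x y w => (share q r D τ v x y w).mean I) v u

theorem contrib_nonneg (v : Fin n) : 0 ≤ contrib I q r D τ v :=
  Finset.sum_nonneg fun u _ => edgeSum_nonneg I (fun _ _ _ => mean_share_nonneg I q r D τ v _ _ _) v u

theorem contrib_le (v : Fin n) : contrib I q r D τ v ≤ light I q r D τ v * triAt I v := by
  classical
  rw [contrib, triAt, Finset.mul_sum]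
  refine Finset.sum_le_sum fun u _ => ?_
  rw [edgeSum, edgeSum, mul_add]
  refine add_le_add ?_ ?_
  all_goals
    rw [triSum, triSum, Finset.mul_sum]
    refine Finset.sum_le_sum fun w _ => ?_
    split_ifs
    · rw [mul_one]; exact mean_share_le I q r D τ v _ _ _
    · simp

theorem mean_triEst (p : Set.Ioc (0 : ℝ) 1) :
    (triEst q r D τ p).mean I = ∑ v, contrib I q r D τ v := by
  rw [triEst, mean_sumL, ← Fin.sum_univ_def]
  refine Finset.sum_congr rfl fun v _ => ?_
  rw [mean_thin, mean_askDeg, mean_vertexScan, contrib]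

/-- Thinning vertices adds `1/p - 1` times the squared contribution of each. One factor is bounded
by `2τ + 4B` thanks to the lightness test, which keeps the whole variance linear in the mean. -/
theorem var_triEst_le (p : Set.Ioc (0 : ℝ) 1) {B : ℝ} (hτ : 0 < τ)
    (hB : (1 / r - 1) / q + (1 / q - 1) * √(2 * (numEdges I.graph : ℝ)) ≤ B) (hB0 : 0 ≤ B) :
    (triEst q r D τ p).var I ≤
      ((1 / r / q + (1 / q - 1) * √(2 * (numEdges I.graph : ℝ))) / p +
        (1 / p - 1) * (2 * τ + 4 * B)) * (triEst q r D τ p).mean I := by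
  rw [mean_triEst, triEst, var_sumL, ← Fin.sum_univ_def, Finset.mul_sum]
  refine Finset.sum_le_sum fun v _ => ?_
  rw [var_thin, mean_askDeg, var_askDeg]
  have hp : 0 ≤ 1 / (p : ℝ) - 1 := by
    rw [sub_nonneg, one_le_div p.2.1]; exact p.2.2
  have hp' := p.2.1
  have hm : (vertexScan q r (share q r D τ v) v (I.deg v)).mean I = contrib I q r D τ v := by
    rw [mean_vertexScan, contrib]
  have hv := var_vertexScan_le I (share q r D τ v) q r (K := 1 / r) (fun x y w => by
      have h := sq_share_le I q r D τ v x y w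
      have hr := r.2.1
      have e : (share q r D τ v x y w).var I / r + (1 / r - 1) * (share q r D τ v x y w).mean I ^ 2 =
        (1 / r) * (share q r D τ v x y w).sq I - (share q r D τ v x y w).mean I ^ 2 := by
        rw [var]; ring
      rw [e]
      have : (1 / (r : ℝ)) * (share q r D τ v x y w).sq I ≤
        1 / r * (share q r D τ v x y w).mean I := by gcongr
      nlinarith [sq_nonneg ((share q r D τ v x y w).mean I)])
    (mean_share_nonneg I q r D τ v) (fun x y w => (mean_share_le I q r D τ v x y w).trans
      (light_le_one I q r D τ v)) v
  change _ ≤ _ * contrib I q r D τ v at hv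
  have hc := (contrib_le I q r D τ v).trans (light_mul_triAt_le I q r D τ hτ hB hB0 v)
  have hc0 := contrib_nonneg I q r D τ v
  rw [hm, add_mul, _root_.sq, mul_assoc (1 / (p : ℝ) - 1), div_mul_eq_mul_div]
  gcongr

/-- Sums over the triangles, ordered so that the first vertex comes first. -/
noncomputable def triTotal (F : Fin n → Fin n → Fin n → ℝ) : ℝ :=
  ∑ x, ∑ y, triSum I F x y

theorem triTotal_one : triTotal I (fun _ _ _ => 1) = 2 * (numTriangles I.graph : ℝ) := by
  rw [← I.sum_tri]; rfl

theorem triTotal_swap (F : Fin n → Fin n → Fin n → ℝ) :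
    triTotal I F = triTotal I fun x y w => F x w y := by
  classical
  refine Finset.sum_congr rfl fun x _ => ?_
  simp only [triSum]
  rw [Finset.sum_comm]
  refine Finset.sum_congr rfl fun y _ => Finset.sum_congr rfl fun w _ => ?_
  simp only [I.tri_comm (x := x) (y := w) (w := y)]

theorem triTotal_add (F G : Fin n → Fin n → Fin n → ℝ) :
    (triTotal I fun x y w => F x y w + G x y w) = triTotal I F + triTotal I G := by
  classical
  simp only [triTotal, ← Finset.sum_add_distrib, triSum]
  refine Finset.sum_congr rfl fun x _ => Finset.sum_congr rfl fun y _ =>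
    Finset.sum_congr rfl fun w _ => ?_
  split_ifs <;> simp

theorem triTotal_congr {F G : Fin n → Fin n → Fin n → ℝ}
    (h : ∀ x y w, I.Tri x y w → F x y w = G x y w) : triTotal I F = triTotal I G := by
  classical
  refine Finset.sum_congr rfl fun x _ => Finset.sum_congr rfl fun y _ =>
    Finset.sum_congr rfl fun w _ => ?_
  split_ifs with h'
  exacts [h x y w h', rfl]

theorem triTotal_mono {F G : Fin n → Fin n → Fin n → ℝ}
    (h : ∀ x y w, F x y w ≤ G x y w) : triTotal I F ≤ triTotal I G :=
  Finset.sum_le_sum fun x _ => Finset.sum_le_sum fun y _ => triSum_mono I h x y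

/-- The ordered triangle `x y w` is met through the edge `xy` from either end: once with `v = x`,
once with `v = y`. -/
theorem sum_edgeSum (F : Fin n → Fin n → Fin n → Fin n → ℝ) :
    ∑ v, ∑ u, edgeSum I (F v) v u = triTotal I fun x y w => F x x y w + F y x y w := by
  rw [triTotal_add]
  simp only [edgeSum, Finset.sum_add_distrib]
  congr 1
  rw [Finset.sum_comm]
  rfl

theorem sum_triAt : ∑ v, triAt I v = 4 * (numTriangles I.graph : ℝ) := by
  simp only [triAt]
  rw [sum_edgeSum I fun _ _ _ _ => 1, triTotal_add I (fun _ _ _ => 1) (fun _ _ _ => 1), triTotal_one]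
  ring

/-- Exchanging `y` and `w` turns half of the shares of `y` into shares of `w`; then `mean_share_add`
applies to each ordered triangle. -/
theorem two_mul_mean_triEst (p : Set.Ioc (0 : ℝ) 1) :
    2 * (triEst q r D τ p).mean I = triTotal I fun x y w =>
      1 - (1 - light I q r D τ x) * (1 - light I q r D τ y) * (1 - light I q r D τ w) := by
  rw [mean_triEst]
  simp only [contrib]
  rw [sum_edgeSum I fun v x y w => (share q r D τ v x y w).mean I, two_mul,
    triTotal_add I (fun x y w => (share q r D τ x x y w).mean I)
      fun x y w => (share q r D τ y x y w).mean I]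
  have hswap := triTotal_swap I fun x y w => (share q r D τ y x y w).mean I
  rw [triTotal_congr I (fun x y w h => (mean_share_add I q r D τ h.1.ne' h.2.1.ne').symm),
    triTotal_add, triTotal_add, ← hswap]
  simp only [two_mul]
  rw [triTotal_add]
  ring

theorem mean_triEst_le (p : Set.Ioc (0 : ℝ) 1) :
    (triEst q r D τ p).mean I ≤ numTriangles I.graph := by
  have h := two_mul_mean_triEst I q r D τ p
  have h2 : (triTotal I fun x y w => 1 - (1 - light I q r D τ x) * (1 - light I q r D τ y) *
      (1 - light I q r D τ w)) ≤ triTotal I fun _ _ _ => 1 := triTotal_mono I fun x y w => by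
    have := mul_nonneg (mul_nonneg (sub_nonneg.2 (light_le_one I q r D τ x))
      (sub_nonneg.2 (light_le_one I q r D τ y))) (sub_nonneg.2 (light_le_one I q r D τ w))
    linarith
  rw [triTotal_one] at h2
  linarith

/-- A triangle is lost only if all three tests fail. Outside `W ³` this has probability at most `η`;
inside there are at most `h ³` ordered triangles, each counted with weight `1/2`. -/
theorem mean_triEst_ge (p : Set.Ioc (0 : ℝ) 1) (W : Finset (Fin n)) {h η : ℝ}
    (hW : (W.card : ℝ) ≤ h) (hη : 0 ≤ η) (hl : ∀ z ∉ W, 1 - light I q r D τ z ≤ η) :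
    numTriangles I.graph - (h ^ 3 / 2 + η * numTriangles I.graph) ≤ (triEst q r D τ p).mean I := by
  classical
  have h' := two_mul_mean_triEst I q r D τ p
  set ind : Fin n → ℝ := fun z => if z ∈ W then 1 else 0 with hind
  have hpt : ∀ x y w, (1 - light I q r D τ x) * (1 - light I q r D τ y) *
      (1 - light I q r D τ w) ≤ ind x * ind y * ind w + η := by
    intro x y w
    have a0 := sub_nonneg.2 (light_le_one I q r D τ x)
    have b0 := sub_nonneg.2 (light_le_one I q r D τ y)
    have c0 := sub_nonneg.2 (light_le_one I q r D τ w)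
    have a1 : 1 - light I q r D τ x ≤ 1 := by linarith [light_nonneg I q r D τ x]
    have b1 : 1 - light I q r D τ y ≤ 1 := by linarith [light_nonneg I q r D τ y]
    have c1 : 1 - light I q r D τ w ≤ 1 := by linarith [light_nonneg I q r D τ w]
    have hab := mul_le_one₀ a1 b0 b1
    have hab0 := mul_nonneg a0 b0
    by_cases hx : x ∈ W
    · by_cases hy : y ∈ W
      · by_cases hw : w ∈ W
        · simp only [hind, hx, hy, hw, if_true]
          nlinarith [mul_le_one₀ hab c0 c1]
        · simp only [hind, hw, if_false, mul_zero, zero_add]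
          nlinarith [hl w hw]
      · simp only [hind, hy, if_false, mul_zero, zero_mul, zero_add]
        have := hl y hy
        have h1 := mul_le_of_le_one_left b0 a1
        have h2 := mul_le_of_le_one_right hab0 c1
        linarith
    · simp only [hind, hx, if_false, zero_mul, zero_add]
      have := hl x hx
      have h1 := mul_le_of_le_one_right a0 b1
      have h2 := mul_le_of_le_one_right hab0 c1
      linarith
  have h1 : (triTotal I fun x y w => (1 - ind x * ind y * ind w) + (-η)) ≤
      triTotal I fun x y w => 1 - (1 - light I q r D τ x) * (1 - light I q r D τ y) *
      (1 - light I q r D τ w) := triTotal_mono I fun x y w => by linarith [hpt x y w]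
  have h2 : triTotal I (fun x y w => (1 - ind x * ind y * ind w) + (-η)) +
      triTotal I (fun x y w => ind x * ind y * ind w) + triTotal I (fun _ _ _ => η) =
      2 * (numTriangles I.graph : ℝ) := by
    rw [← triTotal_add, ← triTotal_add, ← triTotal_one]
    exact triTotal_congr I fun _ _ _ _ => by ring
  have h3 : triTotal I (fun x y w => ind x * ind y * ind w) ≤ h ^ 3 := by
    have hs : ∑ z, ind z = W.card := by simp [hind]
    have h0 (z) : 0 ≤ ind z := by rw [hind]; dsimp; split_ifs <;> norm_num
    calc _ ≤ ∑ x, ∑ y, ∑ w, ind x * ind y * ind w := by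
          refine Finset.sum_le_sum fun x _ => Finset.sum_le_sum fun y _ =>
            Finset.sum_le_sum fun w _ => ?_
          split_ifs
          · rfl
          · exact mul_nonneg (mul_nonneg (h0 x) (h0 y)) (h0 w)
      _ = (∑ z, ind z) ^ 3 := by
          rw [pow_succ, _root_.sq, Finset.sum_mul_sum, Finset.sum_mul]
          simp only [Finset.sum_mul, Finset.mul_sum]
          exact Finset.sum_congr rfl fun x _ => Finset.sum_comm
      _ ≤ h ^ 3 := by rw [hs]; gcongr
  have h4 : triTotal I (fun _ _ _ => η) = η * (2 * (numTriangles I.graph : ℝ)) := by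
    rw [← triTotal_one, triTotal, triTotal, Finset.mul_sum]
    refine Finset.sum_congr rfl fun x _ => ?_
    rw [Finset.mul_sum]
    refine Finset.sum_congr rfl fun y _ => ?_
    rw [triSum, triSum, Finset.mul_sum]
    refine Finset.sum_congr rfl fun w _ => ?_
    split_ifs <;> simp
  linarith

theorem cost_triEst_le (p : Set.Ioc (0 : ℝ) 1) (hD : 0 ≤ D) :
    (triEst (n := n) q r D τ p).cost I ≤
      p * (n + 2 * q * (2 * numEdges I.graph) +
        3 * q * r * (2 * numEdges I.graph * √(2 * (numEdges I.graph : ℝ))) +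
        q * r * (3 * (1 + 2 * q * D + 3 * q * r * (D * √(2 * (numEdges I.graph : ℝ))))) *
          (4 * numTriangles I.graph)) := by
  rw [triEst, cost_sumL, ← Fin.sum_univ_def]
  simp only [cost_thin, cost_askDeg]
  rw [← Finset.mul_sum]
  have hp := p.2.1.le
  refine mul_le_mul_of_nonneg_left ?_ hp
  refine (Finset.sum_le_sum fun v _ => add_le_add le_rfl
    (cost_vertexScan_le I (share q r D τ v) q r
      (cost_share_le I q r D τ (cost_check_le I q r D τ hD) v) v)).trans (le_of_eq ?_)
  simp only [Finset.sum_add_distrib, ← Finset.mul_sum, ← Finset.sum_mul, I.sum_deg]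
  have h : ∑ v, ∑ u, edgeSum I (fun _ _ _ => 1) v u = 4 * (numTriangles I.graph : ℝ) := sum_triAt I
  rw [h]
  simp only [Finset.sum_const, Finset.card_univ, Fintype.card_fin, nsmul_eq_mul, mul_one]
  ring

end

end Alg
end TriangleDP

namespace TriangleDP
namespace Alg

variable {n : ℕ} {α β ι : Type}

/-! ### Sure properties of the result -/

/-- All possible results satisfy `P`, whatever the answers to the queries are. -/
def All (P : α → Prop) : Alg n α → Prop
  | .pure a => P a
  | .ask _ next => ∀ x, (next x).All P
  | .rand _ _ next => ∀ i, (next i).All P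

theorem All.bind {P : α → Prop} {Q : β → Prop} {A : Alg n α} (hA : A.All P) {g : α → Alg n β}
    (hg : ∀ a, P a → (g a).All Q) : (A.bind g).All Q := by
  induction A with
  | pure a => exact hg a hA
  | ask q next ih => exact fun x => ih x (hA x)
  | rand w hw next ih => exact fun i => ih i (hA i)

theorem All.ex_mono (I : GraphInput n) {P : α → Prop} {A : Alg n α} (hA : A.All P)
    {f g : α → ℕ → ℝ} (h : ∀ a c, P a → f a c ≤ g a c) : A.ex I f ≤ A.ex I g := by
  induction A generalizing f g with
  | pure a => exact h a 0 hA
  | ask q next ih => exact ih _ (hA _) fun a c => h a (c + 1)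
  | rand w hw next ih =>
    exact Finset.sum_le_sum fun i _ => mul_le_mul_of_nonneg_left (ih i (hA i) h) (hw.1 i)

/-- Markov's inequality for the result. -/
theorem All.prob_le_div (I : GraphInput n) {A : Alg n ℝ} (hA : A.All (0 ≤ ·)) {r : ℝ}
    (hr : 0 < r) : (A.prob I fun x _ => r ≤ x) ≤ A.mean I / r := by
  rw [div_eq_mul_inv, mean, ← ex_mul_const]
  refine hA.ex_mono I fun x c hx => ?_
  split_ifs with h
  · rw [← div_eq_mul_inv, le_div_iff₀ hr, one_mul]; exact h
  · positivity

theorem all_pure {P : α → Prop} {a : α} (h : P a) : (pure a : Alg n α).All P := h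

theorem All.sumL {l : List ι} {f : ι → Alg n ℝ} (h : ∀ i, (f i).All (0 ≤ ·)) :
    (sumL l f).All (0 ≤ ·) := by
  induction l with
  | nil => exact le_refl (0 : ℝ)
  | cons i l ih => exact (h i).bind fun x hx => ih.bind fun y hy => add_nonneg hx hy

theorem All.thin (p : Set.Ioc (0 : ℝ) 1) {A : Alg n ℝ} (h : A.All (0 ≤ ·)) :
    (thin p A).All (0 ≤ ·) := by
  intro i
  fin_cases i
  · exact h.bind fun x hx => div_nonneg hx p.2.1.le
  · exact le_refl (0 : ℝ)

theorem All.forNbrs (v : Fin n) (d : ℕ) (p : Set.Ioc (0 : ℝ) 1) {body : Fin n → Alg n ℝ}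
    (h : ∀ u, (body u).All (0 ≤ ·)) : (forNbrs v d p body).All (0 ≤ ·) := by
  refine All.sumL fun i => All.thin p ?_
  split_ifs
  · intro o
    change All _ (Option.elim o _ _)
    cases o
    · exact le_refl (0 : ℝ)
    · exact h _
  · exact le_refl (0 : ℝ)

theorem All.vertexScan (q r : Set.Ioc (0 : ℝ) 1) {act : Fin n → Fin n → Fin n → Alg n ℝ}
    (h : ∀ x y w, (act x y w).All (0 ≤ ·)) (v : Fin n) (d : ℕ) :
    (vertexScan q r act v d).All (0 ≤ ·) := by
  have hedge : ∀ x d y, (edgeScan r act x d y).All (0 ≤ ·) := by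
    refine fun x d y => All.forNbrs x d r fun w => ?_
    intro (b : Bool)
    cases b
    · exact le_refl (0 : ℝ)
    · intro (dw : ℕ)
      by_cases hk : GraphInput.key d x < GraphInput.key dw w
      · simpa [hk] using h x y w
      · simpa [hk] using all_pure (P := (0 ≤ ·)) (le_refl (0 : ℝ))
  refine All.forNbrs v d q fun u => ?_
  intro (du : ℕ)
  by_cases hk : GraphInput.key d v < GraphInput.key du u
  · simpa [hk] using hedge v d u
  · simpa [hk] using hedge u du v

theorem all_check (q r : Set.Ioc (0 : ℝ) 1) (D τ : ℝ) (z : Fin n) :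
    (check q r D τ z).All (0 ≤ ·) := by
  intro (d : ℕ)
  by_cases h : D < d
  · simpa [h] using all_pure (P := (0 ≤ ·)) (le_refl (0 : ℝ))
  · simp only [h, if_false]
    refine (All.vertexScan q r (fun _ _ _ => all_pure (zero_le_one (α := ℝ))) z d).bind fun Y _ => ?_
    change (0 : ℝ) ≤ _
    split_ifs <;> norm_num

theorem all_triEst (q r : Set.Ioc (0 : ℝ) 1) (D τ : ℝ) (p : Set.Ioc (0 : ℝ) 1) :
    (triEst (n := n) q r D τ p).All (0 ≤ ·) := by
  refine All.sumL fun v => All.thin p ?_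
  intro (d : ℕ)
  refine All.vertexScan q r (fun x y w => ?_) v d
  refine (all_check q r D τ x).bind fun a ha => (all_check q r D τ y).bind fun b hb =>
    (all_check q r D τ w).bind fun c hc => ?_
  change (0 : ℝ) ≤ _
  split_ifs <;> positivity

theorem All.avg (R : ℕ) {A : Alg n ℝ} (h : A.All (0 ≤ ·)) : (avg R A).All (0 ≤ ·) :=
  (All.sumL fun _ => h).bind fun _ hs => div_nonneg hs R.cast_nonneg

/-! ### Estimating the number of edges -/

/-- The probability `1 / (1 + s)`. -/
noncomputable def invOneAdd (s : ℝ) : Set.Ioc (0 : ℝ) 1 :=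
  ⟨1 / (1 + max s 0), by
    have := le_max_right s 0
    constructor
    · positivity
    · rw [div_le_one (by positivity)]; linarith⟩

theorem coe_invOneAdd {s : ℝ} (hs : 0 ≤ s) : (invOneAdd s : ℝ) = 1 / (1 + s) := by
  change 1 / (1 + max s 0) = _
  rw [max_eq_left hs]

theorem one_div_invOneAdd {s : ℝ} (hs : 0 ≤ s) : 1 / (invOneAdd s : ℝ) = 1 + s := by
  rw [coe_invOneAdd hs, one_div_one_div]

/-- An estimator of twice the number of edges. -/
noncomputable def edgeEst (p : Set.Ioc (0 : ℝ) 1) : Alg n ℝ :=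
  sumL (List.finRange n) fun v => thin p <| askDeg v fun d => pure (d : ℝ)

theorem mean_edgeEst (I : GraphInput n) (p : Set.Ioc (0 : ℝ) 1) :
    (edgeEst p).mean I = 2 * numEdges I.graph := by
  rw [edgeEst, mean_sumL, ← Fin.sum_univ_def, ← I.sum_deg]
  simp [mean_thin, mean_askDeg]

theorem cost_edgeEst (I : GraphInput n) (p : Set.Ioc (0 : ℝ) 1) :
    (edgeEst p).cost I = p * n := by
  rw [edgeEst, cost_sumL, ← Fin.sum_univ_def]
  simp [cost_thin, cost_askDeg, mul_comm]

theorem all_edgeEst (p : Set.Ioc (0 : ℝ) 1) : (edgeEst (n := n) p).All (0 ≤ ·) :=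
  All.sumL fun _ => All.thin p fun d : ℕ => (Nat.cast_nonneg d : (0 : ℝ) ≤ d)

/-- Larger summands give a larger random sum. -/
theorem ex_sumL_thin_antitone (I : GraphInput n) (p : Set.Ioc (0 : ℝ) 1) (l : List (Fin n))
    {b : Fin n → ℝ} (hb : ∀ v, b v ≤ I.deg v) {g : ℝ → ℝ} (hg : Antitone g) :
    ((sumL l fun v => thin p <| askDeg v fun d => pure (d : ℝ)).ex I fun x _ => g x) ≤
      (sumL (n := n) l fun v => thin p <| pure (b v)).ex I fun x _ => g x := by
  have hp := p.2.1
  have hp1 := sub_nonneg.2 p.2.2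
  induction l generalizing g with
  | nil => exact le_rfl
  | cons v l ih =>
    simp only [sumL, ex_bind, ex_thin, ex_askDeg, ex]
    gcongr ?_ * ?_ + ?_ * ?_
    · refine (ex_mono I _ fun x c => ?_).trans (ih (g := fun x => g (b v / p + x)) ?_)
      · apply hg; gcongr; exact hb v
      · intro x y hxy; apply hg; gcongr
    · exact ih (g := fun x => g (0 + x)) fun x y hxy => hg (by gcongr)

/-- Degrees may be too uneven for Chebyshev, as in a star. For a lower bound they can be replaced by
the smaller numbers `degUp`, which still add up to `m` but are at most `√(2m)`. Moreover `θ =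
O(√m)`, since `θ³ ≤ 16 t` and `t = O(m ^ (3/2))`. -/
theorem prob_edgeEst_lt (I : GraphInput n) {θ : ℝ} (hθ : 0 < θ)
    (hm : 0 < numEdges I.graph) (h : θ ^ 3 ≤ 16 * numTriangles I.graph) :
    ((edgeEst (invOneAdd (θ / 512))).prob I fun x _ => x < (numEdges I.graph : ℝ) / 2) ≤ 1 / 32 := by
  classical
  set m : ℝ := (numEdges I.graph : ℝ) with hmdef
  have hm0 : 0 < m := Nat.cast_pos.2 hm
  set p := invOneAdd (θ / 512) with hp
  have hp1 : 1 / (p : ℝ) = 1 + θ / 512 := one_div_invOneAdd (by positivity)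
  set A : Alg n ℝ := sumL (List.finRange n) fun v => thin p <| pure (I.degUp v) with hA
  have hmean : A.mean I = m := by
    rw [hA, mean_sumL, ← Fin.sum_univ_def, hmdef, ← I.sum_degUp]
    simp [mean_thin]
  set s := √(2 * m) with hs
  have hs0 : 0 < s := Real.sqrt_pos.2 (by positivity)
  have hss : s ^ 2 = 2 * m := Real.sq_sqrt (by positivity)
  have hvar : A.var I ≤ θ / 512 * (s * m) := by
    rw [hA, var_sumL, ← Fin.sum_univ_def, hmdef, ← I.sum_degUp, Finset.mul_sum, Finset.mul_sum]
    refine Finset.sum_le_sum fun v _ => ?_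
    rw [var_thin, hp1, var_pure, mean_pure, zero_div, zero_add, add_sub_cancel_left, _root_.sq]
    have := I.degUp_nonneg v
    gcongr
    exact I.degUp_le_sqrt v
  have hdom : ((edgeEst p).prob I fun x _ => x < m / 2) ≤ A.prob I fun x _ => x < m / 2 := by
    refine ex_sumL_thin_antitone I p (List.finRange n) I.degUp_le_deg
      (g := fun x => if x < m / 2 then 1 else 0) ?_
    intro x y hxy
    dsimp only
    split_ifs with h1 h2
    · exact le_rfl
    · exact absurd (lt_of_le_of_lt hxy h1) h2
    · norm_num
    · exact le_rfl
  have hcheb : (A.prob I fun x _ => x < m / 2) ≤ A.var I / (m / 2) ^ 2 := by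
    refine (prob_mono I A fun x c hx => ?_).trans (prob_abs_sub_le I A (half_pos hm0))
    rw [hmean, abs_sub_comm]
    exact le_trans (by linarith) (le_abs_self _)
  have hθs : θ ≤ 2 * s := by
    have h2 := I.two_mul_numTriangles_le
    rw [← hmdef, ← hs] at h2
    by_contra hcon
    have h3 : (2 * s) ^ 3 < θ ^ 3 := by gcongr; linarith
    have h4 : (2 * s) ^ 3 = 16 * (m * s) := by
      calc (2 * s) ^ 3 = 8 * s ^ 2 * s := by ring
        _ = _ := by rw [hss]; ring
    nlinarith [mul_pos hm0 hs0]
  refine hdom.trans (hcheb.trans ?_)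
  rw [div_le_iff₀ (by positivity)]
  refine hvar.trans ?_
  have : θ * s ≤ 2 * s * s := by gcongr
  nlinarith

end Alg
end TriangleDP

namespace TriangleDP
namespace Alg

variable {n : ℕ}

/-! ### The estimator for a guess of the number of triangles -/

/-- The estimator of the number of triangles for the guess `θ ^ 3` of this number, the bound `M` of
the square root of twice the number of edges, and the precision `a`. -/
noncomputable def guessEst (n : ℕ) (a θ M : ℝ) : Alg n ℝ :=
  triEst (invOneAdd (θ ^ 2 / M)) (invOneAdd ((1 + θ ^ 2) / (1 + θ ^ 2 / M) - 1))
    (4 * M ^ 2 / (a / 32 * θ)) (32 * θ ^ 2 / (a / 32)) (invOneAdd θ)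

/-- The bound for the expected number of queries of `guessEst`. -/
noncomputable def guessCost (n : ℕ) (a θ M : ℝ) : ℝ :=
  n / θ + 200 + 128000 * M ^ 3 / (a * θ ^ 3)

theorem mean_guessEst_le (I : GraphInput n) (a θ M : ℝ) :
    (guessEst n a θ M).mean I ≤ numTriangles I.graph :=
  mean_triEst_le I _ _ _ _ _

/-! ### Bias, variance and cost for a good guess -/

section

variable (I : GraphInput n) {a θ M : ℝ}

/-- The rates are `p ≈ 1/θ`, `q ≈ M/θ²` and `q r ≈ 1/θ²`, each with a `1 +` that keeps it at most
`1`. The third is legitimate because `M ≥ 1` implies `θ²/M ≤ θ²`. -/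
theorem guess_params
    (hθ : 0 < θ) (hM : 1 ≤ M) :
    1 / (invOneAdd θ : ℝ) = 1 + θ ∧ 1 / (invOneAdd (θ ^ 2 / M) : ℝ) = 1 + θ ^ 2 / M ∧
    1 / (invOneAdd ((1 + θ ^ 2) / (1 + θ ^ 2 / M) - 1) : ℝ) = (1 + θ ^ 2) / (1 + θ ^ 2 / M) := by
  have hM0 : 0 < M := by linarith
  refine ⟨one_div_invOneAdd hθ.le, one_div_invOneAdd (by positivity), ?_⟩
  rw [one_div_invOneAdd]
  · ring
  · rw [sub_nonneg, one_le_div (by positivity)]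
    have : θ ^ 2 / M ≤ θ ^ 2 := div_le_self (by positivity) hM
    linarith

theorem guess_variance_bound
    (hθ : 0 < θ) (hM : 1 ≤ M) (hmM : 2 * (numEdges I.graph : ℝ) ≤ M ^ 2) :
    (1 / (invOneAdd ((1 + θ ^ 2) / (1 + θ ^ 2 / M) - 1) : ℝ) - 1) / (invOneAdd (θ ^ 2 / M) : ℝ) +
      (1 / (invOneAdd (θ ^ 2 / M) : ℝ) - 1) * √(2 * (numEdges I.graph : ℝ)) ≤ 2 * θ ^ 2 := by
  have hM0 : 0 < M := by linarith
  obtain ⟨-, hq, hr⟩ := guess_params hθ hM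
  rw [div_eq_mul_one_div (_ - _), hr, hq]
  have hs : √(2 * (numEdges I.graph : ℝ)) ≤ M := Real.sqrt_le_iff.2 ⟨hM0.le, hmM⟩
  have h1 : (1 + θ ^ 2 / M - 1) * √(2 * (numEdges I.graph : ℝ)) ≤ θ ^ 2 := by
    calc _ ≤ (1 + θ ^ 2 / M - 1) * M := by
          gcongr
          rw [add_sub_cancel_left]; positivity
      _ = θ ^ 2 := by field_simp; ring
  have h2 : ((1 + θ ^ 2) / (1 + θ ^ 2 / M) - 1) * (1 + θ ^ 2 / M) = θ ^ 2 - θ ^ 2 / M := by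
    have : 1 + θ ^ 2 / M ≠ 0 := by positivity
    field_simp; ring
  have h3 : 0 ≤ θ ^ 2 / M := by positivity
  linarith

/-- With `b = a/32`, at most `2m/D ≤ bθ/4` vertices have degree above `D`, and at most `4t/(τ/2) ≤
4bθ` have `triAt` above `τ/2`. So the heavy set has at most `5bθ` vertices and spans `O(b³θ³)`,
hence `O(b³ t)`, triangles. All other vertices are rejected with probability at most `b/8`. -/
theorem mean_guessEst_ge
    (ha : 0 < a) (ha1 : a ≤ 1 / 2) (hθ : 0 < θ) (hM : 1 ≤ M)
    (hmM : 2 * (numEdges I.graph : ℝ) ≤ M ^ 2) (hlo : (numTriangles I.graph : ℝ) ≤ 16 * θ ^ 3)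
    (hhi : θ ^ 3 ≤ 16 * numTriangles I.graph) : (1 - a / 4) * numTriangles I.graph ≤ (guessEst n a θ M).mean I := by
  classical
  set t : ℝ := (numTriangles I.graph : ℝ) with htdef
  set m : ℝ := (numEdges I.graph : ℝ) with hmdef
  have ht0 : 0 ≤ t := Nat.cast_nonneg _
  have hM0 : 0 < M := by linarith
  set b := a / 32 with hb
  have hb0 : 0 < b := by positivity
  set D := 4 * M ^ 2 / (b * θ) with hD
  set τ := 32 * θ ^ 2 / b with hτ
  have hD0 : 0 < D := by positivity
  have hτ0 : 0 < τ := by positivity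
  have hB := guess_variance_bound I hθ hM hmM
  set W : Finset (Fin n) := Finset.univ.filter fun z => D < I.deg z ∨ τ / 2 < triAt I z with hW
  have hcard : (W.card : ℝ) ≤ 5 * b * θ := by
    have h1 : (W.card : ℝ) ≤ ∑ z, ((I.deg z : ℝ) / D + triAt I z / (τ / 2)) := by
      rw [Finset.cast_card]
      calc ∑ z ∈ W, (1 : ℝ) ≤ ∑ z ∈ W, ((I.deg z : ℝ) / D + triAt I z / (τ / 2)) := by
            refine Finset.sum_le_sum fun z hz => ?_
            have h3 : 0 ≤ (I.deg z : ℝ) / D := by positivity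
            have h4 : 0 ≤ triAt I z / (τ / 2) := div_nonneg (triAt_nonneg I z) (by positivity)
            rcases (Finset.mem_filter.1 hz).2 with h | h
            · have := (one_le_div hD0).2 h.le
              linarith
            · have := (one_le_div (half_pos hτ0)).2 h.le
              linarith
        _ ≤ _ := by
            refine Finset.sum_le_sum_of_subset_of_nonneg (Finset.subset_univ _) fun z _ _ => ?_
            exact add_nonneg (by positivity) (div_nonneg (triAt_nonneg I z) (by positivity))
    rw [Finset.sum_add_distrib, ← Finset.sum_div, ← Finset.sum_div, I.sum_deg, sum_triAt] at h1
    have h2 : 2 * m / D ≤ b * θ / 4 := by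
      rw [div_le_iff₀ hD0, hD]
      calc 2 * m ≤ M ^ 2 := hmM
        _ = b * θ / 4 * (4 * M ^ 2 / (b * θ)) := by field_simp
    have h3 : 4 * t / (τ / 2) ≤ 4 * (b * θ) := by
      rw [div_le_iff₀ (half_pos hτ0), hτ]
      calc 4 * t ≤ 4 * (16 * θ ^ 3) := by gcongr
        _ = 4 * (b * θ) * (32 * θ ^ 2 / b / 2) := by field_simp; ring
    have : 0 < b * θ := by positivity
    linarith
  have hη : ∀ z ∉ W, 1 - light I (invOneAdd (θ ^ 2 / M))
      (invOneAdd ((1 + θ ^ 2) / (1 + θ ^ 2 / M) - 1)) D τ z ≤ b / 8 := by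
    intro z hz
    have hz' : ¬ (D < I.deg z ∨ τ / 2 < triAt I z) := fun h => hz (by simp [hW, h])
    push Not at hz'
    refine (one_sub_light_le I _ _ D τ hτ0 hB (by positivity) hz'.1 hz'.2).trans (le_of_eq ?_)
    rw [hτ]; field_simp; ring
  have h := mean_triEst_ge I _ _ D τ (invOneAdd θ) W hcard (by positivity) hη
  change _ ≤ (guessEst n a θ M).mean I at h
  refine le_trans ?_ h
  have h5 : (5 * b * θ) ^ 3 / 2 ≤ a * t / 8 := by
    calc (5 * b * θ) ^ 3 / 2 = 125 / 2 * b ^ 3 * θ ^ 3 := by ring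
      _ ≤ 125 / 2 * b ^ 3 * (16 * t) := by gcongr
      _ = a * t * (1000 / 32768 * a ^ 2) := by rw [hb]; ring
      _ ≤ a * t * (1 / 8) := by
          gcongr
          nlinarith
      _ = a * t / 8 := by ring
  have h6 : b / 8 * t ≤ a * t / 8 := by
    rw [hb]; nlinarith [mul_nonneg ha.le ht0]
  linarith

/-- The coefficient in `var_triEst_le` is of order `1 + θ³/a`; with `θ³ ≤ 16 t` and `1 ≤ t` it is
`O(t/a)`, and the mean supplies the other factor `t`. -/
theorem var_guessEst_le
    (ha : 0 < a) (ha1 : a ≤ 1 / 2) (hθ : 0 < θ) (hM : 1 ≤ M)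
    (hmM : 2 * (numEdges I.graph : ℝ) ≤ M ^ 2) (ht : 0 < numTriangles I.graph)
    (hhi : θ ^ 3 ≤ 16 * numTriangles I.graph) :
    (guessEst n a θ M).var I ≤ 38400 / a * (numTriangles I.graph : ℝ) ^ 2 := by
  set t : ℝ := (numTriangles I.graph : ℝ) with htdef
  have ht1 : 1 ≤ t := by exact_mod_cast Nat.one_le_cast.2 ht
  have hM0 : 0 < M := by linarith
  have hB := guess_variance_bound I hθ hM hmM
  obtain ⟨hp, hq, hr⟩ := guess_params hθ hM
  have h := var_triEst_le I (invOneAdd (θ ^ 2 / M)) (invOneAdd ((1 + θ ^ 2) / (1 + θ ^ 2 / M) - 1))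
    (4 * M ^ 2 / (a / 32 * θ)) (32 * θ ^ 2 / (a / 32)) (invOneAdd θ) (by positivity) hB (by positivity)
  change (guessEst n a θ M).var I ≤ _ * (guessEst n a θ M).mean I at h
  have hV : 1 / (invOneAdd ((1 + θ ^ 2) / (1 + θ ^ 2 / M) - 1) : ℝ) / (invOneAdd (θ ^ 2 / M) : ℝ) +
      (1 / (invOneAdd (θ ^ 2 / M) : ℝ) - 1) * √(2 * (numEdges I.graph : ℝ)) ≤ 1 + 3 * θ ^ 2 := by
    rw [sub_div, hq] at hB
    have : 1 / (invOneAdd (θ ^ 2 / M) : ℝ) ≤ 1 + θ ^ 2 := by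
      rw [hq]
      have : θ ^ 2 / M ≤ θ ^ 2 := div_le_self (by positivity) hM
      linarith
    rw [hq] at this ⊢
    linarith
  refine h.trans ?_
  rw [div_eq_mul_one_div (_ + _), hp, add_sub_cancel_left]
  have hmean := mean_guessEst_le I a θ M
  rw [← htdef] at hmean
  have hm0 : 0 ≤ (guessEst n a θ M).mean I := by
    rw [mean, ← ex_const I (guessEst n a θ M) 0]
    exact (all_triEst _ _ _ _ _).ex_mono I fun x _ hx => hx
  have hcoef : (1 + 3 * θ ^ 2) * (1 + θ) + θ * (2 * (32 * θ ^ 2 / (a / 32)) + 4 * (2 * θ ^ 2)) ≤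
      38400 / a * t := by
    have e1 : θ * (2 * (32 * θ ^ 2 / (a / 32)) + 4 * (2 * θ ^ 2)) = θ ^ 3 * (2048 / a + 8) := by
      field_simp; ring
    have h1 : θ ≤ 1 + θ ^ 3 := by nlinarith [sq_nonneg (θ - 1), mul_pos hθ hθ]
    have h2 : θ ^ 2 ≤ 1 + θ ^ 3 := by nlinarith [sq_nonneg (θ - 1), mul_pos hθ hθ]
    have e2 : (1 + 3 * θ ^ 2) * (1 + θ) ≤ 5 + 7 * θ ^ 3 := by nlinarith
    have h3 : θ ^ 3 * (2048 / a + 8) ≤ 16 * t * (2048 / a + 8) := by gcongr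
    have h4 : 2 ≤ 1 / a := by rw [le_div_iff₀ ha]; linarith
    have e3 : 38400 / a * t = 16 * t * (2048 / a) + 5632 * (1 / a) * t := by ring
    rw [e1, e3]
    nlinarith
  calc _ ≤ ((1 + 3 * θ ^ 2) * (1 + θ) + θ * (2 * (32 * θ ^ 2 / (a / 32)) + 4 * (2 * θ ^ 2))) *
        (guessEst n a θ M).mean I := by gcongr
    _ ≤ (38400 / a * t) * t := by gcongr
    _ = _ := by ring

/-- The scans give `n/θ` and `M³/θ³`. The lightness tests are run on an expected `O(t/θ³) = O(1)`
sampled triangles, and the degree cutoff `D` bounds each by `O(1 + M D/θ²)`, which is where the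
factor `1/a` enters. -/
theorem cost_guessEst_le
    (ha : 0 < a) (ha1 : a ≤ 1 / 2) (hθ : 0 < θ) (hM : 1 ≤ M)
    (hmM : 2 * (numEdges I.graph : ℝ) ≤ M ^ 2) (hlo : (numTriangles I.graph : ℝ) ≤ 16 * θ ^ 3) : (guessEst n a θ M).cost I ≤ guessCost n a θ M := by
  set t : ℝ := (numTriangles I.graph : ℝ) with htdef
  set m : ℝ := (numEdges I.graph : ℝ) with hmdef
  have ht0 : 0 ≤ t := Nat.cast_nonneg _
  have hm0 : 0 ≤ m := Nat.cast_nonneg _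
  have hM0 : 0 < M := by linarith
  obtain ⟨hp, hq, hr⟩ := guess_params hθ hM
  set p := invOneAdd θ
  set q := invOneAdd (θ ^ 2 / M)
  set r := invOneAdd ((1 + θ ^ 2) / (1 + θ ^ 2 / M) - 1)
  set D := 4 * M ^ 2 / (a / 32 * θ) with hD
  have hD0 : 0 ≤ D := by positivity
  have h := cost_triEst_le I q r D (32 * θ ^ 2 / (a / 32)) p hD0
  change (guessEst n a θ M).cost I ≤ _ at h
  refine h.trans ?_
  set s := √(2 * (numEdges I.graph : ℝ)) with hs
  have hs0 : 0 ≤ s := Real.sqrt_nonneg _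
  have hsM : s ≤ M := Real.sqrt_le_iff.2 ⟨hM0.le, hmM⟩
  have hp0 := p.2.1
  have hq0 := q.2.1
  have hr0 := r.2.1
  have hple : (p : ℝ) ≤ 1 / θ := by
    rw [le_div_iff₀ hθ]
    have : (p : ℝ) * (1 + θ) = 1 := by rw [← hp]; field_simp
    linarith
  have hqle : (q : ℝ) ≤ M / θ ^ 2 := by
    rw [le_div_iff₀ (by positivity)]
    have : (q : ℝ) * (1 + θ ^ 2 / M) = 1 := by rw [← hq]; field_simp
    have h2 : (q : ℝ) * (M + θ ^ 2) = M := by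
      calc (q : ℝ) * (M + θ ^ 2) = (q : ℝ) * (1 + θ ^ 2 / M) * M := by field_simp
        _ = M := by rw [this, one_mul]
    nlinarith
  have hqr : (q : ℝ) * r ≤ 1 / θ ^ 2 := by
    rw [le_div_iff₀ (by positivity)]
    have h1 : 1 / (q : ℝ) * (1 / r) = 1 + θ ^ 2 := by
      rw [hq, hr]; field_simp
    have : (q : ℝ) * r * (1 + θ ^ 2) = 1 := by rw [← h1]; field_simp
    nlinarith [mul_pos hq0 hr0]
  have h1 : 2 * q * (2 * m) ≤ 2 * (M / θ ^ 2) * M ^ 2 := by gcongr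
  have h2 : 3 * q * r * (2 * m * s) ≤ 3 * (1 / θ ^ 2) * (M ^ 2 * M) := by
    rw [mul_assoc 3]; gcongr
  have h3 : 1 + 2 * q * D + 3 * q * r * (D * s) ≤ 1 + 5 * (M * D / θ ^ 2) := by
    have e1 : 2 * q * D ≤ 2 * (M / θ ^ 2) * D := by gcongr
    have e2 : 3 * q * r * (D * s) ≤ 3 * (1 / θ ^ 2) * (D * M) := by
      rw [mul_assoc 3]; gcongr
    have e3 : 2 * (M / θ ^ 2) * D + 3 * (1 / θ ^ 2) * (D * M) = 5 * (M * D / θ ^ 2) := by ring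
    linarith
  have h4 : q * r * (3 * (1 + 2 * q * D + 3 * q * r * (D * s))) * (4 * t) ≤
      1 / θ ^ 2 * (3 * (1 + 5 * (M * D / θ ^ 2))) * (4 * (16 * θ ^ 3)) := by gcongr
  calc _ ≤ 1 / θ * (n + 2 * (M / θ ^ 2) * M ^ 2 + 3 * (1 / θ ^ 2) * (M ^ 2 * M) +
        1 / θ ^ 2 * (3 * (1 + 5 * (M * D / θ ^ 2))) * (4 * (16 * θ ^ 3))) := by gcongr
    _ = n / θ + 192 + (5 + 122880 / a) * (M ^ 3 / θ ^ 3) := by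
        rw [hD]; field_simp; ring
    _ ≤ n / θ + 200 + (128000 / a) * (M ^ 3 / θ ^ 3) := by
        have h5 : (5 + 122880 / a) ≤ 128000 / a := by
          have : 5 ≤ 5120 / a := by rw [le_div_iff₀ ha]; linarith
          have e : 128000 / a = 122880 / a + 5120 / a := by ring
          linarith
        gcongr
        norm_num
    _ = guessCost n a θ M := by rw [guessCost]; field_simp

/-- The number of repetitions that makes the variance small. -/
noncomputable def reps (a : ℝ) : ℕ := ⌈4915200 / a ^ 3⌉₊

theorem reps_pos
    (ha : 0 < a) : 0 < reps a := Nat.ceil_pos.2 (by positivity)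

/-- The averaged estimator, with a bounded number of queries. -/
noncomputable def guessRun (n : ℕ) (a θ M : ℝ) : Alg n ℝ :=
  trunc 0 ⌈32 * reps a * guessCost n a θ M⌉₊ (avg (reps a) (guessEst n a θ M))

/-- If the guess is far too large, Markov's inequality for the nonnegative estimator suffices:
neither `M` nor the budget need be adequate, since aborting returns `0`. -/
theorem prob_guessRun_large
    (ha : 0 < a) (hθ : 0 < θ) (h : 16 * (numTriangles I.graph : ℝ) < θ ^ 3) :
    ((guessRun n a θ M).prob I fun x _ => x ∉ Set.Iio (θ ^ 3)) ≤ 1 / 16 := by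
  have hθ3 : 0 < θ ^ 3 := by positivity
  refine (prob_trunc_le_of_not I 0 _ _ (fun x => x ∉ Set.Iio (θ ^ 3)) (by simpa using hθ3)).trans ?_
  have hall : (guessEst n a θ M).All (0 ≤ ·) := all_triEst _ _ _ _ _
  have h2 := (All.avg (reps a) hall).prob_le_div I hθ3
  rw [mean_avg I (reps_pos ha)] at h2
  simp only [Set.mem_Iio, not_lt]
  refine h2.trans ?_
  rw [div_le_iff₀ hθ3]
  linarith [mean_guessEst_le I a θ M]

theorem prob_guessRun_window
    (ha : 0 < a) (ha1 : a ≤ 1 / 2) (hθ : 0 < θ) (hM : 1 ≤ M)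
    (hmM : 2 * (numEdges I.graph : ℝ) ≤ M ^ 2) (ht : 0 < numTriangles I.graph)
    (hlo : (numTriangles I.graph : ℝ) ≤ 16 * θ ^ 3) (hhi : θ ^ 3 ≤ 16 * numTriangles I.graph) :
    ((guessRun n a θ M).prob I fun x _ => x ∉ Set.Icc ((1 - a) * (numTriangles I.graph : ℝ))
      ((1 + a) * (numTriangles I.graph : ℝ))) ≤ 1 / 16 := by
  have hmean1 := mean_guessEst_le I a θ M
  have hmean2 := mean_guessEst_ge I ha ha1 hθ hM hmM hlo hhi
  have hvar := var_guessEst_le I ha ha1 hθ hM hmM ht hhi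
  have hcost := cost_guessEst_le I ha ha1 hθ hM hmM hlo
  set t : ℝ := (numTriangles I.graph : ℝ) with htdef
  have ht0 : 0 < t := Nat.cast_pos.2 ht
  have hM0 : 0 < M := by linarith
  have hR := reps_pos ha
  have hR' : (0 : ℝ) < reps a := Nat.cast_pos.2 hR
  have hgc : 0 < guessCost n a θ M := by unfold guessCost; positivity
  set A := avg (reps a) (guessEst n a θ M) with hA
  have hAm : A.mean I = (guessEst n a θ M).mean I := mean_avg I hR _
  have hAv : A.var I = (guessEst n a θ M).var I / reps a := var_avg I hR _
  have hAc : A.cost I = reps a * (guessEst n a θ M).cost I := cost_avg I _ _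
  have hat : 0 < a * t := by positivity
  have h1 : (A.prob I fun x _ => x ∉ Set.Icc ((1 - a) * t) ((1 + a) * t)) ≤ 1 / 32 := by
    refine (prob_mono I A fun x c hx => ?_).trans
      ((prob_abs_sub_le I A (r := a * t / 2) (by positivity)).trans ?_)
    · by_contra hcon
      rw [not_le, hAm, abs_lt] at hcon
      refine hx ⟨?_, ?_⟩
      · nlinarith
      · nlinarith
    -- `4915200 = 38400 * 4 * 32`: the variance constant, the square of the radius `a t / 2`, and
    -- the allowed failure `1/32`.
    · have hRge : 4915200 / a ^ 3 ≤ reps a := Nat.le_ceil _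
      have hR3 : 4915200 ≤ reps a * a ^ 3 := by rwa [div_le_iff₀ (by positivity)] at hRge
      rw [hAv, div_le_iff₀ (by positivity), div_le_iff₀ hR']
      refine hvar.trans ?_
      rw [div_mul_eq_mul_div, div_le_iff₀ ha]
      nlinarith [mul_le_mul_of_nonneg_right hR3 (sq_nonneg t)]
  have h2 : (A.prob I fun _ c => ⌈32 * reps a * guessCost n a θ M⌉₊ < c) ≤ 1 / 32 := by
    refine (prob_le_div I A (f := fun _ c => (c : ℝ)) (fun _ c => c.cast_nonneg)
      (r := 32 * reps a * guessCost n a θ M) (by positivity) fun x c hc => ?_).trans ?_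
    · exact (Nat.lt_of_ceil_lt hc).le
    · change A.cost I / _ ≤ _
      rw [hAc, div_le_iff₀ (by positivity)]
      nlinarith
  refine (prob_trunc_le I 0 _ A _).trans ((prob_or_le I A _ _).trans ?_)
  linarith

end

end Alg
end TriangleDP

namespace TriangleDP
namespace Alg

variable {n : ℕ}

/-! ### One round of the search -/

/-- The estimator of the number of edges, with a bounded number of queries. -/
noncomputable def edgeRun (n : ℕ) (θ : ℝ) : Alg n ℝ :=
  trunc 0 ⌈32768 * (n / θ)⌉₊ (edgeEst (invOneAdd (θ / 512)))

theorem prob_edgeEst_large (I : GraphInput n) (p : Set.Ioc (0 : ℝ) 1) :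
    ((edgeEst p).prob I fun x _ => x ∉ Set.Iic (128 * (numEdges I.graph : ℝ) + 1)) ≤ 1 / 64 := by
  have hm : (0 : ℝ) ≤ numEdges I.graph := Nat.cast_nonneg _
  refine (prob_mono I _ fun x c hx => ?_).trans (((all_edgeEst p).prob_le_div I
    (r := 128 * (numEdges I.graph : ℝ) + 1) (by positivity)).trans ?_)
  · exact (not_le.1 hx).le
  · rw [mean_edgeEst, div_le_iff₀ (by positivity)]
    linarith

theorem prob_edgeRun_large (I : GraphInput n) (θ : ℝ) :
    ((edgeRun n θ).prob I fun x _ => x ∉ Set.Iic (128 * (numEdges I.graph : ℝ) + 1)) ≤ 1 / 16 := by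
  refine (prob_trunc_le_of_not I 0 _ _
    (fun x => x ∉ Set.Iic (128 * (numEdges I.graph : ℝ) + 1)) ?_).trans
    ((prob_edgeEst_large I _).trans (by norm_num))
  rw [not_not, Set.mem_Iic]
  positivity

theorem prob_edgeRun_window (I : GraphInput n) {θ : ℝ} (hθ : 0 < θ) (hn : 0 < n)
    (hm : 0 < numEdges I.graph) (h : θ ^ 3 ≤ 16 * numTriangles I.graph) :
    ((edgeRun n θ).prob I fun x _ => x ∉ Set.Icc ((numEdges I.graph : ℝ) / 2)
      (128 * (numEdges I.graph : ℝ) + 1)) ≤ 1 / 16 := by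
  set p := invOneAdd (θ / 512) with hp
  have hn' : (0 : ℝ) < n := Nat.cast_pos.2 hn
  have h1 := prob_edgeEst_lt I hθ hm h
  have h2 := prob_edgeEst_large I p
  have h3 : ((edgeEst p).prob I fun _ c => ⌈32768 * (n / θ)⌉₊ < c) ≤ 1 / 64 := by
    refine (prob_le_div I _ (f := fun _ c => (c : ℝ)) (fun _ c => c.cast_nonneg)
      (r := 32768 * (n / θ)) (by positivity) fun x c hc => (Nat.lt_of_ceil_lt hc).le).trans ?_
    change (edgeEst p).cost I / _ ≤ _
    rw [cost_edgeEst, div_le_iff₀ (by positivity), hp, coe_invOneAdd (by positivity)]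
    have : 1 / (1 + θ / 512) ≤ 512 / θ := by
      rw [div_le_div_iff₀ (by positivity) hθ]
      linarith
    calc _ ≤ 512 / θ * n := by gcongr
      _ = _ := by ring
  refine (prob_trunc_le I 0 _ _ _).trans ?_
  calc _ ≤ (edgeEst p).prob I fun x c => (x < (numEdges I.graph : ℝ) / 2 ∨
        x ∉ Set.Iic (128 * (numEdges I.graph : ℝ) + 1)) ∨ ⌈32768 * (n / θ)⌉₊ < c := by
        refine prob_mono I _ fun x c hx => ?_
        rcases hx with hx | hx
        · left
          by_contra hcon
          rw [not_or, not_not, not_lt] at hcon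
          exact hx ⟨hcon.1, hcon.2⟩
        · exact Or.inr hx
    _ ≤ (1 / 32 + 1 / 64) + 1 / 64 :=
        (prob_or_le I _ _ _).trans (add_le_add ((prob_or_le I _ _ _).trans (add_le_add h1 h2)) h3)
    _ = 1 / 16 := by norm_num

/-- The bound of the square root of twice the number of edges that belongs to the estimate `x`. -/
noncomputable def rootBound (x : ℝ) : ℝ := √(4 * max x 0 + 1)

theorem one_le_rootBound (x : ℝ) : 1 ≤ rootBound x := by
  rw [rootBound, Real.one_le_sqrt]
  linarith [le_max_right x 0]

/-- One round of the search: estimate the number of edges, then the number of triangles with the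
guess `θ ^ 3`. -/
noncomputable def searchRound (n : ℕ) (a : ℝ) (k : ℕ) (θ : ℝ) : Alg n ℝ :=
  (medianRuns k (edgeRun n θ)).bind fun x => medianRuns k (guessRun n a θ (rootBound x))

/-- The bound for the number of queries in a round. -/
noncomputable def roundCost (n : ℕ) (a : ℝ) (k : ℕ) (m θ : ℝ) : ℕ :=
  k * ⌈32768 * (n / θ)⌉₊ + k * ⌈32 * reps a * guessCost n a θ √(512 * m + 5)⌉₊

/-- For a much too large guess only an upper bound for the estimated number of edges is needed, to
control the budget. For a good guess the lower bound is needed as well, so that `rootBound`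
dominates `√(2m)`. Two medians are taken, hence the factor `2`. -/
theorem prob_searchRound (I : GraphInput n) {a θ : ℝ} (k : ℕ) (ha : 0 < a) (ha1 : a ≤ 1 / 2)
    (hθ : 0 < θ) (hn : 0 < n) (hlo : (numTriangles I.graph : ℝ) ≤ 16 * θ ^ 3) :
    ((searchRound n a k θ).prob I fun x c => ¬ (c ≤ roundCost n a k (numEdges I.graph) θ ∧
      (16 * (numTriangles I.graph : ℝ) < θ ^ 3 → x < θ ^ 3) ∧
      (θ ^ 3 ≤ 16 * (numTriangles I.graph : ℝ) →
        x ∈ Set.Icc ((1 - a) * (numTriangles I.graph : ℝ)) ((1 + a) * numTriangles I.graph)))) ≤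
      2 * (1 / 2) ^ k := by
  set t : ℝ := (numTriangles I.graph : ℝ) with htdef
  set m : ℝ := (numEdges I.graph : ℝ) with hmdef
  have hm0 : 0 ≤ m := Nat.cast_nonneg _
  rw [two_mul]
  have hbud {x : ℝ} (hx : x ≤ 128 * m + 1) : ⌈32 * reps a * guessCost n a θ (rootBound x)⌉₊ ≤
      ⌈32 * reps a * guessCost n a θ √(512 * m + 5)⌉₊ := by
    refine Nat.ceil_mono ?_
    have h1 : rootBound x ≤ √(512 * m + 5) := by
      refine Real.sqrt_le_sqrt ?_
      have : max x 0 ≤ 128 * m + 1 := max_le hx (by positivity)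
      linarith
    have h0 := one_le_rootBound x
    unfold guessCost
    gcongr
  rcases lt_or_ge (16 * t) (θ ^ 3) with h | h
  · refine prob_bind_not_le I _ _ (fun x c => x ∈ Set.Iic (128 * m + 1) ∧
      c ≤ k * ⌈32768 * (n / θ)⌉₊) _ (by positivity)
      (prob_medianRuns I (prob_trunc_lt_cost I _ _ _).le Set.ordConnected_Iic
        (prob_edgeRun_large I θ)) fun x c hx => ?_
    refine (prob_mono I _ fun y c' hy => ?_).trans
      (prob_medianRuns I (prob_trunc_lt_cost I _ _ _).le Set.ordConnected_Iio
        (prob_guessRun_large I (M := rootBound x) ha hθ h))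
    contrapose! hy
    exact ⟨Nat.add_le_add hx.2 (hy.2.trans (Nat.mul_le_mul_left k (hbud hx.1))), fun _ => hy.1,
      fun h' => absurd h (not_lt.2 h')⟩
  · have ht0 : 0 < t := by
      have : 0 < θ ^ 3 := by positivity
      linarith
    have ht : 0 < numTriangles I.graph := Nat.cast_pos.1 ht0
    have hm : 0 < numEdges I.graph := by
      rw [Nat.pos_iff_ne_zero]
      intro hzero
      have := I.two_mul_numTriangles_le
      rw [hzero, Nat.cast_zero, zero_mul] at this
      linarith
    refine prob_bind_not_le I _ _ (fun x c => x ∈ Set.Icc (m / 2) (128 * m + 1) ∧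
      c ≤ k * ⌈32768 * (n / θ)⌉₊) _ (by positivity)
      (prob_medianRuns I (prob_trunc_lt_cost I _ _ _).le Set.ordConnected_Icc
        (prob_edgeRun_window I hθ hn hm h)) fun x c hx => ?_
    have hM2 : 2 * m ≤ rootBound x ^ 2 := by
      rw [rootBound, Real.sq_sqrt (by positivity)]
      have := le_max_left x 0
      linarith [hx.1.1]
    refine (prob_mono I _ fun y c' hy => ?_).trans
      (prob_medianRuns I (prob_trunc_lt_cost I _ _ _).le Set.ordConnected_Icc
        (prob_guessRun_window I ha ha1 hθ (one_le_rootBound x) hM2 ht hlo h))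
    contrapose! hy
    exact ⟨Nat.add_le_add hx.2 (hy.2.trans (Nat.mul_le_mul_left k (hbud hx.1.2))),
      fun h' => absurd h (not_le.2 h'), fun _ => hy.1⟩

/-! ### The search -/

/-- Search for the number of triangles, starting with the guess `θ ^ 3`. -/
noncomputable def search (n : ℕ) (a : ℝ) (k : ℕ) : ℕ → ℝ → Alg n ℝ
  | 0, _ => pure 0
  | f + 1, θ => (searchRound n a k θ).bind fun x =>
      if θ ^ 3 ≤ x then pure x else search n a k f (θ / 2)

/-- The invariant is `t ≤ 16 θ³`. When a round does not fail, acceptance implies `θ³ ≤ 16 t`, so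
that the accepted value is accurate, and rejection preserves the invariant for `θ / 2`. -/
theorem prob_search (I : GraphInput n) {a : ℝ} (k : ℕ) (ha : 0 < a) (ha1 : a ≤ 1 / 2) (hn : 0 < n)
    {Γ : ℕ} (hΓ : 0 < numTriangles I.graph → ∀ θ : ℝ, 0 < θ →
      (numTriangles I.graph : ℝ) ≤ 16 * θ ^ 3 → roundCost n a k (numEdges I.graph) θ ≤ Γ)
    (f : ℕ) (θ : ℝ) (hθ : 0 < θ) (hlo : (numTriangles I.graph : ℝ) ≤ 16 * θ ^ 3)
    (hf : 0 < numTriangles I.graph → θ ≤ 2 ^ f / 4) :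
    ((search n a k f θ).prob I fun x c => ¬ (
      x ∈ Set.Icc ((1 - a) * (numTriangles I.graph : ℝ)) ((1 + a) * numTriangles I.graph) ∧
      (0 < numTriangles I.graph → c ≤ f * Γ))) ≤ f * (2 * (1 / 2) ^ k) := by
  induction f generalizing θ with
  | zero =>
    rcases Nat.eq_zero_or_pos (numTriangles I.graph) with ht | ht
    · simp [search, prob, ex, ht]
    -- When the rounds are used up, `θ ≤ 1/4`, so the invariant gives `t ≤ 1/4`. Hence stopping with
    -- `0` happens only for triangle-free graphs.
    · exfalso
      have h1 := hf ht
      have h2 : θ ^ 3 ≤ (1 / 4) ^ 3 := by gcongr; simpa using h1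
      have h3 : (1 : ℝ) ≤ numTriangles I.graph := by exact_mod_cast ht
      norm_num at h2
      linarith
  | succ f ih =>
    have hround := prob_searchRound I k ha ha1 hθ hn hlo
    have e : ((f + 1 : ℕ) : ℝ) * (2 * (1 / 2) ^ k) = 2 * (1 / 2) ^ k + f * (2 * (1 / 2) ^ k) := by
      push_cast; ring
    rw [search, e]
    refine prob_bind_not_le I _ _ _ _ (by positivity) hround fun x c hx => ?_
    have ht0 : (0 : ℝ) ≤ numTriangles I.graph := Nat.cast_nonneg _
    have hwin : θ ^ 3 ≤ x → θ ^ 3 ≤ 16 * (numTriangles I.graph : ℝ) := by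
      intro hacc
      by_contra hcon
      exact absurd (hx.2.1 (not_le.1 hcon)) (not_lt.2 hacc)
    split_ifs with hacc
    · refine le_trans (le_of_eq ?_) (by positivity : (0 : ℝ) ≤ f * (2 * (1 / 2) ^ k))
      have hc : 0 < numTriangles I.graph → c + 0 ≤ (f + 1) * Γ := fun ht => by
        have := hx.1.trans (hΓ ht θ hθ hlo)
        nlinarith
      rw [prob, ex, if_neg (not_not.2 ⟨hx.2.2 (hwin hacc), hc⟩)]
    -- Otherwise `2 θ³ < t`; the guess is then in the accurate range, and the estimate is at least
    -- `(1 - a) t ≥ t / 2 > θ³`, contrary to the rejection.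
    · have hlo' : (numTriangles I.graph : ℝ) ≤ 16 * (θ / 2) ^ 3 := by
        by_contra hcon
        have h1 : 16 * (θ / 2) ^ 3 = 2 * θ ^ 3 := by ring
        rw [h1, not_le] at hcon
        have h2 := (hx.2.2 (by linarith)).1
        refine hacc ?_
        nlinarith
      refine (prob_mono I _ fun y c' hy => ?_).trans (ih (θ / 2) (half_pos hθ) hlo' fun ht => ?_)
      · contrapose! hy
        refine ⟨hy.1, fun ht => ?_⟩
        have h1 := hx.1.trans (hΓ ht θ hθ hlo)
        have h2 := hy.2 ht
        linarith
      · have := hf ht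
        rw [pow_succ] at this
        linarith

/-! ### The estimator -/

/-- The number of rounds of the search. -/
noncomputable def rounds (n : ℕ) : ℕ := Nat.log 2 n + 3

theorem rounds_le {n : ℕ} (hn : 0 < n) : (rounds n : ℝ) ≤ 3 + 2 * Real.log n := by
  have h1 : (2 : ℝ) ^ Nat.log 2 n ≤ n := by exact_mod_cast Nat.pow_log_le_self 2 hn.ne'
  have h2 := Real.log_le_log (by positivity) h1
  rw [Real.log_pow] at h2
  have h3 := Real.log_two_gt_d9
  rw [rounds]; push_cast
  have h4 : (0 : ℝ) ≤ Nat.log 2 n := Nat.cast_nonneg _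
  nlinarith

theorem le_rounds {n : ℕ} : (n : ℝ) ≤ 2 ^ rounds n / 4 := by
  have h := Nat.lt_pow_succ_log_self (b := 2) (by norm_num) n
  have h2 : (n : ℝ) ≤ 2 ^ (Nat.log 2 n + 1) := by exact_mod_cast h.le
  refine h2.trans (le_of_eq ?_)
  rw [rounds]; ring

/-- The leading factor of the number of queries. -/
noncomputable def baseCost (n : ℕ) (t m : ℝ) : ℝ := n / t ^ (1 / 3 : ℝ) + m ^ (3 / 2 : ℝ) / t

/-- Lets the roundings and additive constants be absorbed into `baseCost`. -/
theorem one_le_baseCost {t m : ℝ} (ht : 0 < t) (hm : 0 ≤ m) (h : t ≤ (n : ℝ) ^ 3) :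
    1 ≤ baseCost n t m := by
  have h1 : t ^ (1 / 3 : ℝ) ≤ n := by
    calc t ^ (1 / 3 : ℝ) ≤ ((n : ℝ) ^ 3) ^ (1 / 3 : ℝ) := by gcongr
      _ = n := by
        rw [← Real.rpow_natCast, ← Real.rpow_mul (by positivity)]; norm_num
  have h2 : 0 ≤ m ^ (3 / 2 : ℝ) / t := by positivity
  have h3 : 1 ≤ n / t ^ (1 / 3 : ℝ) := by
    rw [one_le_div (by positivity)]; exact h1
  unfold baseCost
  linarith

theorem div_guess_le {t m θ : ℝ} (ht : 0 < t) (hm : 0 ≤ m) (hθ : 0 < θ) (h : t ≤ 16 * θ ^ 3) :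
    n / θ ≤ 3 * baseCost n t m := by
  have h1 : t ^ (1 / 3 : ℝ) ≤ 3 * θ := by
    calc t ^ (1 / 3 : ℝ) ≤ ((3 * θ) ^ 3) ^ (1 / 3 : ℝ) := by
          gcongr
          have : 0 < θ ^ 3 := by positivity
          rw [mul_pow]; linarith
      _ = 3 * θ := by
        rw [← Real.rpow_natCast, ← Real.rpow_mul (by positivity)]; norm_num
  have h2 : 0 ≤ m ^ (3 / 2 : ℝ) / t := by positivity
  have h3 : n / θ ≤ 3 * (n / t ^ (1 / 3 : ℝ)) := by
    rw [← mul_div_assoc, div_le_div_iff₀ hθ (by positivity)]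
    calc (n : ℝ) * t ^ (1 / 3 : ℝ) ≤ n * (3 * θ) := by gcongr
      _ = _ := by ring
  unfold baseCost
  linarith

theorem cube_div_guess_le {t m θ : ℝ} (ht : 0 < t) (hm : 1 ≤ m) (h : t ≤ 16 * θ ^ 3) :
    √(512 * m + 5) ^ 3 / θ ^ 3 ≤ 194672 * baseCost n t m := by
  have hθ3 : 0 < θ ^ 3 := by linarith
  have hm0 : 0 < m := by linarith
  have h1 : √(512 * m + 5) ≤ 23 * √m := by
    rw [Real.sqrt_le_iff]
    refine ⟨by positivity, ?_⟩
    rw [mul_pow, Real.sq_sqrt hm0.le]; linarith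
  have h2 : √m ^ 3 = m ^ (3 / 2 : ℝ) := by
    rw [Real.sqrt_eq_rpow, ← Real.rpow_natCast, ← Real.rpow_mul hm0.le]; norm_num
  have h3 : √(512 * m + 5) ^ 3 ≤ 12167 * m ^ (3 / 2 : ℝ) := by
    calc _ ≤ (23 * √m) ^ 3 := by gcongr
      _ = _ := by rw [mul_pow, h2]; norm_num
  have h4 : 0 ≤ n / t ^ (1 / 3 : ℝ) := by positivity
  have h5 : √(512 * m + 5) ^ 3 / θ ^ 3 ≤ 194672 * (m ^ (3 / 2 : ℝ) / t) := by
    rw [← mul_div_assoc, div_le_div_iff₀ hθ3 ht]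
    have h6 : 0 ≤ m ^ (3 / 2 : ℝ) := by positivity
    calc _ ≤ 12167 * m ^ (3 / 2 : ℝ) * (16 * θ ^ 3) := by gcongr
      _ = _ := by ring
  unfold baseCost
  linarith

/-- Of the power `1 / a ^ 4`, three factors come from the repetitions and one from the lightness
tests. Under the search invariant the bound no longer depends on `θ`. -/
theorem roundCost_le {a t m θ : ℝ} (k : ℕ) (ha : 0 < a) (ha1 : a ≤ 1 / 2) (ht : 0 < t)
    (hm : 1 ≤ m) (hθ : 0 < θ) (hn : t ≤ (n : ℝ) ^ 3) (h : t ≤ 16 * θ ^ 3) :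
    (roundCost n a k m θ : ℝ) ≤ 10 ^ 19 * k * baseCost n t m / a ^ 4 := by
  have h1 := one_le_baseCost ht (by linarith) hn (m := m)
  have h2 := div_guess_le (n := n) ht (by linarith : 0 ≤ m) hθ h
  have h3 := cube_div_guess_le (n := n) ht hm h
  set Q := baseCost n t m
  have hinv : 2 ≤ 1 / a := by rw [le_div_iff₀ ha]; linarith
  have hgc : guessCost n a θ √(512 * m + 5) ≤ 3 * 10 ^ 10 * (Q * (1 / a)) := by
    have e : guessCost n a θ √(512 * m + 5) =
        n / θ + 200 + 128000 * (1 / a) * (√(512 * m + 5) ^ 3 / θ ^ 3) := by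
      unfold guessCost; field_simp
    rw [e]
    have e1 : 128000 * (1 / a) * (√(512 * m + 5) ^ 3 / θ ^ 3) ≤
        128000 * (1 / a) * (194672 * Q) := by gcongr
    have e2 : Q * 2 ≤ Q * (1 / a) := by gcongr
    nlinarith
  have hgc0 : 0 ≤ guessCost n a θ √(512 * m + 5) := by unfold guessCost; positivity
  have hcube : 1 ≤ (1 / a) ^ 3 := one_le_pow₀ (by linarith)
  have hR : (reps a : ℝ) ≤ 4915201 * (1 / a) ^ 3 := by
    have h4 : (reps a : ℝ) ≤ 4915200 / a ^ 3 + 1 := (Nat.ceil_lt_add_one (by positivity)).le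
    have e : 4915200 / a ^ 3 = 4915200 * (1 / a) ^ 3 := by rw [one_div_pow]; ring
    rw [e] at h4
    linarith
  have hb1 : (⌈32768 * (n / θ)⌉₊ : ℝ) ≤ 32768 * (n / θ) + 1 :=
    (Nat.ceil_lt_add_one (by positivity)).le
  have hb2 : (⌈32 * reps a * guessCost n a θ √(512 * m + 5)⌉₊ : ℝ) ≤
      32 * reps a * guessCost n a θ √(512 * m + 5) + 1 :=
    (Nat.ceil_lt_add_one (by positivity)).le
  have hb3 : 32 * reps a * guessCost n a θ √(512 * m + 5) ≤
      32 * (4915201 * (1 / a) ^ 3) * (3 * 10 ^ 10 * (Q * (1 / a))) := by gcongr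
  have hb4 : 32 * (4915201 * (1 / a) ^ 3) * (3 * 10 ^ 10 * (Q * (1 / a))) =
      4718592960000000000 * (Q * (1 / a) ^ 4) := by ring
  have hQa : Q ≤ Q * (1 / a) ^ 4 :=
    le_mul_of_one_le_right (by linarith) (one_le_pow₀ (by linarith))
  have e : 10 ^ 19 * k * Q / a ^ 4 = k * (10 ^ 19 * (Q * (1 / a) ^ 4)) := by
    rw [one_div_pow]; ring
  rw [e, roundCost]
  push_cast
  rw [← mul_add]
  gcongr
  linarith

/-- A sublinear estimator of the number of triangles with failure probability `δ`. -/
theorem exists_estimator {n : ℕ} (hn : 0 < n) {a δ : ℝ} (ha : 0 < a) (ha1 : a ≤ 1 / 2) (hδ : 0 < δ)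
    (hδ1 : δ ≤ 1) : ∃ A : Alg n ℝ, ∀ I : GraphInput n, (A.prob I fun x c => ¬ (
      x ∈ Set.Icc ((1 - a) * (numTriangles I.graph : ℝ)) ((1 + a) * numTriangles I.graph) ∧
      (0 < numTriangles I.graph → (c : ℝ) ≤ 10 ^ 21 *
        baseCost n (numTriangles I.graph) (numEdges I.graph) *
        (1 + Real.log n + 1 / a + Real.log (1 / δ)) ^ 6))) ≤ δ := by
  set L := 1 + Real.log n + 1 / a + Real.log (1 / δ) with hL
  have hlogn : 0 ≤ Real.log n := Real.log_natCast_nonneg n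
  have hlogδ : 0 ≤ Real.log (1 / δ) := Real.log_nonneg (by rw [le_div_iff₀ hδ]; linarith)
  have hinv : 2 ≤ 1 / a := by rw [le_div_iff₀ ha]; linarith
  have hL1 : 3 ≤ L := by linarith
  have hf := rounds_le hn
  have hf0 : (0 : ℝ) < rounds n := by rw [rounds]; positivity
  -- As `log 2 ≥ 1/2`, this makes `2 ^ k ≥ 2 * rounds n / δ`, and a union bound over the rounds
  -- costs `δ`.
  set k := ⌈2 * Real.log (2 * rounds n / δ)⌉₊ with hk
  have hlog : Real.log (2 * rounds n / δ) ≤ 2 * rounds n + Real.log (1 / δ) := by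
    rw [div_eq_mul_one_div, Real.log_mul (by positivity) (by positivity)]
    have := Real.log_le_self (by positivity : (0 : ℝ) ≤ 2 * rounds n)
    linarith
  have hk1 : (k : ℝ) ≤ 17 * L := by
    have h1 : (k : ℝ) ≤ 2 * (2 * rounds n + Real.log (1 / δ)) + 1 := by
      refine (Nat.cast_le.2 (Nat.ceil_mono (mul_le_mul_of_nonneg_left hlog zero_le_two))).trans ?_
      exact (Nat.ceil_lt_add_one (by positivity)).le
    linarith
  have hfail : rounds n * (2 * (1 / 2 : ℝ) ^ k) ≤ δ := by
    have h1 : 2 * Real.log (2 * rounds n / δ) ≤ k := Nat.le_ceil _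
    have h2 := Real.log_two_gt_d9
    have h3 : (2 * rounds n / δ : ℝ) ≤ 2 ^ k := by
      rw [← Real.log_le_log_iff (by positivity) (by positivity), Real.log_pow]
      have : (0 : ℝ) ≤ k := Nat.cast_nonneg k
      nlinarith
    rw [div_le_iff₀ hδ] at h3
    have h4 : (1 / 2 : ℝ) ^ k * 2 ^ k = 1 := by rw [← mul_pow]; norm_num
    calc rounds n * (2 * (1 / 2 : ℝ) ^ k) = (2 * rounds n) * (1 / 2 : ℝ) ^ k := by ring
      _ ≤ (2 ^ k * δ) * (1 / 2 : ℝ) ^ k := by gcongr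
      _ = ((1 / 2 : ℝ) ^ k * 2 ^ k) * δ := by ring
      _ = δ := by rw [h4, one_mul]
  refine ⟨search n a k (rounds n) n, fun I => ?_⟩
  set t : ℝ := (numTriangles I.graph : ℝ) with ht
  set m : ℝ := (numEdges I.graph : ℝ) with hm
  have htn : t ≤ (n : ℝ) ^ 3 := I.numTriangles_le
  have hn0 : (0 : ℝ) < n := Nat.cast_pos.2 hn
  set Γ := ⌊10 ^ 19 * k * baseCost n t m / a ^ 4⌋₊ with hΓ
  have hmain := prob_search I k ha ha1 hn (Γ := Γ) (fun htpos θ hθ hlo => by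
      have ht0 : 0 < t := Nat.cast_pos.2 htpos
      have hm1 : 1 ≤ m := by
        rw [hm, Nat.one_le_cast]
        by_contra hcon
        have h := I.two_mul_numTriangles_le
        rw [show numEdges I.graph = 0 by omega, Nat.cast_zero, zero_mul] at h
        linarith
      exact Nat.le_floor (roundCost_le k ha ha1 ht0 hm1 hθ htn hlo))
    (rounds n) n hn0 (by
      have : (0 : ℝ) ≤ (n : ℝ) ^ 3 := by positivity
      linarith) (fun _ => le_rounds)
  refine (prob_mono I _ fun x c hx => ?_).trans (hmain.trans hfail)
  contrapose! hx
  refine ⟨hx.1, fun htpos => ?_⟩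
  have ht0 : 0 < t := Nat.cast_pos.2 htpos
  have hQ := one_le_baseCost (n := n) ht0 (Nat.cast_nonneg _ : (0 : ℝ) ≤ m) htn
  have hc : (c : ℝ) ≤ rounds n * Γ := by exact_mod_cast hx.2 htpos
  have hΓ1 : (Γ : ℝ) ≤ 10 ^ 19 * k * baseCost n t m / a ^ 4 := Nat.floor_le (by positivity)
  calc (c : ℝ) ≤ rounds n * Γ := hc
    _ ≤ (3 * L) * (10 ^ 19 * k * baseCost n t m / a ^ 4) := by gcongr; linarith
    _ = (3 * L) * (10 ^ 19 * k * baseCost n t m * (1 / a) ^ 4) := by rw [one_div_pow]; ring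
    _ ≤ (3 * L) * (10 ^ 19 * (17 * L) * baseCost n t m * L ^ 4) := by gcongr; linarith
    _ ≤ 10 ^ 21 * baseCost n t m * L ^ 6 := by
        have : 0 ≤ baseCost n t m * L ^ 6 := by positivity
        nlinarith

end Alg
end TriangleDP

namespace TriangleDP

/-! ### The truncated geometric mechanism -/

/-- The probability that the truncated geometric mechanism on `{0, …, K}` with parameter `a` moves
`i` to `j`. -/
noncomputable def geoW (a : ℝ) (K i j : ℕ) : ℝ :=
  (if j = 0 ∨ j = K then 1 else 1 - a) / (1 + a) * a ^ Nat.dist i j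

/-- The distribution function of the truncated geometric mechanism: the probability that `i` is
moved below `j`. -/
noncomputable def geoF (a : ℝ) (K i j : ℕ) : ℝ :=
  if j = 0 then 0 else if K < j then 1 else
    if j ≤ i then a ^ (i + 1 - j) / (1 + a) else 1 - a ^ (j - i) / (1 + a)

/-! ### Mass, tail and privacy ratio of the geometric weights -/

section geo

variable {a : ℝ} {K : ℕ}

theorem geoW_nonneg (ha : 0 ≤ a) (ha1 : a ≤ 1) (i j : ℕ) : 0 ≤ geoW a K i j := by
  unfold geoW
  have : 0 ≤ 1 - a := by linarith
  split_ifs <;> positivity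

/-- With an explicit distribution function, total mass and tails follow by telescoping. The
endpoints carry the larger weight because they collect the truncated tails. -/
theorem geoW_eq_sub (ha : 0 ≤ a) (hK : 0 < K) {i j : ℕ} (hi : i ≤ K) (hj : j ≤ K) :
    geoW a K i j = geoF a K i (j + 1) - geoF a K i j := by
  have h1 : 1 + a ≠ 0 := by positivity
  unfold geoW geoF
  rcases Nat.eq_zero_or_pos j with rfl | hj0
  · have hK' : ¬ K < 0 + 1 := by omega
    rcases Nat.eq_zero_or_pos i with rfl | hi0
    · simp [hK', Nat.dist]
      field_simp; ring
    · have : 0 + 1 ≤ i := hi0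
      simp [hK', this, Nat.dist_zero_right]
      ring
  rcases hj.lt_or_eq with hjK | rfl
  · have e1 : ¬ (j = 0 ∨ j = K) := by omega
    have e2 : ¬ j = 0 := by omega
    have e3 : ¬ K < j := by omega
    have e4 : ¬ K < j + 1 := by omega
    rw [if_neg e1, if_neg (Nat.succ_ne_zero j), if_neg e4, if_neg e2, if_neg e3]
    rcases lt_trichotomy j i with h | rfl | h
    · rw [if_pos (by omega : j + 1 ≤ i), if_pos h.le, Nat.dist_eq_sub_of_le_right h.le,
        show i + 1 - (j + 1) = i - j by omega, show i + 1 - j = i - j + 1 by omega, pow_succ]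
      ring
    · rw [if_neg (by omega : ¬ j + 1 ≤ j), if_pos le_rfl, Nat.dist_self,
        show j + 1 - j = 1 by omega]
      field_simp; ring
    · rw [if_neg (by omega : ¬ j + 1 ≤ i), if_neg (by omega : ¬ j ≤ i),
        Nat.dist_eq_sub_of_le h.le,
        show j + 1 - i = j - i + 1 by omega, pow_succ]
      ring
  · have e2 : ¬ j = 0 := by omega
    simp only [e2, or_true, if_true, Nat.succ_ne_zero, if_false, lt_irrefl, Nat.lt_succ_self]
    rcases hi.lt_or_eq with h | rfl
    · rw [if_neg (by omega), Nat.dist_eq_sub_of_le h.le]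
      ring
    · rw [if_pos le_rfl, Nat.dist_self, show i + 1 - i = 1 by omega]
      field_simp; ring

theorem sum_range_geoW (ha : 0 ≤ a) (hK : 0 < K) {i l : ℕ} (hi : i ≤ K) (hl : l ≤ K + 1) :
    ∑ j ∈ Finset.range l, geoW a K i j = geoF a K i l := by
  rw [Finset.sum_congr rfl fun j hj =>
    geoW_eq_sub ha hK hi (by have := Finset.mem_range.1 hj; omega : j ≤ K), Finset.sum_range_sub]
  simp [geoF]

theorem sum_geoW (ha : 0 ≤ a) (hK : 0 < K) {i : ℕ} (hi : i ≤ K) :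
    ∑ j : Fin (K + 1), geoW a K i j = 1 := by
  rw [Fin.sum_univ_eq_sum_range (geoW a K i), sum_range_geoW ha hK hi le_rfl]
  simp [geoF]

theorem geoW_tail (ha : 0 ≤ a) (hK : 0 < K) {i s : ℕ} (hi : i ≤ K) (hs : 0 < s) :
    (∑ j : Fin (K + 1), if s ≤ Nat.dist i j then geoW a K i j else 0) ≤ 2 * a ^ s / (1 + a) := by
  have hp : 0 ≤ a ^ s / (1 + a) := by positivity
  rw [Fin.sum_univ_eq_sum_range (fun j => if s ≤ Nat.dist i j then geoW a K i j else 0)]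
  have hsplit : ∀ j ∈ Finset.range (K + 1), (if s ≤ Nat.dist i j then geoW a K i j else 0) =
      (if j ∈ Finset.range (i + 1 - s) then geoW a K i j else 0) +
      (geoW a K i j - if j ∈ Finset.range (min (i + s) (K + 1)) then geoW a K i j else 0) := by
    intro j hj
    have hj' := Finset.mem_range.1 hj
    have hd : Nat.dist i j = i - j + (j - i) := rfl
    simp only [Finset.mem_range]
    by_cases h1 : j < i + 1 - s
    · rw [if_pos (by omega : s ≤ Nat.dist i j), if_pos h1,
        if_pos (by omega : j < min (i + s) (K + 1))]; ring
    · by_cases h2 : j < min (i + s) (K + 1)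
      · rw [if_neg (by omega : ¬ s ≤ Nat.dist i j), if_neg h1, if_pos h2]; ring
      · rw [if_pos (by omega : s ≤ Nat.dist i j), if_neg h1, if_neg h2]; ring
  have hsub1 : Finset.range (i + 1 - s) ⊆ Finset.range (K + 1) :=
    Finset.range_subset_range.2 (by omega)
  have hsub2 : Finset.range (min (i + s) (K + 1)) ⊆ Finset.range (K + 1) :=
    Finset.range_subset_range.2 (by omega)
  rw [Finset.sum_congr rfl hsplit, Finset.sum_add_distrib, Finset.sum_sub_distrib,
    Finset.sum_ite_mem, Finset.sum_ite_mem, Finset.inter_eq_right.2 hsub1,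
    Finset.inter_eq_right.2 hsub2, sum_range_geoW ha hK hi (by omega),
    sum_range_geoW ha hK hi le_rfl, sum_range_geoW ha hK hi (by omega)]
  have h1 : geoF a K i (i + 1 - s) ≤ a ^ s / (1 + a) := by
    unfold geoF
    split_ifs with h1 h2 h3
    · exact hp
    · omega
    · rw [show i + 1 - (i + 1 - s) = s by omega]
    · omega
  have h2 : geoF a K i (K + 1) - geoF a K i (min (i + s) (K + 1)) ≤ a ^ s / (1 + a) := by
    rcases le_or_gt (K + 1) (i + s) with h | h
    · rw [min_eq_right h, sub_self]; exact hp
    · rw [min_eq_left h.le]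
      unfold geoF
      rw [if_neg (by omega), if_pos (by omega), if_neg (by omega), if_neg (by omega),
        if_neg (by omega), show i + s - i = s by omega]
      linarith
  have : 2 * a ^ s / (1 + a) = a ^ s / (1 + a) + a ^ s / (1 + a) := by ring
  linarith

/-- The prefactor depends only on `j`, so by the triangle inequality a shift of the input by `D`
costs at most `D` factors `a`. -/
theorem geoW_ratio (ha : 0 ≤ a) (ha1 : a ≤ 1) {i i' D : ℕ} (h : Nat.dist i i' ≤ D) (j : ℕ) :
    a ^ D * geoW a K i j ≤ geoW a K i' j := by
  unfold geoW
  have h0 : 0 ≤ 1 - a := by linarith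
  have hc : 0 ≤ (if j = 0 ∨ j = K then 1 else 1 - a) / (1 + a) := by
    split_ifs <;> positivity
  have hd : Nat.dist i' j ≤ D + Nat.dist i j := by
    have := Nat.dist.triangle_inequality i' i j
    rw [Nat.dist_comm i' i] at this
    omega
  calc _ = (if j = 0 ∨ j = K then 1 else 1 - a) / (1 + a) * a ^ (D + Nat.dist i j) := by
        rw [pow_add]; ring
    _ ≤ _ := mul_le_mul_of_nonneg_left (pow_le_pow_of_le_one ha ha1 hd) hc

end geo

/-! ### Making an estimator private -/

namespace Alg

variable {n : ℕ}

/-- The weights of the geometric mechanism mixed with the uniform distribution. -/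
noncomputable def mixW (a ζ : ℝ) (K i : ℕ) (j : Fin (K + 1)) : ℝ :=
  (1 - ζ) * geoW a K i j + ζ / (K + 1)

theorem mixW_weights {a ζ : ℝ} {K i : ℕ} (ha : 0 ≤ a) (ha1 : a ≤ 1) (hζ : 0 ≤ ζ) (hζ1 : ζ ≤ 1)
    (hK : 0 < K) (hi : i ≤ K) : (∀ j, 0 ≤ mixW a ζ K i j) ∧ ∑ j, mixW a ζ K i j = 1 := by
  constructor
  · intro j
    have := geoW_nonneg (K := K) ha ha1 i j
    have h : 0 ≤ 1 - ζ := by linarith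
    unfold mixW; positivity
  · simp only [mixW, Finset.sum_add_distrib, ← Finset.mul_sum, sum_geoW ha hK hi]
    simp
    field_simp
    ring

/-- Run an estimator, discretize its result by `idx`, and apply the mixed geometric mechanism. -/
noncomputable def privatize {a ζ : ℝ} {K : ℕ} (ha : 0 ≤ a) (ha1 : a ≤ 1) (hζ : 0 ≤ ζ) (hζ1 : ζ ≤ 1)
    (hK : 0 < K) (idx : ℝ → ℕ) (hidx : ∀ x, idx x ≤ K) (out : ℕ → ℝ) (A : Alg n ℝ) : Alg n ℝ :=
  A.bind fun x => .rand (mixW a ζ K (idx x)) (mixW_weights ha ha1 hζ hζ1 hK (hidx x))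
    fun j => pure (out j)

/-! ### Accuracy and privacy of the mechanism -/

section privatize

variable {a ζ : ℝ} {K : ℕ} (ha : 0 ≤ a) (ha1 : a ≤ 1) (hζ : 0 ≤ ζ) (hζ1 : ζ ≤ 1)
    (hK : 0 < K) {idx : ℝ → ℕ} (hidx : ∀ x, idx x ≤ K) (out : ℕ → ℝ) (A : Alg n ℝ)

open Classical in
/-- The probability that the geometric mechanism moves `i` into `S`. -/
noncomputable def geoP (a : ℝ) (K : ℕ) (out : ℕ → ℝ) (S : Set ℝ) (i : ℕ) : ℝ :=
  ∑ j : Fin (K + 1), geoW a K i j * if out j ∈ S then 1 else 0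

open Classical in
/-- The probability that a uniform grid point lies in `S`. -/
noncomputable def unifP (K : ℕ) (out : ℕ → ℝ) (S : Set ℝ) : ℝ :=
  ∑ j : Fin (K + 1), 1 / ((K : ℝ) + 1) * if out j ∈ S then 1 else 0

theorem prob_privatize (I : GraphInput n) (S : Set ℝ) :
    ((privatize ha ha1 hζ hζ1 hK idx hidx out A).prob I fun x _ => x ∈ S) =
      (1 - ζ) * (A.ex I fun x _ => geoP a K out S (idx x)) + ζ * unifP K out S := by
  classical
  rw [privatize, prob, ex_bind, ← ex_const_mul, ← ex_const I A (ζ * unifP K out S), ← ex_add]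
  congr; ext x c
  simp only [ex, mixW, geoP, unifP, Finset.mul_sum, ← Finset.sum_add_distrib]
  refine Finset.sum_congr rfl fun j _ => ?_
  ring

theorem prob_privatize_cost (I : GraphInput n) (P : ℕ → Prop) :
    ((privatize ha ha1 hζ hζ1 hK idx hidx out A).prob I fun _ c => P c) = A.prob I fun _ c => P c := by
  classical
  rw [privatize, prob, ex_bind, prob]
  congr; ext x c
  simp only [ex, add_zero, ← Finset.sum_mul,
    (mixW_weights ha ha1 hζ hζ1 hK (hidx x)).2, one_mul]

theorem geoP_nonneg (ha : 0 ≤ a) (ha1 : a ≤ 1) (S : Set ℝ) (i : ℕ) : 0 ≤ geoP a K out S i :=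
  Finset.sum_nonneg fun j _ => mul_nonneg (geoW_nonneg ha ha1 i j) (by split_ifs <;> norm_num)

theorem geoP_le_one (ha : 0 ≤ a) (ha1 : a ≤ 1) (hK : 0 < K) (S : Set ℝ) {i : ℕ} (hi : i ≤ K) :
    geoP a K out S i ≤ 1 := by
  rw [← sum_geoW ha hK hi]
  refine Finset.sum_le_sum fun j _ => mul_le_of_le_one_right (geoW_nonneg ha ha1 i j) ?_
  split_ifs <;> norm_num

theorem geoP_ratio (ha : 0 ≤ a) (ha1 : a ≤ 1) (S : Set ℝ) {i i' D : ℕ} (h : Nat.dist i i' ≤ D) :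
    a ^ D * geoP a K out S i ≤ geoP a K out S i' := by
  rw [geoP, geoP, Finset.mul_sum]
  refine Finset.sum_le_sum fun j _ => ?_
  rw [← mul_assoc]
  exact mul_le_mul_of_nonneg_right (geoW_ratio ha ha1 h j) (by split_ifs <;> norm_num)

/-- Accuracy of the private estimator. -/
theorem prob_privatize_ge (I : GraphInput n) {G S : Set ℝ} {s : ℕ} {δ : ℝ} (hs : 0 < s)
    (hA : (A.prob I fun x _ => x ∉ G) ≤ δ)
    (hacc : ∀ x ∈ G, ∀ j ≤ K, Nat.dist (idx x) j < s → out j ∈ S) :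
    1 - (δ + 2 * a ^ s / (1 + a) + ζ) ≤
      (privatize ha ha1 hζ hζ1 hK idx hidx out A).prob I fun x _ => x ∈ S := by
  classical
  have htail : 0 ≤ 2 * a ^ s / (1 + a) := by positivity
  have hgood : ∀ x ∈ G, 1 - 2 * a ^ s / (1 + a) ≤ geoP a K out S (idx x) := by
    intro x hx
    have h1 := geoW_tail ha hK (hidx x) hs
    have h2 := sum_geoW ha hK (hidx x)
    have h3 : (∑ j : Fin (K + 1), geoW a K (idx x) j) -
        (∑ j : Fin (K + 1), if s ≤ Nat.dist (idx x) j then geoW a K (idx x) j else 0) ≤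
        geoP a K out S (idx x) := by
      rw [← Finset.sum_sub_distrib, geoP]
      refine Finset.sum_le_sum fun j _ => ?_
      have h0 := geoW_nonneg (K := K) ha ha1 (idx x) j
      by_cases hd : s ≤ Nat.dist (idx x) j
      · rw [if_pos hd, sub_self]
        exact mul_nonneg h0 (by split_ifs <;> norm_num)
      · rw [if_neg hd, if_pos (hacc x hx j (by omega) (by omega)), mul_one, sub_zero]
    linarith
  have hex : 1 - (δ + 2 * a ^ s / (1 + a)) ≤ A.ex I fun x _ => geoP a K out S (idx x) := by
    have h1 : (A.ex I fun x _ => (1 - 2 * a ^ s / (1 + a)) - if x ∉ G then (1 : ℝ) else 0) ≤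
        A.ex I fun x _ => geoP a K out S (idx x) := by
      refine ex_mono I A fun x _ => ?_
      split_ifs with hx
      · have := hgood x hx
        linarith
      · have := geoP_nonneg (K := K) out ha ha1 S (idx x)
        linarith
    rw [ex_sub, ex_const] at h1
    have h2 : (A.ex I fun x _ => if x ∉ G then (1 : ℝ) else 0) ≤ δ := by
      unfold prob at hA; convert hA using 5
    linarith
  have hex1 : (A.ex I fun x _ => geoP a K out S (idx x)) ≤ 1 := by
    rw [← ex_const I A 1]
    exact ex_mono I A fun x _ => geoP_le_one out ha ha1 hK S (hidx x)
  have hu : 0 ≤ unifP K out S :=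
    Finset.sum_nonneg fun j _ => mul_nonneg (by positivity) (by split_ifs <;> norm_num)
  rw [prob_privatize]
  nlinarith [mul_nonneg hζ hu]

/-- Privacy of the private estimator. -/
theorem prob_privatize_le (I₁ I₂ : GraphInput n) (S : Set ℝ) {G₁ G₂ : Set ℝ} {D : ℕ} {δ e : ℝ}
    (h₁ : (A.prob I₁ fun x _ => x ∉ G₁) ≤ δ) (h₂ : (A.prob I₂ fun x _ => x ∉ G₂) ≤ δ)
    (hD : ∀ x ∈ G₁, ∀ y ∈ G₂, Nat.dist (idx x) (idx y) ≤ D) (he : 1 ≤ e)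
    (hδ0 : 0 ≤ δ) (hδ1 : δ < 1) (hde : 1 ≤ e * (a ^ D * (1 - δ)))
    (hmix : δ * (K + 1) ≤ (e - 1) * ζ) :
    ((privatize ha ha1 hζ hζ1 hK idx hidx out A).prob I₁ fun x _ => x ∈ S) ≤
      e * (privatize ha ha1 hζ hζ1 hK idx hidx out A).prob I₂ fun x _ => x ∈ S := by
  classical
  rw [prob_privatize, prob_privatize]
  set g : ℝ → ℝ := fun x => geoP a K out S (idx x) with hg
  have hg0 (x) : 0 ≤ g x := geoP_nonneg out ha ha1 S _
  have hg1 (x) : g x ≤ 1 := geoP_le_one out ha ha1 hK S (hidx x)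
  set P₁ := A.ex I₁ fun x _ => g x with hP₁
  set P₂ := A.ex I₂ fun x _ => g x with hP₂
  have hP₂0 : 0 ≤ P₂ := ex_nonneg I₂ A fun x _ => hg0 x
  -- If `S` misses the grid both sides vanish; otherwise the uniform part gives `S` at least the
  -- mass of one grid point, which pays for `δ`.
  by_cases hS : ∃ j : Fin (K + 1), out j ∈ S
  swap
  · push Not at hS
    have hz : ∀ x, g x = 0 := fun x => Finset.sum_eq_zero fun j _ => by rw [if_neg (hS j), mul_zero]
    have hu : unifP K out S = 0 := Finset.sum_eq_zero fun j _ => by rw [if_neg (hS j), mul_zero]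
    have e1 : P₁ = 0 := by rw [hP₁]; simp only [hz]; exact ex_const I₁ A 0
    have e2 : P₂ = 0 := by rw [hP₂]; simp only [hz]; exact ex_const I₂ A 0
    rw [e1, e2, hu]; simp
  obtain ⟨j₀, hj₀⟩ := hS
  have hu : 1 / ((K : ℝ) + 1) ≤ unifP K out S := by
    have := Finset.single_le_sum (f := fun j : Fin (K + 1) =>
      1 / ((K : ℝ) + 1) * if out j ∈ S then 1 else 0)
      (fun j _ => mul_nonneg (by positivity) (by split_ifs <;> norm_num)) (Finset.mem_univ j₀)
    simpa [hj₀, unifP] using this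
  have hbad₁ : (A.ex I₁ fun x _ => if x ∉ G₁ then (1 : ℝ) else 0) ≤ δ := by
    unfold prob at h₁; convert h₁ using 5
  have hbad₂ : (A.ex I₂ fun x _ => if x ∉ G₂ then (1 : ℝ) else 0) ≤ δ := by
    unfold prob at h₂; convert h₂ using 5
  have haD : 0 ≤ a ^ D := by positivity
  -- Compare a fixed good result on `I₂` with the average over the results on `I₁`, then average
  -- over `I₂`. Only the two marginal laws matter, so no coupling of the runs is needed.
  have hcross : ∀ y ∈ G₂, a ^ D * (P₁ - δ) ≤ g y := by
    intro y hy
    have h : a ^ D * P₁ ≤ a ^ D * δ + g y := by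
      calc a ^ D * P₁ = A.ex I₁ fun x _ => a ^ D * g x := by rw [ex_const_mul]
        _ ≤ A.ex I₁ fun x _ => a ^ D * (if x ∉ G₁ then (1 : ℝ) else 0) + g y := by
            refine ex_mono I₁ A fun x _ => ?_
            by_cases hx : x ∈ G₁
            · simpa [hx] using geoP_ratio out ha ha1 S (hD x hx y hy)
            · simp only [hx, not_false_eq_true, if_true]
              have := mul_le_mul_of_nonneg_left (hg1 x) haD
              linarith [hg0 y]
        _ ≤ a ^ D * δ + g y := by
            rw [ex_add, ex_const_mul, ex_const]
            gcongr
    linarith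
  have hmain : a ^ D * (1 - δ) * (P₁ - δ) ≤ P₂ := by
    rcases le_total P₁ δ with h | h
    · have : a ^ D * (1 - δ) * (P₁ - δ) ≤ 0 :=
        mul_nonpos_of_nonneg_of_nonpos (mul_nonneg haD (by linarith)) (by linarith)
      linarith
    · have hc0 : 0 ≤ a ^ D * (P₁ - δ) := mul_nonneg haD (by linarith)
      calc a ^ D * (1 - δ) * (P₁ - δ) = a ^ D * (P₁ - δ) * (1 - δ) := by ring
        _ ≤ a ^ D * (P₁ - δ) * (1 - A.ex I₂ fun x _ => if x ∉ G₂ then (1 : ℝ) else 0) := by gcongr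
        _ = A.ex I₂ fun x _ => a ^ D * (P₁ - δ) * (1 - if x ∉ G₂ then (1 : ℝ) else 0) := by
            rw [ex_const_mul, ex_sub, ex_const]
        _ ≤ P₂ := by
            refine ex_mono I₂ A fun y _ => ?_
            by_cases hy : y ∈ G₂
            · simpa [hy] using hcross y hy
            · simpa [hy] using hg0 y
  have h3 : P₁ - δ ≤ e * P₂ := by
    rcases le_total P₁ δ with h | h
    · have := mul_nonneg (by linarith : 0 ≤ e) hP₂0
      linarith
    · calc P₁ - δ ≤ e * (a ^ D * (1 - δ)) * (P₁ - δ) := le_mul_of_one_le_left (by linarith) hde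
        _ = e * (a ^ D * (1 - δ) * (P₁ - δ)) := by ring
        _ ≤ e * P₂ := by gcongr
  have h4 : δ ≤ (e - 1) * ζ * unifP K out S := by
    calc δ = δ * (K + 1) * (1 / ((K : ℝ) + 1)) := by field_simp
      _ ≤ (e - 1) * ζ * unifP K out S := by
        have : 0 ≤ (e - 1) * ζ := mul_nonneg (by linarith) hζ
        gcongr
  have h5 : (1 - ζ) * (P₁ - δ) ≤ (1 - ζ) * (e * P₂) :=
    mul_le_mul_of_nonneg_left h3 (by linarith)
  nlinarith [mul_nonneg hζ hδ0]

end privatize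

end Alg
end TriangleDP

namespace TriangleDP

/-! ### The logarithmic grid -/

/-- The grid point below `x` of the logarithmic grid with offset `N` and step `g`. -/
noncomputable def gridIdx (N g : ℝ) (K : ℕ) (x : ℝ) : ℕ := min ⌊Real.log (1 + x / N) / g⌋₊ K

/-- The value of the `j`-th point of the logarithmic grid with offset `N` and step `g`. -/
noncomputable def gridOut (N g : ℝ) (j : ℕ) : ℝ := N * (Real.exp (g * j) - 1)

section grid

variable {N g : ℝ} {K : ℕ}

theorem gridIdx_le (x : ℝ) : gridIdx N g K x ≤ K := min_le_right _ _

theorem gridIdx_le_add (hN : 0 < N) (hg : 0 < g) {x y w : ℝ} (hx : 0 ≤ x) (hy : 0 ≤ y)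
    (h : 1 + x / N ≤ Real.exp w * (1 + y / N)) : gridIdx N g K x ≤ gridIdx N g K y + ⌈w / g⌉₊ := by
  have hx1 : 0 < 1 + x / N := by positivity
  have hy1 : 1 ≤ 1 + y / N := by linarith [div_nonneg hy hN.le]
  have h1 : Real.log (1 + x / N) ≤ w + Real.log (1 + y / N) := by
    have := Real.log_le_log hx1 h
    rwa [Real.log_mul (Real.exp_pos w).ne' (by positivity), Real.log_exp] at this
  have h2 : Real.log (1 + x / N) / g ≤ Real.log (1 + y / N) / g + ⌈w / g⌉₊ := by
    have h3 := Nat.le_ceil (w / g)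
    have h4 : Real.log (1 + x / N) / g ≤ (w + Real.log (1 + y / N)) / g := by gcongr
    rw [add_div] at h4
    linarith
  have h5 := Nat.floor_le_floor h2
  rw [Nat.floor_add_natCast (div_nonneg (Real.log_nonneg hy1) hg.le)] at h5
  unfold gridIdx
  omega

/-- Multiplicative approximations of numbers at distance at most `ν * N` lie close to each other on
the grid. -/
theorem one_add_div_le_exp_mul (hN : 0 < N) {a ν t t' x y : ℝ} (ha : 0 ≤ a) (ha1 : a ≤ 1 / 2)
    (ht' : 0 ≤ t') (h : t ≤ t' + ν * N) (hν : 0 ≤ ν)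
    (hx : x ≤ (1 + a) * t) (hy : (1 - a) * t' ≤ y) :
    1 + x / N ≤ Real.exp (ν + 3 * a) * (1 + y / N) := by
  have e1 : 1 + ν ≤ Real.exp ν := by linarith [Real.add_one_le_exp ν]
  have e2 : 1 + a ≤ Real.exp a := by linarith [Real.add_one_le_exp a]
  have e3 : 1 ≤ Real.exp (2 * a) * (1 - a) := by
    have := Real.add_one_le_exp (2 * a)
    nlinarith
  have hup : N + x ≤ (1 + a) * ((1 + ν) * (N + t')) := by
    have : (1 + a) * t ≤ (1 + a) * (t' + ν * N) := by gcongr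
    nlinarith [mul_nonneg hν ht', mul_nonneg ha (mul_nonneg hν ht'), mul_nonneg ha hN.le]
  have hlow : (1 - a) * (N + t') ≤ N + y := by nlinarith [mul_nonneg ha hN.le]
  have hNt : 0 ≤ N + t' := by positivity
  have key : N + x ≤ Real.exp (ν + 3 * a) * (N + y) := by
    calc N + x ≤ (1 + a) * ((1 + ν) * (N + t')) := hup
      _ ≤ Real.exp a * (Real.exp ν * (N + t')) := by gcongr
      _ ≤ Real.exp a * (Real.exp ν * (N + t')) * (Real.exp (2 * a) * (1 - a)) :=
          le_mul_of_one_le_right (by positivity) e3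
      _ = Real.exp (ν + 3 * a) * ((1 - a) * (N + t')) := by
          rw [show ν + 3 * a = a + ν + 2 * a by ring, Real.exp_add, Real.exp_add]; ring
      _ ≤ Real.exp (ν + 3 * a) * (N + y) := by gcongr
  calc 1 + x / N = (N + x) / N := by field_simp
    _ ≤ (Real.exp (ν + 3 * a) * (N + y)) / N := by gcongr
    _ = Real.exp (ν + 3 * a) * (1 + y / N) := by field_simp

/-- The offset `N` makes an additive change of at most `ν N` a multiplicative change of `N + t` by
at most `1 + ν`; the two relative errors `a` contribute at most `3a` to the logarithm. -/
theorem dist_gridIdx_le (hN : 0 < N) (hg : 0 < g) {a ν t t' x y : ℝ} (ha : 0 ≤ a)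
    (ha1 : a ≤ 1 / 2) (ht : 0 ≤ t) (ht' : 0 ≤ t') (h : t ≤ t' + ν * N) (h' : t' ≤ t + ν * N)
    (hν : 0 ≤ ν) (hx : x ∈ Set.Icc ((1 - a) * t) ((1 + a) * t))
    (hy : y ∈ Set.Icc ((1 - a) * t') ((1 + a) * t')) :
    Nat.dist (gridIdx N g K x) (gridIdx N g K y) ≤ ⌈(ν + 3 * a) / g⌉₊ := by
  have hx0 : 0 ≤ x := (mul_nonneg (by linarith) ht).trans hx.1
  have hy0 : 0 ≤ y := (mul_nonneg (by linarith) ht').trans hy.1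
  have h1 := gridIdx_le_add (K := K) hN hg hx0 hy0
    (one_add_div_le_exp_mul hN ha ha1 ht' h hν hx.2 hy.1)
  have h2 := gridIdx_le_add (K := K) hN hg hy0 hx0
    (one_add_div_le_exp_mul hN ha ha1 ht h' hν hy.2 hx.1)
  unfold Nat.dist
  omega

/-- A grid point that is less than `s` steps away from that of `x` is close to `x`. -/
theorem gridOut_bounds (hN : 0 < N) (hg : 0 < g) {x : ℝ} (hx : 0 ≤ x) (hxK : x ≤ K * g * N)
    {j s : ℕ} (h : Nat.dist (gridIdx N g K x) j < s) :
    (N + x) * Real.exp (-(g * s)) - N ≤ gridOut N g j ∧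
      gridOut N g j ≤ (N + x) * Real.exp (g * s) - N := by
  have hx1 : 1 ≤ 1 + x / N := by linarith [div_nonneg hx hN.le]
  have hL0 : 0 ≤ Real.log (1 + x / N) / g := div_nonneg (Real.log_nonneg hx1) hg.le
  have hLK : Real.log (1 + x / N) / g ≤ K := by
    rw [div_le_iff₀ hg]
    have h1 := Real.log_le_sub_one_of_pos (by linarith : 0 < 1 + x / N)
    have h2 : x / N ≤ K * g := by rwa [div_le_iff₀ hN]
    linarith
  have hfK : ⌊Real.log (1 + x / N) / g⌋₊ ≤ K := Nat.floor_le_of_le hLK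
  rw [gridIdx, min_eq_left hfK] at h
  set i := ⌊Real.log (1 + x / N) / g⌋₊ with hi
  have hi1 : (i : ℝ) ≤ Real.log (1 + x / N) / g := Nat.floor_le hL0
  have hi2 : Real.log (1 + x / N) / g < i + 1 := Nat.lt_floor_add_one _
  rw [le_div_iff₀ hg] at hi1
  rw [div_lt_iff₀ hg] at hi2
  have hj1 : j ≤ i + s := by unfold Nat.dist at h; omega
  have hj2 : i + 1 ≤ j + s := by unfold Nat.dist at h; omega
  have hj1' : (j : ℝ) ≤ i + s := by exact_mod_cast hj1
  have hj2' : (i : ℝ) + 1 ≤ j + s := by exact_mod_cast hj2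
  have hexp : N + x = N * Real.exp (Real.log (1 + x / N)) := by
    rw [Real.exp_log (by linarith)]; field_simp
  rw [hexp, mul_assoc, mul_assoc, ← Real.exp_add, ← Real.exp_add, gridOut, mul_sub, mul_one]
  constructor
  · have : Real.log (1 + x / N) + -(g * s) ≤ g * j := by nlinarith
    gcongr
  · have : g * j ≤ Real.log (1 + x / N) + g * s := by nlinarith
    gcongr

end grid
end TriangleDP

namespace TriangleDP

/-! ### The choice of the parameters -/

/-- The surplus of `3/2 c l` over `c l` is at least `c/2`, of which `c/40` pays for the factor `2 /
(1 + exp (-q))`. The remaining `exp (-(19/40 c)) < 1` leaves room for the other two failure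
probabilities. -/
theorem geometric_tail_le {c l q : ℝ} {s : ℕ} (hc : 0 < c) (hl : 1 ≤ l) (hq0 : 0 ≤ q)
    (hq : q ≤ c / 40) (hs : 3 / 2 * c * l ≤ q * s) :
    2 * Real.exp (-q) ^ s / (1 + Real.exp (-q)) ≤ Real.exp (-(c * l)) * Real.exp (-(19 / 40 * c)) := by
  have ha := Real.exp_pos (-q)
  have ha1 : Real.exp (-q) ≤ 1 := Real.exp_le_one_iff.2 (by linarith)
  have h1 : 1 - q ≤ Real.exp (-q) := Real.one_sub_le_exp_neg q
  have h2 : 2 / (1 + Real.exp (-q)) ≤ Real.exp (c / 40) := by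
    have : 2 / (1 + Real.exp (-q)) ≤ 2 - Real.exp (-q) := by
      rw [div_le_iff₀ (by positivity)]; nlinarith
    linarith [Real.add_one_le_exp (c / 40)]
  have h3 : Real.exp (-q) ^ s ≤ Real.exp (-(3 / 2 * c * l)) := by
    rw [← Real.exp_nat_mul, Real.exp_le_exp]; linarith
  calc 2 * Real.exp (-q) ^ s / (1 + Real.exp (-q))
      = 2 / (1 + Real.exp (-q)) * Real.exp (-q) ^ s := by ring
    _ ≤ Real.exp (c / 40) * Real.exp (-(3 / 2 * c * l)) := by gcongr
    _ ≤ Real.exp (-(c * l)) * Real.exp (-(19 / 40 * c)) := by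
      rw [← Real.exp_add, ← Real.exp_add, Real.exp_le_exp]
      nlinarith

theorem log_one_div_one_sub_exp_neg_le {x : ℝ} (hx : 0 < x) :
    Real.log (1 / (1 - Real.exp (-x))) ≤ 1 / x := by
  have h1 : Real.exp (-x) < 1 := Real.exp_lt_one_iff.2 (by linarith)
  have h2 : 0 < 1 - Real.exp (-x) := by linarith
  have h3 := Real.add_one_le_exp x
  have h4 : Real.exp x * Real.exp (-x) = 1 := by rw [← Real.exp_add]; simp
  have h5 : 1 / (1 - Real.exp (-x)) ≤ 1 + 1 / x := by
    rw [div_le_iff₀ h2]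
    have h6 : Real.exp (-x) * (x + 1) ≤ 1 := by nlinarith [Real.exp_pos (-x)]
    have h7 : (1 + 1 / x) * (1 - Real.exp (-x)) - 1 = (1 - Real.exp (-x) * (x + 1)) / x := by
      field_simp; ring
    have h8 : 0 ≤ (1 - Real.exp (-x) * (x + 1)) / x := div_nonneg (by linarith) hx.le
    linarith
  linarith [Real.log_le_sub_one_of_pos (one_div_pos.2 h2)]

theorem exp_le_one_add_div {α θ : ℝ} (hα : 0 < α) (hα1 : α < 1) (hθ : θ ≤ 7 * α / 128) :
    Real.exp θ ≤ 1 + α / 16 := by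
  have h1 := Real.one_sub_le_exp_neg θ
  have h4 : Real.exp θ * Real.exp (-θ) = 1 := by rw [← Real.exp_add]; simp
  have h5 : 0 < Real.exp (-θ) := Real.exp_pos _
  have h6 : 1 ≤ (1 + α / 16) * Real.exp (-θ) := by
    have : (1 + α / 16) * (1 - 7 * α / 128) ≤ (1 + α / 16) * Real.exp (-θ) := by
      gcongr; linarith
    nlinarith
  have h7 : Real.exp θ * Real.exp (-θ) ≤ (1 + α / 16) * Real.exp (-θ) := by rw [h4]; exact h6
  exact le_of_mul_le_mul_right h7 h5

/-- The parameters of the grid and of the geometric mechanism. -/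
theorem exists_grid {n : ℕ} {c ε α l : ℝ} (hn1 : (1 : ℝ) < n) (hl : 1 ≤ l) (hln : l ≤ n) (hc : 0 < c)
    (hε : 0 < ε) (hα : 0 < α) (hα1 : α < 1) (hsmall : α * ε < c * l) :
    ∃ (ν N g q : ℝ) (D s K : ℕ), ν = α * ε / (32 * c * l) ∧ 0 < ν ∧ ν ≤ 1 / 32 ∧ N = n / ν ∧
      0 < N ∧ 0 < g ∧ D = ⌈(ν + 3 * (ν / 40)) / g⌉₊ ∧ 0 < q ∧ D * q = 39 / 40 * ε ∧ q ≤ c / 40 ∧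
      0 < s ∧ 3 / 2 * c * l ≤ q * s ∧ g * s ≤ 7 * α / 128 ∧ 0 < K ∧ 2 * (n : ℝ) ^ 3 ≤ K * g * N ∧
      (K : ℝ) + 1 ≤ 83 * ((n : ℝ) ^ 3 / α) := by
  have hl0 : 0 < l := by linarith
  have hnR : (0 : ℝ) < n := by linarith
  -- With `N = n/ν` this choice makes `N α/16` equal to the permitted additive error `2c/ε * n * l`.
  obtain ⟨ν, hν⟩ : ∃ ν, ν = α * ε / (32 * c * l) := ⟨_, rfl⟩
  have hν0 : 0 < ν := by rw [hν]; positivity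
  have hν1 : ν ≤ 1 / 32 := by
    rw [hν, div_le_iff₀ (by positivity)]; linarith
  have hνmul : 32 * c * l * ν = α * ε := by rw [hν]; field_simp
  obtain ⟨N, hN⟩ : ∃ N, N = n / ν := ⟨_, rfl⟩
  have hN0 : 0 < N := by rw [hN]; positivity
  have hνN : ν * N = n := by rw [hN]; field_simp
  -- The step is so fine that rounding `D` up costs at most `ν/40` and that `q ≤ c/40`.
  obtain ⟨g, hg⟩ : ∃ g, g = ν * α / (40 * l) := ⟨_, rfl⟩
  have hg0 : 0 < g := by rw [hg]; positivity
  have hgmul : 40 * l * g = ν * α := by rw [hg]; field_simp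
  have hgν : g ≤ ν / 40 := by
    have h1 : 40 * g ≤ 40 * l * g := by
      rw [mul_assoc]; exact mul_le_mul_of_nonneg_left (le_mul_of_one_le_left hg0.le hl) (by norm_num)
    have h2 : ν * α ≤ ν := mul_le_of_le_one_right hν0.le hα1.le
    linarith only [h1, h2, hgmul]
  have hgα : g ≤ α / 1280 := by
    have h1 : 40 * g ≤ 40 * l * g := by
      rw [mul_assoc]; exact mul_le_mul_of_nonneg_left (le_mul_of_one_le_left hg0.le hl) (by norm_num)
    have h2 : ν * α ≤ 1 / 32 * α := mul_le_mul_of_nonneg_right hν1 hα.le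
    linarith only [h1, h2, hgmul]
  obtain ⟨D, hD⟩ : ∃ D, D = ⌈(ν + 3 * (ν / 40)) / g⌉₊ := ⟨_, rfl⟩
  have hD1 : (ν + 3 * (ν / 40)) / g ≤ D := by rw [hD]; exact Nat.le_ceil _
  have hDg : ν ≤ D * g := by rw [div_le_iff₀ hg0] at hD1; linarith
  have hD0 : (0 : ℝ) < D := lt_of_lt_of_le (by positivity) hD1
  have hDg2 : D * g ≤ 44 / 40 * ν := by
    have : (D : ℝ) < (ν + 3 * (ν / 40)) / g + 1 := by
      rw [hD]; exact Nat.ceil_lt_add_one (by positivity)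
    have h2 : D * g ≤ ((ν + 3 * (ν / 40)) / g + 1) * g := by gcongr
    have h3 : ((ν + 3 * (ν / 40)) / g + 1) * g = ν + 3 * (ν / 40) + g := by field_simp
    linarith
  -- A shift by `D` steps uses `39/40` of the privacy budget; the last `ε/40` pays for the factor `1
  -- - δ`.
  obtain ⟨q, hq⟩ : ∃ q, q = 39 / 40 * ε / D := ⟨_, rfl⟩
  have hq0 : 0 < q := by rw [hq]; positivity
  have hqD : D * q = 39 / 40 * ε := by rw [hq]; field_simp
  have hqc : q ≤ c / 40 := by
    have h1 : l ≤ D * α / 40 := by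
      have : ν * l ≤ ν * (D * α / 40) := by
        have h2 : ν * (40 * l) ≤ D * g * (40 * l) := mul_le_mul_of_nonneg_right hDg (by positivity)
        have h3 : D * g * (40 * l) = D * (ν * α) := by rw [← hgmul]; ring
        linarith only [h2, h3]
      exact le_of_mul_le_mul_left this hν0
    have h2 : q * l ≤ c / 40 * l := by
      calc q * l ≤ q * (D * α / 40) := by gcongr
        _ = 39 / 40 * ε * α / 40 := by rw [← hqD]; ring
        _ ≤ c / 40 * l := by linarith only [mul_pos hα hε, hsmall]
    exact le_of_mul_le_mul_right h2 hl0
  obtain ⟨s, hs⟩ : ∃ s, s = ⌈3 / 2 * c * l / q⌉₊ := ⟨_, rfl⟩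
  have hs0 : 0 < s := by rw [hs]; exact Nat.ceil_pos.2 (by positivity)
  have hs1 : 3 / 2 * c * l ≤ q * s := by
    have := Nat.le_ceil (3 / 2 * c * l / q)
    rw [← hs, div_le_iff₀ hq0] at this
    linarith
  have hθ : g * s ≤ 7 * α / 128 := by
    have h1 : (s : ℝ) ≤ 3 / 2 * c * l / q + 1 := by
      rw [hs]; exact (Nat.ceil_lt_add_one (by positivity)).le
    have h2 : g * s ≤ g * (3 / 2 * c * l / q + 1) := by gcongr
    have h3 : g * (3 / 2 * c * l / q) = 3 / 2 * c * l * (D * g) * (40 / (39 * ε)) := by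
      rw [hq]; field_simp
    have h4 : 3 / 2 * c * l * (D * g) * (40 / (39 * ε)) ≤
        3 / 2 * c * l * (44 / 40 * ν) * (40 / (39 * ε)) := by gcongr
    have h5 : 3 / 2 * c * l * (44 / 40 * ν) * (40 / (39 * ε)) = 66 / 39 * (α / 32) := by
      have : c * l * ν = α * ε / 32 := by linarith
      calc _ = (c * l * ν) * (66 / (39 * ε)) := by ring
        _ = _ := by rw [this]; field_simp
    linarith
  -- Since `log (1 + x/N) ≤ x/N`, this grid covers all `x ≤ 2n³`, so good estimates are never
  -- clipped. Its size matters only through `log (K + 1)`.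
  obtain ⟨K, hK⟩ : ∃ K, K = ⌈2 * (n : ℝ) ^ 3 / (N * g)⌉₊ + 1 := ⟨_, rfl⟩
  have hK0 : 0 < K := by omega
  have hK1 : 2 * (n : ℝ) ^ 3 ≤ K * g * N := by
    have h1 := Nat.le_ceil (2 * (n : ℝ) ^ 3 / (N * g))
    rw [div_le_iff₀ (by positivity)] at h1
    have h2 : (K : ℝ) = ⌈2 * (n : ℝ) ^ 3 / (N * g)⌉₊ + 1 := by rw [hK]; push_cast; ring
    have h3 := mul_pos hN0 hg0
    rw [h2, mul_assoc, mul_comm g N, add_mul, one_mul]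
    linarith only [h1, h3]
  have hK2 : (K : ℝ) + 1 ≤ 83 * ((n : ℝ) ^ 3 / α) := by
    have h1 : (K : ℝ) ≤ 2 * (n : ℝ) ^ 3 / (N * g) + 2 := by
      rw [hK]; push_cast
      linarith [Nat.ceil_lt_add_one (by positivity : 0 ≤ 2 * (n : ℝ) ^ 3 / (N * g))]
    have h2 : 2 * (n : ℝ) ^ 3 / (N * g) = 80 * ((n : ℝ) ^ 2 * l / α) := by
      rw [hN, hg]; field_simp; ring
    have h3 : (n : ℝ) ^ 2 * l / α ≤ (n : ℝ) ^ 3 / α := by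
      rw [pow_succ (n : ℝ) 2]; gcongr
    have h4 : 1 ≤ (n : ℝ) ^ 3 / α := by
      rw [le_div_iff₀ hα]; linarith only [one_le_pow₀ hn1.le (n := 3), hα1]
    linarith
  exact ⟨ν, N, g, q, D, s, K, hν, hν0, hν1, hN, hN0, hg0, hD, hq0, hqD, hqc, hs0, hs1, hθ, hK0, hK1,
    hK2⟩

/-- The weight of the uniform distribution and the failure probability of the estimator. -/
theorem exists_mix (K : ℕ) {c ε l : ℝ} (hl : 1 ≤ l) (hc : 0 < c) (hε : 0 < ε) :
    ∃ ζ δ : ℝ, 0 < ζ ∧ ζ ≤ 1 ∧ 0 < δ ∧ δ < 1 ∧ δ ≤ ζ ∧ δ * (K + 1) ≤ (Real.exp ε - 1) * ζ ∧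
      Real.exp (-(ε / 40)) ≤ 1 - δ ∧
      2 * ζ + Real.exp (-(c * l)) * Real.exp (-(19 / 40 * c)) = Real.exp (-(c * l)) ∧
      Real.log (1 / δ) ≤ Real.log (2 / (1 - Real.exp (-(19 / 40 * c)))) + c * l + 40 / ε +
        Real.log (K + 1) := by
  have he1 : Real.exp (-(19 / 40 * c)) < 1 := Real.exp_lt_one_iff.2 (by linarith)
  have he0 := Real.exp_pos (-(19 / 40 * c))
  -- Half of what the geometric tail leaves of `exp (-(c l)) = n ^ (-c)`; the other half covers `δ ≤
  -- ζ`.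
  obtain ⟨ζ, hζ⟩ : ∃ ζ, ζ = (1 - Real.exp (-(19 / 40 * c))) / 2 * Real.exp (-(c * l)) := ⟨_, rfl⟩
  have hel0 := Real.exp_pos (-(c * l))
  have hel1 : Real.exp (-(c * l)) ≤ 1 := Real.exp_le_one_iff.2 (by nlinarith)
  have hζ0 : 0 < ζ := by rw [hζ]; exact mul_pos (by linarith) hel0
  have hζ1 : ζ ≤ 1 := by rw [hζ]; nlinarith
  have hζ2 : 2 * ζ + Real.exp (-(c * l)) * Real.exp (-(19 / 40 * c)) = Real.exp (-(c * l)) := by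
    rw [hζ]; ring
  -- One factor for two demands on `δ`: `r ≤ exp ε - 1` serves the absorption into the uniform part,
  -- and `δ ≤ r` gives `exp (-(ε/40)) ≤ 1 - δ`.
  obtain ⟨r, hr⟩ : ∃ r, r = 1 - Real.exp (-(ε / 40)) := ⟨_, rfl⟩
  have hr0 : 0 < r := by
    rw [hr]; linarith [Real.exp_lt_one_iff.2 (by linarith : -(ε / 40) < 0)]
  have hr1 : r < 1 := by rw [hr]; linarith [Real.exp_pos (-(ε / 40))]
  have hrε : r ≤ Real.exp ε - 1 := by
    have h1 := Real.one_sub_le_exp_neg (ε / 40)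
    have h2 := Real.add_one_le_exp ε
    rw [hr]; linarith
  have hKR : (0 : ℝ) < K + 1 := by positivity
  obtain ⟨δ, hδ⟩ : ∃ δ, δ = ζ * r / (K + 1) := ⟨_, rfl⟩
  have hδ0 : 0 < δ := by rw [hδ]; positivity
  have hδK : δ * (K + 1) = ζ * r := by rw [hδ]; field_simp
  have hδζr : δ ≤ ζ * r := by
    rw [← hδK]; exact le_mul_of_one_le_right hδ0.le (by linarith [Nat.cast_nonneg (α := ℝ) K])
  have hδζ : δ ≤ ζ := hδζr.trans (mul_le_of_le_one_right hζ0.le hr1.le)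
  have hδr : δ ≤ r := hδζr.trans (mul_le_of_le_one_left hr0.le hζ1)
  have hδ1 : δ < 1 := lt_of_le_of_lt hδr hr1
  have hlogδ : Real.log (1 / δ) ≤ Real.log (2 / (1 - Real.exp (-(19 / 40 * c)))) + c * l + 40 / ε +
      Real.log (K + 1) := by
    have h0 : 0 < 2 / (1 - Real.exp (-(19 / 40 * c))) := div_pos two_pos (by linarith)
    have h1 : 1 / δ = 2 / (1 - Real.exp (-(19 / 40 * c))) * Real.exp (c * l) * (1 / r) * (K + 1) := by
      have : (1 - Real.exp (-(19 / 40 * c))) ≠ 0 := by linarith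
      rw [hδ, hζ, Real.exp_neg (c * l)]
      field_simp
    rw [h1, Real.log_mul (by positivity) (by positivity), Real.log_mul (by positivity) (by positivity),
      Real.log_mul (by positivity) (by positivity), Real.log_exp]
    have h2 : Real.log (1 / r) ≤ 40 / ε := by
      rw [hr]
      refine (log_one_div_one_sub_exp_neg_le (by positivity)).trans_eq ?_
      field_simp
    linarith
  refine ⟨ζ, δ, hζ0, hζ1, hδ0, hδ1, hδζ, ?_, by linarith, hζ2, hlogδ⟩
  rw [hδK, mul_comm]; gcongr

theorem log_grid_le {n : ℕ} {α k : ℝ} (hn : (0 : ℝ) < n) (hα : 0 < α) (hk : 0 < k)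
    (h : k ≤ 83 * ((n : ℝ) ^ 3 / α)) : Real.log k ≤ 83 + 3 * Real.log n + Real.log (1 / α) := by
  refine (Real.log_le_log hk h).trans ?_
  rw [div_eq_mul_one_div, Real.log_mul (by norm_num) (by positivity),
    Real.log_mul (by positivity) (by positivity), Real.log_pow]
  have := Real.log_le_sub_one_of_pos (by norm_num : (0 : ℝ) < 83)
  push_cast
  linarith

namespace Alg

/-- A private sublinear estimator of the number of triangles, for moderate accuracy. -/
theorem exists_private_estimator {n : ℕ} {c ε α : ℝ} (hn : 1 ≤ Real.log n) (hc : 0 < c)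
    (hε : 0 < ε) (hα : 0 < α) (hα1 : α < 1) (hsmall : α * ε < c * Real.log n) :
    ∃ T : Alg n ℝ,
      (∀ I₁ I₂ : GraphInput n, EdgeNeighboring I₁.graph I₂.graph → ∀ S : Set ℝ,
        (T.prob I₁ fun x _ => x ∈ S) ≤ Real.exp ε * T.prob I₂ fun x _ => x ∈ S) ∧
      ∀ (I : GraphInput n) (t β η : ℝ), t = numTriangles I.graph →
        β = α / 4 + α * ε / (4 * c * Real.log n) → η = 2 * c / ε * (n * Real.log n) →
        1 - 1 / (n : ℝ) ^ c ≤ (T.prob I fun x _ => x ∈ Set.Icc ((1 - β) * t - η) ((1 + β) * t + η)) ∧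
        (0 < t → 1 - 1 / (n : ℝ) ^ c ≤ T.prob I fun _ k => (k : ℝ) ≤
          10 ^ 21 * baseCost n t (numEdges I.graph) *
            (85 + 4 * Real.log n + c * Real.log n + 1280 * (c * Real.log n / (α * ε)) + 40 / ε
              + Real.log (2 / (1 - Real.exp (-(19 / 40 * c)))) + Real.log (1 / α)) ^ 6) := by
  set l := Real.log n with hl
  have hl0 : 0 < l := by linarith
  have hn1 : (1 : ℝ) < n := by
    by_contra h
    have := Real.log_nonpos (Nat.cast_nonneg n) (not_lt.1 h)
    linarith
  have hn0 : 0 < n := by exact_mod_cast zero_lt_one.trans hn1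
  have hnR : (0 : ℝ) < n := by exact_mod_cast hn0
  have hln : l ≤ n := (Real.log_le_sub_one_of_pos hnR).trans (by linarith)
  have hpow : 1 / (n : ℝ) ^ c = Real.exp (-(c * l)) := by
    rw [Real.rpow_def_of_pos hnR, ← hl, one_div, ← Real.exp_neg, mul_comm]
  obtain ⟨ν, N, g, q, D, s, K, hν, hν0, hν1, hN, hN0, hg0, hD, hq0, hqD, hqc, hs0, hs1, hθ, hK0, hK1,
    hK2⟩ := exists_grid hn1 hn hln hc hε hα hα1 hsmall
  have hνN : ν * N = n := by rw [hN]; field_simp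
  obtain ⟨ζ, δ, hζ0, hζ1, hδ0, hδ1, hδζ, hδK, hδε, hζ2, hlogδ⟩ := exists_mix K hn hc hε
  have hKα := log_grid_le hnR hα (by positivity) hK2
  obtain ⟨A, hA⟩ := exists_estimator hn0 (a := ν / 40) (δ := δ) (by positivity) (by linarith) hδ0 hδ1.le
  obtain ⟨G, hG⟩ : ∃ G : GraphInput n → Set ℝ, G = fun I => Set.Icc
    ((1 - ν / 40) * (numTriangles I.graph : ℝ)) ((1 + ν / 40) * numTriangles I.graph) := ⟨_, rfl⟩
  have hAG (I : GraphInput n) : (A.prob I fun x _ => x ∉ G I) ≤ δ := by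
    refine (prob_mono I A fun x k h => ?_).trans (hA I)
    rw [hG] at h
    exact fun h' => h h'.1
  have ha0 : 0 ≤ Real.exp (-q) := (Real.exp_pos _).le
  have ha1 : Real.exp (-q) ≤ 1 := Real.exp_le_one_iff.2 (by linarith)
  refine ⟨privatize ha0 ha1 hζ0.le hζ1 hK0 (gridIdx N g K) gridIdx_le
    (gridOut N g) A, ?_, ?_⟩
  · intro I₁ I₂ hI S
    refine prob_privatize_le (D := D) (δ := δ) ha0 ha1 hζ0.le hζ1 hK0 _ _ A I₁ I₂ S (hAG I₁) (hAG I₂)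
      ?_ (Real.one_le_exp hε.le) hδ0.le hδ1 ?_ ?_
    · intro x hx y hy
      rw [hG] at hx hy
      rw [hD]
      refine dist_gridIdx_le hN0 hg0 (by positivity) (by linarith) (Nat.cast_nonneg _)
        (Nat.cast_nonneg _) ?_ ?_ hν0.le hx hy
      · rw [hνN]; exact_mod_cast numTriangles_le_add hI
      · rw [hνN]; exact_mod_cast numTriangles_le_add hI.symm
    · rw [← Real.exp_nat_mul, mul_neg, hqD]
      calc (1 : ℝ) = Real.exp ε * (Real.exp (-(39 / 40 * ε)) * Real.exp (-(ε / 40))) := by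
            rw [← Real.exp_add, ← Real.exp_add, ← Real.exp_zero]; congr 1; ring
        _ ≤ _ := by
            gcongr
    · exact hδK
  · intro I t β η ht hβ hη
    have ht0 : 0 ≤ t := by rw [ht]; positivity
    have htn : t ≤ (n : ℝ) ^ 3 := by rw [ht]; exact I.numTriangles_le
    have hβ' : β = α / 4 + 8 * ν := by rw [hβ, hν]; field_simp; ring
    have hηN : η = N * (α / 16) := by rw [hη, hN, hν]; field_simp; ring
    refine ⟨?_, fun ht1 => ?_⟩
    · refine le_trans ?_ (prob_privatize_ge ha0 ha1 hζ0.le hζ1 hK0 _ _ A I (s := s) hs0 (hAG I) ?_)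
      · rw [hpow]
        linarith [geometric_tail_le hc hn hq0.le hqc hs1]
      · intro x hx j _ hj
        simp only [hG, ← ht] at hx
        have hx0 : 0 ≤ x := (mul_nonneg (by linarith) ht0).trans hx.1
        have hxK : x ≤ K * g * N := by
          refine hx.2.trans (le_trans ?_ hK1)
          nlinarith
        obtain ⟨h1, h2⟩ := gridOut_bounds hN0 hg0 hx0 hxK hj
        have e1 : 1 - α / 16 ≤ Real.exp (-(g * s)) := by
          linarith [Real.one_sub_le_exp_neg (g * s)]
        have e2 := exp_le_one_add_div hα hα1 hθ
        have hNx : 0 ≤ N + x := by positivity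
        have e3 : (N + x) * (1 - α / 16) ≤ (N + x) * Real.exp (-(g * s)) := by gcongr
        have e4 : (N + x) * Real.exp (g * s) ≤ (N + x) * (1 + α / 16) := by gcongr
        have e5 : (1 - ν / 40) * t * (1 - α / 16) ≤ x * (1 - α / 16) :=
          mul_le_mul_of_nonneg_right hx.1 (by linarith)
        have e6 : x * (1 + α / 16) ≤ (1 + ν / 40) * t * (1 + α / 16) :=
          mul_le_mul_of_nonneg_right hx.2 (by linarith)
        have e7 : 0 ≤ α * t := by positivity
        have e8 : 0 ≤ ν * t := by positivity
        have e9 : 0 ≤ ν * t * α := by positivity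
        have e10 : ν * t * α ≤ ν * t := mul_le_of_le_one_right e8 hα1.le
        rw [hβ', hηN]
        constructor <;> linarith
    · refine le_of_le_of_eq ?_
        (prob_privatize_cost ha0 ha1 hζ0.le hζ1 hK0 _ _ A I fun k => (k : ℝ) ≤ _).symm
      have h1 := hA I
      rw [prob_not] at h1
      have h2 : δ ≤ 1 / (n : ℝ) ^ c := by
        rw [hpow]
        have := mul_pos (Real.exp_pos (-(c * l))) (Real.exp_pos (-(19 / 40 * c)))
        linarith
      refine (sub_le_comm.1 (h1.trans h2)).trans (prob_mono I A fun x k h => (h.2 ?_).trans ?_)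
      · rw [ht] at ht1; exact_mod_cast ht1
      · rw [← ht]
        have hb : 0 ≤ baseCost n t (numEdges I.graph) := by unfold baseCost; positivity
        have hld : 0 ≤ Real.log (1 / δ) := Real.log_nonneg (by rw [le_div_iff₀ hδ0]; linarith)
        have hinv : 1 / (ν / 40) = 1280 * (c * l / (α * ε)) := by
          rw [hν]; field_simp; norm_num
        have h3 : 0 ≤ 1 + l + 1 / (ν / 40) + Real.log (1 / δ) := by positivity
        refine mul_le_mul_of_nonneg_left (pow_le_pow_left₀ h3 ?_ 6) (by positivity)
        rw [hinv]
        linarith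

end Alg
end TriangleDP

/-! ### Extreme parameters and the final statement -/

namespace TriangleDP

theorem numTriangles_eq_zero {n : ℕ} (hn : n ≤ 2) (G : SimpleGraph (Fin n)) : numTriangles G = 0 := by
  have : G.cliqueSet 3 = ∅ := by
    ext s
    simp only [SimpleGraph.mem_cliqueSet_iff, Set.mem_empty_iff_false, iff_false]
    intro h
    have h1 := h.card_eq
    have h2 := s.card_le_univ
    rw [Fintype.card_fin] at h2
    omega
  rw [numTriangles, this, Set.ncard_empty]

/-- Here `u = 1/(α ε)`. The mixed term `l u`, which comes from the precision `ν`, forces the square.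
-/
theorem cost_factor_le {c l u M Q x y : ℝ} (hc : 0 ≤ c) (hl : 0 ≤ l) (hu : 0 ≤ u) (hM : 0 ≤ M)
    (hQ : 0 ≤ Q) (hx : x ≤ 40 * u) (hy : y ≤ Q + 5 * l + u) :
    85 + 4 * l + c * l + 1280 * (c * l * u) + x + M + y ≤
      (137 + 1281 * c + Q + M) * (1 + l + u) ^ 2 := by
  have hlu := mul_nonneg hl hu
  have hW1 : 1 + 2 * l + 2 * u ≤ (1 + l + u) ^ 2 := by nlinarith [sq_nonneg l, sq_nonneg u]
  have hWl : l ≤ (1 + l + u) ^ 2 := by linarith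
  have hWlu : l * u ≤ (1 + l + u) ^ 2 := by nlinarith [sq_nonneg l, sq_nonneg u]
  have f1 := mul_le_mul_of_nonneg_left hWl hc
  have f2 := mul_le_mul_of_nonneg_left hWlu hc
  have f3 : M * 1 ≤ M * (1 + l + u) ^ 2 := mul_le_mul_of_nonneg_left (by linarith) hM
  have f4 : Q * 1 ≤ Q * (1 + l + u) ^ 2 := mul_le_mul_of_nonneg_left (by linarith) hQ
  rw [← mul_assoc] at f2
  linarith

namespace Alg

theorem prob_pure_of_true {n : ℕ} {β : Type} (I : GraphInput n) (x : β) {P : β → ℕ → Prop}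
    (h : P x 0) : (pure x : Alg n β).prob I P = 1 := by
  simp [prob, ex, h]

/-- A private sublinear estimator of the number of triangles. -/
theorem exists_private {K : ℕ} (hK : 0 < K) {c : ℝ} (hc : 0 < c) {ε α : ℝ} (hε : 0 < ε)
    (hα : 0 < α) (hα1 : α < 1) {n : ℕ} (hn : 0 < n) :
    ∃ T : Alg n ℝ,
      (∀ I₁ I₂ : GraphInput n, EdgeNeighboring I₁.graph I₂.graph → ∀ S : Set ℝ,
        (T.prob I₁ fun x _ => x ∈ S) ≤ Real.exp ε * T.prob I₂ fun x _ => x ∈ S) ∧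
      ∀ (I : GraphInput n) (t α' err : ℝ), t = numTriangles I.graph →
        α' = α * (1 + ε / (c * Real.log n)) →
        err = 2 * c / ε * (n * Real.log n) + 1 / (K * (n : ℝ) ^ 3) →
        1 - 1 / (n : ℝ) ^ c ≤
          (T.prob I fun x _ => x ∈ Set.Icc ((1 - α') * t - err) ((1 + α') * t + err)) ∧
        (0 < t → 1 - 1 / (n : ℝ) ^ c ≤ T.prob I fun _ k => (k : ℝ) ≤
          10 ^ 21 * baseCost n t (numEdges I.graph) *
            ((137 + 1281 * c + 2 * c * K + Real.log (2 / (1 - Real.exp (-(19 / 40 * c))))) *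
              (1 + Real.log n + 1 / (α * ε)) ^ 2) ^ 6) := by
  have hnR : (0 : ℝ) < n := by exact_mod_cast hn
  have hKR : (1 : ℝ) ≤ K := by exact_mod_cast hK
  have hl0 : 0 ≤ Real.log n := Real.log_natCast_nonneg n
  have hpow : 0 ≤ 1 / (n : ℝ) ^ c := by positivity
  -- The constant `0` is accurate in both cases: there are no triangles, or `α' ≥ 1` makes the lower
  -- bound nonpositive.
  by_cases htriv : n ≤ 2 ∨ c * Real.log n ≤ α * ε
  · refine ⟨pure 0, fun I₁ I₂ _ S => ?_, fun I t α' err ht hα' herr => ⟨?_, fun ht0 => ?_⟩⟩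
    · have h1 : ((pure 0 : Alg n ℝ).prob I₁ fun x _ => x ∈ S) =
          (pure 0 : Alg n ℝ).prob I₂ fun x _ => x ∈ S := rfl
      rw [h1]
      exact le_mul_of_one_le_left (prob_nonneg _ _ _) (Real.one_le_exp hε.le)
    · rw [prob_pure_of_true]
      · linarith
      have herr0 : 0 ≤ err := by rw [herr]; positivity
      have ht0 : 0 ≤ t := by rw [ht]; positivity
      have hα0 : 0 ≤ α' := by rw [hα']; positivity
      have hup : 0 ≤ (1 + α') * t + err := by positivity
      refine ⟨?_, hup⟩
      rcases lt_or_ge 2 n with h2 | h2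
      · have hle := htriv.resolve_left (by omega)
        have hl : 0 < Real.log n := Real.log_pos (by exact_mod_cast (by omega : 1 < n))
        have h1 : 1 ≤ α * ε / (c * Real.log n) := by rwa [one_le_div (by positivity)]
        have h3 : α' = α + α * ε / (c * Real.log n) := by rw [hα']; ring
        nlinarith
      · rw [ht, numTriangles_eq_zero h2]
        simpa using herr0
    · rw [prob_pure_of_true]
      · linarith
      have : 0 ≤ baseCost n t (numEdges I.graph) := by unfold baseCost; positivity
      simpa using by positivity
  push Not at htriv
  obtain ⟨hn2, hsmall⟩ := htriv
  have hl : 1 ≤ Real.log n := by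
    rw [Real.le_log_iff_exp_le hnR]
    have h3 : (3 : ℝ) ≤ n := by exact_mod_cast hn2
    linarith [Real.exp_one_lt_d9]
  obtain ⟨l, hll⟩ : ∃ l, l = Real.log n := ⟨_, rfl⟩
  rw [← hll] at hl hl0 hsmall
  have hn1 : (1 : ℝ) ≤ n := by exact_mod_cast hn
  have hln : l ≤ n := by rw [hll]; exact (Real.log_le_sub_one_of_pos hnR).trans (by linarith)
  have hlpos : 0 < l := by linarith
  -- The value of `ε` at which the additive error `2c/ε * n * l` equals `1 / (K n³)`; larger `ε` are
  -- not exploited.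
  obtain ⟨E, hE⟩ : ∃ E, E = 2 * c * K * (n : ℝ) ^ 4 * l := ⟨_, rfl⟩
  have hn4 : 1 ≤ (n : ℝ) ^ 4 := one_le_pow₀ hn1
  have hEc : c * l ≤ E := by
    have h1 : 1 ≤ 2 * (K * (n : ℝ) ^ 4) := by linarith [one_le_mul_of_one_le_of_one_le hKR hn4]
    calc c * l ≤ c * l * (2 * (K * (n : ℝ) ^ 4)) := le_mul_of_one_le_right (by positivity) h1
      _ = E := by rw [hE]; ring
  have hE0 : 0 < E := lt_of_lt_of_le (by positivity) hEc
  have hαε : 0 < α * ε := by positivity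
  obtain ⟨ε', hε'⟩ : ∃ ε', ε' = min ε E := ⟨_, rfl⟩
  have hε'0 : 0 < ε' := by rw [hε']; exact lt_min hε hE0
  have hε'ε : ε' ≤ ε := by rw [hε']; exact min_le_left _ _
  have hε'E : ε' ≤ E := by rw [hε']; exact min_le_right _ _
  -- Keeping the product `α ε` fixed leaves `ν` unchanged. It also gives `1/a ≤ E / (α ε)`, so that
  -- `log (1/a)` is controlled by `log n` and `1/(α ε)`, whereas `log (1/α)` would not be if `ε`
  -- were huge.
  obtain ⟨a, ha⟩ : ∃ a, a = α * ε / ε' := ⟨_, rfl⟩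
  have ha0 : 0 < a := by rw [ha]; positivity
  have haε : a * ε' = α * ε := by rw [ha]; field_simp
  have hcase : (ε' = ε ∧ a = α) ∨ (ε' = E ∧ a * E = α * ε) := by
    rcases min_choice ε E with h | h
    · left
      rw [h] at hε'
      refine ⟨hε', ?_⟩
      rw [ha, hε']; field_simp
    · right
      rw [h] at hε'
      exact ⟨hε', by rw [← hε', haε]⟩
  have ha1 : a < 1 := by
    rcases hcase with ⟨-, h⟩ | ⟨-, h⟩
    · rw [h]; exact hα1
    · by_contra h1
      have := mul_le_mul_of_nonneg_right (not_lt.1 h1) hE0.le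
      linarith
  have haα : a / 4 ≤ α / 4 + α * ε / (4 * (c * l)) := by
    have hp : 0 ≤ α * ε / (4 * (c * l)) := by positivity
    rcases hcase with ⟨-, h⟩ | ⟨-, h⟩
    · rw [h]; linarith
    · have : a / 4 ≤ α * ε / (4 * (c * l)) := by
        rw [div_le_div_iff₀ (by norm_num) (by positivity)]
        have := mul_le_mul_of_nonneg_left hEc ha0.le
        linarith
      linarith
  have hη : 2 * c / ε' * (n * l) ≤ 2 * c / ε * (n * l) + 1 / (K * (n : ℝ) ^ 3) := by
    rcases hcase with ⟨h, -⟩ | ⟨h, -⟩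
    · rw [h]
      have : 0 ≤ 1 / (K * (n : ℝ) ^ 3) := by positivity
      linarith
    · have h1 : 2 * c / ε' * (n * l) = 1 / (K * (n : ℝ) ^ 3) := by rw [h, hE]; field_simp
      have h2 : 0 ≤ 2 * c / ε * (n * l) := by positivity
      linarith
  have hsmall' : a * ε' < c * Real.log n := by rw [haε, ← hll]; exact hsmall
  obtain ⟨T, hT1, hT2⟩ := exists_private_estimator (by rwa [← hll]) hc hε'0 ha0 ha1 hsmall'
  refine ⟨T, fun I₁ I₂ h S => (hT1 I₁ I₂ h S).trans ?_, fun I t α' err ht hα' herr => ?_⟩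
  · exact mul_le_mul_of_nonneg_right (Real.exp_le_exp.2 hε'ε) (prob_nonneg _ _ _)
  obtain ⟨h1, h2⟩ := hT2 I t _ _ ht rfl rfl
  have ht0 : 0 ≤ t := by rw [ht]; positivity
  rw [← hll] at h1 h2 hα' herr ⊢
  constructor
  · refine h1.trans (prob_mono I T fun x _ hx => ?_)
    have hβ : a / 4 + a * ε' / (4 * c * l) ≤ α' := by
      have e1 : α' = α + 4 * (α * ε / (4 * (c * l))) := by rw [hα']; field_simp
      have e2 : a * ε' / (4 * c * l) = α * ε / (4 * (c * l)) := by rw [haε, mul_assoc]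
      have hp : 0 ≤ α * ε / (4 * (c * l)) := by positivity
      rw [e1, e2]; linarith
    have hβt := mul_le_mul_of_nonneg_right hβ ht0
    rw [← herr] at hη
    exact ⟨by linarith [hx.1], by linarith [hx.2]⟩
  · intro ht1
    refine (h2 ht1).trans (prob_mono I T fun _ k hk => hk.trans ?_)
    have hb : 0 ≤ baseCost n t (numEdges I.graph) := by unfold baseCost; positivity
    obtain ⟨u, hu⟩ : ∃ u, u = 1 / (α * ε) := ⟨_, rfl⟩
    have hu0 : 0 < u := by rw [hu]; positivity
    obtain ⟨M, hM⟩ : ∃ M, M = Real.log (2 / (1 - Real.exp (-(19 / 40 * c)))) := ⟨_, rfl⟩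
    have hM0 : 0 ≤ M := by
      have h3 : Real.exp (-(19 / 40 * c)) < 1 := Real.exp_lt_one_iff.2 (by linarith)
      have h4 := Real.exp_pos (-(19 / 40 * c))
      rw [hM]
      refine Real.log_nonneg ?_
      rw [le_div_iff₀ (by linarith)]; linarith
    have hεu : 40 / ε' ≤ 40 * u := by
      have : α * ε ≤ ε' := by
        rw [← haε]; exact mul_le_of_le_one_left hε'0.le ha1.le
      calc 40 / ε' ≤ 40 / (α * ε) := by gcongr
        _ = 40 * u := by rw [hu]; ring
    have hinv : c * l / (a * ε') = c * l * u := by rw [haε, hu]; ring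
    have hloga0 : 0 ≤ Real.log (1 / a) := Real.log_nonneg (by rw [le_div_iff₀ ha0]; linarith)
    have hloga : Real.log (1 / a) ≤ 2 * c * K + 5 * l + u := by
      have e1 : 1 / a ≤ 2 * c * K * (n : ℝ) ^ 5 * u := by
        have : 1 / a = ε' * u := by rw [ha, hu]; field_simp
        rw [this]
        gcongr
        refine hε'E.trans ?_
        rw [hE, pow_succ (n : ℝ) 4, ← mul_assoc]
        gcongr
      refine (Real.log_le_log (by positivity) e1).trans ?_
      rw [Real.log_mul (by positivity) hu0.ne', Real.log_mul (by positivity) (by positivity),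
        Real.log_pow, ← hll]
      have e2 := Real.log_le_sub_one_of_pos (by positivity : 0 < 2 * c * K)
      have e3 := Real.log_le_sub_one_of_pos hu0
      push_cast
      linarith
    rw [hinv, ← hM, ← hu]
    have hlow : 0 ≤ 85 + 4 * l + c * l + 1280 * (c * l * u) + 40 / ε' + M + Real.log (1 / a) := by
      positivity
    refine mul_le_mul_of_nonneg_left (pow_le_pow_left₀ hlow ?_ 6) (by positivity)
    exact cost_factor_le hc.le hl0 hu0.le hM0 (by positivity) hεu hloga

end Alg
end TriangleDP

theorem mainTheorem5 (K : ℕ) (hK : 0 < K) (c : ℝ) (hc : 0 < c) :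
    ∃ C' C : ℝ, 0 < C' ∧ 0 < C ∧ ∃ k : ℕ,
      ∀ ε : ℝ, 0 < ε → ∀ α : ℝ, 0 < α → α < 1 →
        ∃ A : (n : ℕ) → TriangleDP.RandomizedAlgorithm n,
          ∀ n : ℕ, 0 < n →
            -- Privacy
            (A n).IsEdgeDP ε ∧
            ∀ I : TriangleDP.GraphInput n, ∀ t m α' err : ℝ,
              t = (TriangleDP.numTriangles I.graph : ℝ) →
              m = (TriangleDP.numEdges I.graph : ℝ) →
              α' = α * (1 + ε / (C' * Real.log n)) →
              err = 2 * c / ε * (n * Real.log n) + 1 / (K * (n : ℝ) ^ 3) →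
              -- Accuracy
              1 - 1 / (n : ℝ) ^ c - 1 / ((n : ℝ) ^ (c - 3) * (Real.exp ε - 1) / K + 1) ≤
                (A n).probOutput I (Set.Icc ((1 - α') * t - err) ((1 + α') * t + err)) ∧
              -- Queries
              (0 < t →
                1 - 1 / (n : ℝ) ^ c ≤
                  (A n).probQueriesLE I
                    (C * (n / t ^ (1 / 3 : ℝ) + m ^ (3 / 2 : ℝ) / t) *
                      (1 + Real.log n + 1 / (α * ε)) ^ k)) := by
  obtain ⟨B, hB⟩ : ∃ B, B = 137 + 1281 * c + 2 * c * K +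
    Real.log (2 / (1 - Real.exp (-(19 / 40 * c)))) := ⟨_, rfl⟩
  have hB0 : 0 < B := by
    have h3 : Real.exp (-(19 / 40 * c)) < 1 := Real.exp_lt_one_iff.2 (by linarith)
    have h4 := Real.exp_pos (-(19 / 40 * c))
    have h5 : 0 ≤ Real.log (2 / (1 - Real.exp (-(19 / 40 * c)))) := by
      refine Real.log_nonneg ?_
      rw [le_div_iff₀ (by linarith)]; linarith
    rw [hB]; positivity
  -- The exponent is `12 = 2 * 6`: a quadratic bound for the factor of the estimator's cost that
  -- enters with the sixth power.
  refine ⟨c, 10 ^ 21 * B ^ 6, hc, by positivity, 12, fun ε hε α hα hα1 => ?_⟩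
  have hT (n : ℕ) (hn : 0 < n) := TriangleDP.Alg.exists_private hK hc hε hα hα1 hn
  choose T hT using hT
  have hA (n : ℕ) : ∃ A : TriangleDP.RandomizedAlgorithm n, ∀ hn : 0 < n,
      TriangleDP.Alg.Realizes A (T n hn) := by
    rcases Nat.eq_zero_or_pos n with h | h
    · obtain ⟨A, -⟩ := TriangleDP.Alg.exists_realizes (.pure 0 : TriangleDP.Alg n ℝ)
      exact ⟨A, fun h' => absurd h h'.ne'⟩
    · obtain ⟨A, hA⟩ := TriangleDP.Alg.exists_realizes (T n h)
      exact ⟨A, fun _ => hA⟩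
  choose A hA using hA
  refine ⟨A, fun n hn => ⟨fun I₁ I₂ h S hS => ?_, fun I t m α' err ht hm hα' herr => ?_⟩⟩
  · rw [(hA n hn).probOutput_eq I₁ hS, (hA n hn).probOutput_eq I₂ hS]
    exact (hT n hn).1 I₁ I₂ h S
  · obtain ⟨h1, h2⟩ := (hT n hn).2 I t α' err ht hα' herr
    rw [(hA n hn).probOutput_eq I measurableSet_Icc, (hA n hn).probQueriesLE_eq]
    refine ⟨le_trans ?_ h1, fun ht0 => (h2 ht0).trans_eq ?_⟩
    -- Accuracy holds already with failure probability `1 / n ^ c`; the second allowance is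
    -- nonnegative and is simply given away.
    · have he : 0 ≤ Real.exp ε - 1 := by linarith [Real.one_le_exp hε.le]
      have : 0 ≤ 1 / ((n : ℝ) ^ (c - 3) * (Real.exp ε - 1) / K + 1) := by positivity
      linarith
    · rw [← hB, ← hm, mul_pow, ← pow_mul, TriangleDP.Alg.baseCost]
      congr! 4
      ring
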